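/- Let $\mathbb{F}_q$ be a finite field with $q$ elements, let $C$ be a smooth connected projective curve over $\mathbb{F}_q$ with function field $F$, let $\infty\in C$ be a closed point, and let $A\subset F$ be the ring of functions that are regular outside $\infty$. Let $\Omega_A$ be the module of Kähler differentials of $A$ over $\mathbb{F}_q$. Let $\mathfrak p\neq\infty$ be a place of $F$, that is, a maximal ideal of $A$, let $F_{\mathfrak p}$ be the completion of $F$ at $\mathfrak p$ and $A_{\mathfrak p}$ its valuation ring. Fix an integer $r\ge1$. For a field $K$ over $\mathbb{F}_q$ with algebraic closure $\bar K$ let $K[\tau]$ be the twisted polynomial ring with $\tau\xi=\xi^q\tau$, acting on $\bar K$ by $(\sum_i\psi_i\tau^i)(\xi)=\sum_i\psi_i\xi^{q^i}$. Let $\phi\colon A\to K[\tau]$, $a\mapsto\phi_a$, be a Drinfeld $A$-module of rank $r$ over $K$, that is, an $\mathbb{F}_q$-algebra homomorphism such that for every $a\ne0$ the polynomial $\phi_a$ has degree $r\dim_{\mathbb{F}_q}(A/Aa)$ in $\tau$. No condition is imposed on the kernel $\wp$ of its characteristic $A\to K$; in particular $\mathfrak p=\wp$ is allowed. View $\bar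 K$ as an $A$-module through $\phi$, let $\phi[\mathfrak p^i]\subset\bar K$ be its $\mathfrak p^i$-torsion submodule, and put $$T_{\mathfrak p}(\phi)=\operatorname{Hom}_A\bigl(F_{\mathfrak p}/A_{\mathfrak p},\textstyle\bigcup_i\phi[\mathfrak p^i]\bigr),\qquad V_{\mathfrak p}(\phi)=T_{\mathfrak p}(\phi)\otimes_{A_{\mathfrak p}}F_{\mathfrak p}.$$ Let $M=K[\tau]$ be the $A$-motive of $\phi$, with the $A\otimes_{\mathbb{F}_q}K$-module structure $(a\otimes\xi)m=\xi m\phi_a$ and with $\tau$ acting by left multiplication. For any field $K'$ over $\mathbb{F}_q$ let $\mathcal E_{K'}=F_{\mathfrak p}\mathbin{\hat\otimes}_{\mathbb{F}_q}K'$, with $K'$ discrete, endowed with the partial Frobenius $\sigma\colon a\otimes\xi\mapsto a\otimes\xi^q$. Let $M_{F,\mathfrak p}=\mathcal E_K\otimes_{A\otimes K}M$ with the induced $\sigma$-semilinear map $\tau$, and let $$T_0(M_{F,\mathfrak p})=\bigl(\mathcal E_{\bar K}\otimes_{\mathcal E_K}M_{F,\mathfrak p}\bigr)^{\tau}$$ be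 the $F_{\mathfrak p}$-vector space of $\tau$-invariants. The group $\Gamma_K=\operatorname{Aut}(\bar K/K)$ acts on $V_{\mathfrak p}(\phi)$ and $T_0(M_{F,\mathfrak p})$ through $\bar K$, contragrediently on the dual $T_0(M_{F,\mathfrak p})^\vee$ over $F_{\mathfrak p}$, and trivially on $\Omega_A$. Then there are $\Gamma_K$-equivariant isomorphisms of $F_{\mathfrak p}$-vector spaces $$V_{\mathfrak p}(\phi)\;\cong\;T_0(M_{F,\mathfrak p})^\vee\otimes_A\Omega_A$$ for all $K$, $\bar K$ and $\phi$ as above, which are natural in the following sense. (a) For every homomorphism $u\colon\phi\to\psi$ of Drinfeld modules of rank $r$ over $K$, that is, $u\in K[\tau]$ with $u\phi_a=\psi_au$ for all $a\in A$, the isomorphisms commute with the maps induced by $\xi\mapsto u(\xi)$ on the left side and by $M_\psi\to M_\phi$, $m\mapsto mu$, on the right side. (b) For all $\mathbb{F}_q$-embeddings $i\colon K\to K'$ and $\bar K\to\bar K'$ that are compatible with each other, with $\phi'$ the base change of $\phi$ along $i$ and with $M'$ the motive of $\phi'$, the isomorphism for $\phi$ is the composite of the induced map $V_{\mathfrak p}(\phi)\to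 V_{\mathfrak p}(\phi')$, the isomorphism for $\phi'$, and the map $T_0(M'_{F,\mathfrak p})^\vee\otimes_A\Omega_A\to T_0(M_{F,\mathfrak p})^\vee\otimes_A\Omega_A$ dual to the induced map $T_0(M_{F,\mathfrak p})\to T_0(M'_{F,\mathfrak p})$. -/

import Mathlib

open scoped TensorProduct

noncomputable section

/-! ## The ring of coefficients -/

/-- Let `A` be a Dedekind domain of finite type over a finite field, not a field, with fraction
field `F`, so that `Spec A` is a smooth connected affine curve with function field `F`. The closed
points of the smooth projective curve `C` with function field `F` are the places of `F`, that is,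
its valuation rings other than `F`, and those on `Spec A` are the ones that contain `A`. So the
following says that `Spec A = C ∖ {∞}` for one closed point `∞`; equivalently, `A` consists of
the functions on `C` that are regular outside `∞`. -/
def HasUniquePlaceAtInfinity (A F : Type*) [CommRing A] [Field F] [Algebra A F] : Prop :=
  ∃! v : ValuationSubring F, v ≠ ⊤ ∧ ¬ (algebraMap A F).range ≤ v.toSubring

/-! ## The twisted polynomial ring `K[τ]` over a field `K` containing the finite field `Fq` -/

section TwistedPolynomials

variable (Fq : Type*) [Field Fq] [Fintype Fq]

/-- The action of the monoid `ℕ` (written multiplicatively) on an `Fq`-algebra `K` through the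
iterates of the `q`-Frobenius `x ↦ x ^ q`, where `q` is the order of `Fq`. -/
@[reducible]
def frobeniusAction (K : Type*) [CommRing K] [Algebra Fq K] :
    MulSemiringAction (Multiplicative ℕ) K :=
  MulSemiringAction.compHom K (powersHom (K →+* K) (FiniteField.frobeniusAlgHom Fq K).toRingHom)

/-- The twisted polynomial ring `K[τ]`: finite sums `∑ ψ_i τ ^ i` with `ψ_i ∈ K` and with the
multiplication determined by `τ ψ = ψ ^ q τ`. -/
def TwistedPoly (K : Type*) [CommRing K] [Algebra Fq K] : Type _ :=
  SkewPolynomial K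

namespace TwistedPoly

variable {Fq}
variable {K : Type*} [CommRing K] [Algebra Fq K]
variable {K' : Type*} [CommRing K'] [Algebra Fq K']
variable {K'' : Type*} [CommRing K''] [Algebra Fq K'']

instance : Ring (TwistedPoly Fq K) :=
  letI := frobeniusAction Fq K
  inferInstanceAs (Ring (SkewMonoidAlgebra K (Multiplicative ℕ)))

/-- The coefficient of `τ ^ n`. -/
def coeff (f : TwistedPoly Fq K) (n : ℕ) : K := SkewPolynomial.coeff f n

/-- The monomial `x τ ^ n`. -/
def monomial (n : ℕ) (x : K) : TwistedPoly Fq K := SkewPolynomial.monomial n x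

/-- The constants `K → K[τ]`. -/
def C : K →+* TwistedPoly Fq K :=
  letI := frobeniusAction Fq K
  (SkewPolynomial.CRingHom : K →+* SkewPolynomial K)

/-- The indeterminate `τ`. -/
def tau : TwistedPoly Fq K := monomial 1 1

/-- `ψ ∈ K[τ]` is elliptic of degree `d`: its highest term is `ψ_d τ ^ d`, and `ψ_d` is a unit. -/
def IsElliptic (f : TwistedPoly Fq K) (d : ℕ) : Prop :=
  IsUnit (f.coeff d) ∧ ∀ n, d < n → f.coeff n = 0

lemma induction_on {P : TwistedPoly Fq K → Prop} (f : TwistedPoly Fq K)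
    (add : ∀ f g, P f → P g → P (f + g)) (mon : ∀ n x, P (monomial n x)) : P f := by
  refine SkewPolynomial.induction (motive := P) f ?_ ?_
  · have h := mon 0 0
    have h0 : (monomial 0 0 : TwistedPoly Fq K) = 0 := SkewPolynomial.monomial_zero_right 0
    rwa [h0] at h
  · intro n r g _ _ hg
    exact add _ _ (mon n r) hg

lemma frobeniusAction_smul (n : ℕ) (x : K) :
    (letI := frobeniusAction Fq K; Multiplicative.ofAdd n • x)
      = x ^ (Fintype.card Fq) ^ n := by
  change (((FiniteField.frobeniusAlgHom Fq K).toRingHom) ^ n) x = _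
  induction n with
  | zero => simp
  | succ n ih =>
    rw [pow_succ', RingHom.mul_def, RingHom.comp_apply, ih]
    simp [pow_succ, pow_mul]

lemma monomial_mul_monomial (n m : ℕ) (x y : K) :
    (monomial n x * monomial m y : TwistedPoly Fq K)
      = monomial (n + m) (x * y ^ (Fintype.card Fq) ^ n) := by
  let := frobeniusAction Fq K
  have h := SkewPolynomial.monomial_mul_monomial n m x y
  rw [SkewPolynomial.φ_iterate_apply] at h
  have h2 := frobeniusAction_smul (Fq := Fq) n y
  exact h.trans (by rw [h2]; rfl)

lemma C_eq_monomial (x : K) : (C x : TwistedPoly Fq K) = monomial 0 x := rfl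

lemma monomial_eq (n : ℕ) (x : K) : (monomial n x : TwistedPoly Fq K) = C x * tau ^ n := by
  have h : ∀ n, (tau ^ n : TwistedPoly Fq K) = monomial n 1 := by
    intro n
    induction n with
    | zero => rfl
    | succ n ih => rw [pow_succ, ih, tau, monomial_mul_monomial]; simp
  rw [h, C_eq_monomial, monomial_mul_monomial]
  simp

lemma tau_mul_C (x : K) : (tau * C x : TwistedPoly Fq K) = C (x ^ Fintype.card Fq) * tau := by
  rw [tau, C_eq_monomial, C_eq_monomial, monomial_mul_monomial, monomial_mul_monomial]
  simp

/-- The constants from `Fq` are central. -/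
instance : Algebra Fq (TwistedPoly Fq K) :=
  RingHom.toAlgebra' ((C : K →+* TwistedPoly Fq K).comp (algebraMap Fq K)) fun c f => by
    induction f using induction_on with
    | add f g hf hg => rw [mul_add, add_mul, hf, hg]
    | mon n x =>
      rw [RingHom.comp_apply, C_eq_monomial, monomial_mul_monomial, monomial_mul_monomial]
      rw [← map_pow, FiniteField.pow_card_pow]
      simp [mul_comm]

lemma algebraMap_eq (c : Fq) :
    algebraMap Fq (TwistedPoly Fq K) c = C (algebraMap Fq K c) := rfl

/-- A ring homomorphism out of `K[τ]`, from a ring homomorphism `f` on `K` and an image `t` of `τ`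
with `t f(x) = f(x ^ q) t`. -/
def lift {S : Type*} [Ring S] (f : K →+* S) (t : S)
    (h : ∀ x, t * f x = f (x ^ Fintype.card Fq) * t) : TwistedPoly Fq K →+* S :=
  letI := frobeniusAction Fq K
  SkewMonoidAlgebra.liftNCRingHom f (powersHom S t) (by
    intro x n
    have key : ∀ (n : ℕ) (x : K), f (x ^ (Fintype.card Fq) ^ n) * t ^ n = t ^ n * f x := by
      intro n
      induction n with
      | zero => simp
      | succ n ih =>
        intro x
        rw [pow_succ t, mul_assoc (t ^ n), h, ← mul_assoc (t ^ n), ← ih, ← pow_mul, ← pow_succ',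
          mul_assoc]
    have h2 := frobeniusAction_smul (Fq := Fq) n.toAdd x
    have h3 := key n.toAdd x
    rw [← h2] at h3
    exact h3)

lemma lift_monomial {S : Type*} [Ring S] (f : K →+* S) (t : S)
    (h : ∀ x, t * f x = f (x ^ Fintype.card Fq) * t) (n : ℕ) (x : K) :
    lift f t h (monomial n x) = f x * t ^ n := by
  let := frobeniusAction Fq K
  exact SkewMonoidAlgebra.liftNC_single _ _ _ _

/-- The left `K[τ]`-module structure on an extension `L` of `K`, where `∑ ψ_i τ ^ i` acts as
`x ↦ ∑ ψ_i x ^ (q ^ i)`. -/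
def eval (L : Type*) [CommRing L] [Algebra Fq L] [Algebra K L] [IsScalarTower Fq K L] :
    TwistedPoly Fq K →+* Module.End Fq L :=
  lift ((Algebra.lmul Fq L).toRingHom.comp (algebraMap K L))
    (FiniteField.frobeniusAlgHom Fq L).toLinearMap (fun x => by
      ext y
      simp [mul_pow])

lemma eval_monomial (L : Type*) [CommRing L] [Algebra Fq L] [Algebra K L] [IsScalarTower Fq K L]
    (n : ℕ) (x : K) (y : L) :
    eval L (monomial n x : TwistedPoly Fq K) y
      = algebraMap K L x * y ^ (Fintype.card Fq) ^ n := by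
  rw [eval, lift_monomial]
  have h : ((FiniteField.frobeniusAlgHom Fq L).toLinearMap ^ n) y
      = y ^ (Fintype.card Fq) ^ n := by
    induction n with
    | zero => simp
    | succ n ih =>
      rw [pow_succ', Module.End.mul_apply, ih]
      simp [pow_succ, pow_mul]
  rw [Module.End.mul_apply, h]
  simp

/-- Applying an `Fq`-algebra homomorphism `i` to the coefficients: `∑ ψ_n τ^n ↦ ∑ i(ψ_n) τ^n`. -/
def map (i : K →ₐ[Fq] K') : TwistedPoly Fq K →+* TwistedPoly Fq K' :=
  lift ((C : K' →+* TwistedPoly Fq K').comp i.toRingHom) tau (fun x => by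
    simp [tau_mul_C])

lemma map_monomial (i : K →ₐ[Fq] K') (n : ℕ) (x : K) :
    map i (monomial n x : TwistedPoly Fq K) = monomial n (i x) := by
  rw [map, lift_monomial, monomial_eq]
  rfl

/-- Evaluation of twisted polynomials commutes with extension of the base field. -/
lemma eval_map {L L' : Type*} [CommRing L] [Algebra Fq L] [Algebra K L] [IsScalarTower Fq K L]
    [CommRing L'] [Algebra Fq L'] [Algebra K' L'] [IsScalarTower Fq K' L']
    (i : K →ₐ[Fq] K') (ib : L →ₐ[Fq] L')
    (hib : ∀ x : K, ib (algebraMap K L x) = algebraMap K' L' (i x))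
    (f : TwistedPoly Fq K) (y : L) :
    ib (eval L f y) = eval L' (map i f) (ib y) := by
  induction f using induction_on with
  | add f g hf hg => simp only [map_add, LinearMap.add_apply, hf, hg]
  | mon n x => rw [map_monomial, eval_monomial, eval_monomial, map_mul, hib, map_pow]

end TwistedPoly

end TwistedPolynomials

/-! ## Drinfeld modules and their Tate modules -/

section Drinfeld

variable (Fq : Type*) [Field Fq] [Fintype Fq]

/-- A Drinfeld `A`-module of rank `r` over `K`: a homomorphism of `Fq`-algebras `A → K[τ]`,
`a ↦ φ_a`, such that for all `a ≠ 0` the element `φ_a` is elliptic of degree `r * deg a`, where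
`deg a = dim (A / A a)` over `Fq`. -/
structure DrinfeldModule (A : Type*) [CommRing A] [Algebra Fq A]
    (K : Type*) [Field K] [Algebra Fq K] (r : ℕ) where
  toAlgHom : A →ₐ[Fq] TwistedPoly Fq K
  elliptic : ∀ a : A, a ≠ 0 →
    (toAlgHom a).IsElliptic (r * Module.finrank Fq (A ⧸ Ideal.span {a}))

variable {Fq}
variable {A : Type*} [CommRing A] [Algebra Fq A]
variable {K : Type*} [Field K] [Algebra Fq K]
variable {K' : Type*} [Field K'] [Algebra Fq K']
variable {r : ℕ}

namespace DrinfeldModule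

variable (φ : DrinfeldModule Fq A K r) (ψ : DrinfeldModule Fq A K r)
variable (φ' : DrinfeldModule Fq A K' r)

/-- `u ∈ K[τ]` is a homomorphism of Drinfeld modules `φ → ψ` over `K`. -/
def IsHom (u : TwistedPoly Fq K) : Prop :=
  ∀ a, u * φ.toAlgHom a = ψ.toAlgHom a * u

/-- `φ'` is the base change of `φ` along `i : K → K'`. -/
def IsBaseChange (i : K →ₐ[Fq] K') : Prop :=
  ∀ a, φ'.toAlgHom a = TwistedPoly.map i (φ.toAlgHom a)

section Points

variable (Kb : Type*) [Field Kb] [Algebra Fq Kb] [Algebra K Kb] [IsScalarTower Fq K Kb]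
variable (Kb' : Type*) [Field Kb'] [Algebra Fq Kb'] [Algebra K' Kb'] [IsScalarTower Fq K' Kb']

/-- The additive group of an extension `Kb` of `K`, made into an `A`-module through `φ`. -/
def Points (_φ : DrinfeldModule Fq A K r) (Kb : Type*) : Type _ := Kb

instance : AddCommGroup (φ.Points Kb) := inferInstanceAs (AddCommGroup Kb)

/-- `a ∈ A` acts as `ξ ↦ φ_a(ξ)`. -/
instance : Module A (φ.Points Kb) :=
  letI : Module (Module.End Fq Kb) (φ.Points Kb) :=
    inferInstanceAs (Module (Module.End Fq Kb) Kb)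
  Module.compHom _ ((TwistedPoly.eval (K := K) Kb).comp φ.toAlgHom.toRingHom)

lemma Points.smul_def (a : A) (ξ : φ.Points Kb) :
    a • ξ = TwistedPoly.eval (K := K) Kb (φ.toAlgHom a) ξ := rfl

variable {φ ψ φ'} in
/-- A homomorphism `u : φ → ψ` induces the `A`-linear map `ξ ↦ u(ξ)`. -/
def Points.mapHom {u : TwistedPoly Fq K} (hu : φ.IsHom ψ u) :
    φ.Points Kb →ₗ[A] ψ.Points Kb where
  toFun ξ := TwistedPoly.eval (K := K) Kb u ξ
  map_add' x y := map_add (TwistedPoly.eval (K := K) Kb u) x y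
  map_smul' a ξ := by
    have h := congrArg (fun f => TwistedPoly.eval (K := K) Kb f ξ) (hu a)
    simp only [map_mul] at h
    exact h

variable {φ φ' Kb Kb'} in
/-- An extension `Kb → Kb'` of `i : K → K'` induces an `A`-linear map from the points of `φ` over
`Kb` to the points over `Kb'` of the base change of `φ` to `K'`. -/
def Points.mapField {i : K →ₐ[Fq] K'} (ib : Kb →ₐ[Fq] Kb')
    (hib : ∀ x : K, ib (algebraMap K Kb x) = algebraMap K' Kb' (i x))
    (hφ : φ.IsBaseChange φ' i) : φ.Points Kb →ₗ[A] φ'.Points Kb' where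
  toFun ξ := ib ξ
  map_add' x y := map_add ib x y
  map_smul' a ξ := by
    have h := TwistedPoly.eval_map i ib hib (φ.toAlgHom a) ξ
    rw [← hφ a] at h
    exact h

variable {Kb} in
/-- An automorphism of `Kb` over `K` acts `A`-linearly on the points of `φ` over `Kb`. -/
def Points.galois (γ : Kb ≃ₐ[K] Kb) : φ.Points Kb →ₗ[A] φ.Points Kb where
  toFun ξ := γ ξ
  map_add' x y := map_add γ x y
  map_smul' a ξ := by
    have h1 : ∀ f : TwistedPoly Fq K, TwistedPoly.map (AlgHom.id Fq K) f = f := by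
      intro f
      induction f using TwistedPoly.induction_on with
      | add f g hf hg => rw [map_add, hf, hg]
      | mon n x => rw [TwistedPoly.map_monomial]; rfl
    have h := TwistedPoly.eval_map (AlgHom.id Fq K) (γ.toAlgHom.restrictScalars Fq)
      (fun x => γ.commutes x) (φ.toAlgHom a) ξ
    rw [h1] at h
    exact h

end Points

end DrinfeldModule

end Drinfeld

section TateModule

open IsDedekindDomain

variable {A : Type*} [CommRing A] [IsDedekindDomain A]
variable (F : Type*) [Field F] [Algebra A F] [IsFractionRing A F] (p : HeightOneSpectrum A)

/-- The union of the `p ^ i`-torsion submodules `N[p ^ i]` of an `A`-module `N`. -/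
def primeTorsion (N : Type*) [AddCommGroup N] [Module A N] : Submodule A N where
  carrier := {x | ∃ i : ℕ, ∀ b ∈ p.asIdeal ^ i, b • x = 0}
  zero_mem' := ⟨0, fun b _ => smul_zero b⟩
  add_mem' := by
    rintro x y ⟨i, hi⟩ ⟨j, hj⟩
    refine ⟨i + j, fun b hb => ?_⟩
    rw [smul_add, hi b (Ideal.pow_le_pow_right (Nat.le_add_right i j) hb),
      hj b (Ideal.pow_le_pow_right (Nat.le_add_left j i) hb), add_zero]
  smul_mem' := by
    rintro c x ⟨i, hi⟩
    exact ⟨i, fun b hb => by rw [smul_comm, hi b hb, smul_zero]⟩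

/-- `F_p / A_p`, where `F_p` is the completion of `F` at `p` and `A_p` its valuation ring. -/
abbrev LocalQuotient : Type _ :=
  p.adicCompletion F ⧸
    LinearMap.range (Algebra.linearMap (p.adicCompletionIntegers F) (p.adicCompletion F))

/-- The `p`-adic Tate module `Hom_A(F_p / A_p, ⋃ N[p ^ i])` of an `A`-module `N`. -/
def TateModule (N : Type*) [AddCommGroup N] [Module A N] : Type _ :=
  LocalQuotient F p →ₗ[A] primeTorsion p N

namespace TateModule

variable {N : Type*} [AddCommGroup N] [Module A N]
variable {N' : Type*} [AddCommGroup N'] [Module A N']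

instance : AddCommGroup (TateModule F p N) :=
  inferInstanceAs (AddCommGroup (LocalQuotient F p →ₗ[A] primeTorsion p N))

instance : FunLike (TateModule F p N) (LocalQuotient F p) (primeTorsion p N) :=
  inferInstanceAs
    (FunLike (LocalQuotient F p →ₗ[A] primeTorsion p N) (LocalQuotient F p) (primeTorsion p N))

instance : LinearMapClass (TateModule F p N) A (LocalQuotient F p) (primeTorsion p N) :=
  inferInstanceAs (LinearMapClass (LocalQuotient F p →ₗ[A] primeTorsion p N) A
    (LocalQuotient F p) (primeTorsion p N))

variable {F p} in
lemma ext {f g : TateModule F p N} (h : ∀ x, f x = g x) : f = g :=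
  LinearMap.ext h

/-- `b ∈ A_p` acts on the Tate module by `(b f)(x) = f (b x)`. -/
instance : Module (p.adicCompletionIntegers F) (TateModule F p N) where
  smul b f := (f : LocalQuotient F p →ₗ[A] primeTorsion p N).comp
    (DistribSMul.toLinearMap A (LocalQuotient F p) b)
  one_smul f := ext fun x => congrArg f (one_smul _ x)
  mul_smul b c f := ext fun x => congrArg f (by
    change (b * c) • x = c • b • x
    rw [mul_comm, mul_smul])
  smul_zero _ := rfl
  smul_add _ _ _ := rfl
  add_smul b c f := ext fun x => (congrArg f (add_smul b c x)).trans
    (map_add f (b • x) (c • x))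
  zero_smul f := ext fun x => (congrArg f (zero_smul _ x)).trans
    (map_zero f)

lemma smul_apply (b : p.adicCompletionIntegers F) (f : TateModule F p N) (x : LocalQuotient F p) :
    (b • f) x = f (b • x) := rfl

/-- Functoriality of the Tate module, by composition. -/
def map (g : N →ₗ[A] N') :
    TateModule F p N →ₗ[p.adicCompletionIntegers F] TateModule F p N' where
  toFun f := (g.restrict (p := primeTorsion p N) (q := primeTorsion p N') (by
    rintro x ⟨i, hi⟩
    exact ⟨i, fun b hb => by rw [← map_smul, hi b hb, map_zero]⟩)).comp
      (f : LocalQuotient F p →ₗ[A] primeTorsion p N)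
  map_add' _ _ := ext fun x => Subtype.ext (map_add g _ _)
  map_smul' _ _ := rfl

lemma coe_map_apply (g : N →ₗ[A] N') (f : TateModule F p N) (x : LocalQuotient F p) :
    ((map F p g f) x : N') = g (f x) := rfl

end TateModule

/-- The rational Tate module `T_p ⊗ F_p` (tensor product over `A_p`). -/
abbrev RationalTateModule (N : Type*) [AddCommGroup N] [Module A N] : Type _ :=
  p.adicCompletion F ⊗[p.adicCompletionIntegers F] TateModule F p N

/-- Functoriality of the rational Tate module. -/
def RationalTateModule.map {N : Type*} [AddCommGroup N] [Module A N]
    {N' : Type*} [AddCommGroup N'] [Module A N'] (g : N →ₗ[A] N') :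
    RationalTateModule F p N →ₗ[p.adicCompletion F] RationalTateModule F p N' :=
  (TateModule.map F p g).baseChange (p.adicCompletion F)

variable {Fq : Type*} [Field Fq] [Fintype Fq] [Algebra Fq A]
variable {K : Type*} [Field K] [Algebra Fq K] {r : ℕ} (φ : DrinfeldModule Fq A K r)
variable (Kb : Type*) [Field Kb] [Algebra Fq Kb] [Algebra K Kb] [IsScalarTower Fq K Kb]

namespace DrinfeldModule

/-- The rational `p`-adic Tate module `V_p(φ)`, formed with the algebraic closure `Kb` of `K`. -/
abbrev V : Type _ := RationalTateModule F p (φ.Points Kb)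

/-- The action of `Aut(Kb / K)` on `V_p(φ)`. -/
def V.galoisRep : Representation (p.adicCompletion F) (Kb ≃ₐ[K] Kb) (φ.V F p Kb) where
  toFun γ := RationalTateModule.map F p (Points.galois φ γ)
  map_one' := by
    have h : TateModule.map F p (Points.galois φ (1 : Kb ≃ₐ[K] Kb)) = LinearMap.id := by
      ext f
      exact TateModule.ext fun x => Subtype.ext rfl
    rw [RationalTateModule.map, h, LinearMap.baseChange_id]
    rfl
  map_mul' γ δ := by
    have h : TateModule.map F p (Points.galois φ (γ * δ)) =
        (TateModule.map F p (Points.galois φ γ)).comp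
          (TateModule.map F p (Points.galois φ δ)) := by
      ext f
      exact TateModule.ext fun x => Subtype.ext rfl
    rw [RationalTateModule.map, h, LinearMap.baseChange_comp]
    rfl

end DrinfeldModule

end TateModule


/-! ## The difference ring `F_p ⊗̂ K` -/

section CompletedTensor

variable (k O L : Type*) [CommRing k] [CommRing O] [IsLocalRing O] [CommRing L]
variable [Algebra k O] [Algebra O L]
variable (K K' K'' : Type*) [CommRing K] [Algebra k K] [CommRing K'] [Algebra k K']
variable [CommRing K''] [Algebra k K'']

/-- The ideal of `O ⊗ K` generated by the maximal ideal `m` of `O`. -/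
abbrev tensorIdeal : Ideal (O ⊗[k] K) :=
  (IsLocalRing.maximalIdeal O).map (algebraMap O (O ⊗[k] K))

/-- The completed tensor product `O ⊗̂ K` over `k` of a local ring `O` with its `m`-adic topology
and a discrete `K`: the inverse limit of `(O ⊗ K) / m ^ n (O ⊗ K) = O / m ^ n ⊗ K`. -/
abbrev CompletedTensorInt : Type _ := AdicCompletion (tensorIdeal k O K) (O ⊗[k] K)

/-- The completed tensor product `L ⊗̂ K` over `k`, where `L` is the fraction field of a complete
discrete valuation ring `O` and `K` is discrete; it is obtained from `O ⊗̂ K` by inverting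
a uniformizer, that is, by extending scalars from `O` to `L`. -/
def CompletedTensor : Type _ := L ⊗[O] CompletedTensorInt k O K

namespace CompletedTensor

instance : CommRing (CompletedTensor k O L K) :=
  inferInstanceAs (CommRing (L ⊗[O] CompletedTensorInt k O K))

instance : Algebra L (CompletedTensor k O L K) :=
  inferInstanceAs (Algebra L (L ⊗[O] CompletedTensorInt k O K))

variable {K K' K''}

lemma tensorIdeal_pow_le (f : K →ₐ[k] K') (n : ℕ) :
    tensorIdeal k O K ^ n ≤
      (tensorIdeal k O K' ^ n).comap (Algebra.TensorProduct.map (AlgHom.id O O) f) := by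
  refine le_trans (Ideal.pow_right_mono ?_ n) (Ideal.le_comap_pow _ n)
  rw [Ideal.map_le_iff_le_comap]
  intro x hx
  rw [Ideal.mem_comap, Ideal.mem_comap, AlgHom.commutes]
  exact Ideal.mem_map_of_mem _ hx

lemma mapInt_aux (f : K →ₐ[k] K') {m n : ℕ} (hle : m ≤ n) :
    (Ideal.Quotient.factorₐ O (Ideal.pow_le_pow_right hle)).comp
      ((Ideal.quotientMapₐ (tensorIdeal k O K' ^ n)
        (Algebra.TensorProduct.map (AlgHom.id O O) f) (tensorIdeal_pow_le k O f n)).comp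
      ((AdicCompletion.evalₐ (tensorIdeal k O K) n).restrictScalars O)) =
      (Ideal.quotientMapₐ (tensorIdeal k O K' ^ m)
        (Algebra.TensorProduct.map (AlgHom.id O O) f) (tensorIdeal_pow_le k O f m)).comp
      ((AdicCompletion.evalₐ (tensorIdeal k O K) m).restrictScalars O) := by
  ext x
  obtain ⟨s, rfl⟩ := AdicCompletion.mk_surjective _ _ x
  simp only [AlgHom.comp_apply, AlgHom.restrictScalars_apply, AdicCompletion.evalₐ_mk]
  rw [← AdicCompletion.Ideal.mk_eq_mk _ hle s]
  rfl

/-- Functoriality of `O ⊗̂ K` in `K`. -/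
def mapInt (f : K →ₐ[k] K') : CompletedTensorInt k O K →ₐ[O] CompletedTensorInt k O K' :=
  AdicCompletion.liftAlgHom (R := O) (tensorIdeal k O K')
    (fun n => (Ideal.quotientMapₐ (tensorIdeal k O K' ^ n)
        (Algebra.TensorProduct.map (AlgHom.id O O) f) (tensorIdeal_pow_le k O f n)).comp
      ((AdicCompletion.evalₐ (tensorIdeal k O K) n).restrictScalars O))
    (fun hle => mapInt_aux k O f hle)

/-- Functoriality of `L ⊗̂ K` in `K`. -/
def map (f : K →ₐ[k] K') : CompletedTensor k O L K →ₐ[L] CompletedTensor k O L K' :=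
  Algebra.TensorProduct.map (AlgHom.id L L) (mapInt k O f)

lemma evalₐ_mapInt (f : K →ₐ[k] K') (n : ℕ) (x : CompletedTensorInt k O K) :
    AdicCompletion.evalₐ (tensorIdeal k O K') n (mapInt k O f x) =
      Ideal.quotientMapₐ (tensorIdeal k O K' ^ n)
        (Algebra.TensorProduct.map (AlgHom.id O O) f) (tensorIdeal_pow_le k O f n)
        (AdicCompletion.evalₐ (tensorIdeal k O K) n x) :=
  AdicCompletion.evalₐ_liftAlgHom _ _ (fun hle => mapInt_aux k O f hle) _ _

lemma evalₐ_mapInt_mk (f : K →ₐ[k] K') (n : ℕ)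
    (s : AdicCompletion.AdicCauchySequence (tensorIdeal k O K) (O ⊗[k] K)) :
    AdicCompletion.evalₐ (tensorIdeal k O K') n (mapInt k O f (AdicCompletion.mk _ _ s)) =
      Ideal.Quotient.mk _ (Algebra.TensorProduct.map (AlgHom.id O O) f (s.val n)) := by
  rw [evalₐ_mapInt, AdicCompletion.evalₐ_mk]
  rfl

lemma mapInt_comp (f : K →ₐ[k] K') (g : K' →ₐ[k] K'') :
    (mapInt k O g).comp (mapInt k O f) = mapInt k O (g.comp f) := by
  have h := Algebra.TensorProduct.map_comp (AlgHom.id O O) (AlgHom.id O O) g f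
  rw [AlgHom.id_comp] at h
  ext1 x
  obtain ⟨s, rfl⟩ := AdicCompletion.mk_surjective _ _ x
  refine AdicCompletion.ext_evalₐ fun n => ?_
  rw [AlgHom.comp_apply, evalₐ_mapInt, evalₐ_mapInt_mk, evalₐ_mapInt_mk, h]
  rfl

lemma map_map (f : K →ₐ[k] K') (g : K' →ₐ[k] K'') (x : CompletedTensor k O L K) :
    map k O L g (map k O L f x) = map k O L (g.comp f) x := by
  have h := Algebra.TensorProduct.map_comp (AlgHom.id L L) (AlgHom.id L L)
    (mapInt k O g) (mapInt k O f)
  rw [mapInt_comp, AlgHom.id_comp] at h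
  exact (DFunLike.congr_fun h x).symm

lemma map_id (x : CompletedTensor k O L K) : map k O L (AlgHom.id k K) x = x := by
  have h : mapInt k O (AlgHom.id k K) = AlgHom.id O _ := by
    ext1 x
    obtain ⟨s, rfl⟩ := AdicCompletion.mk_surjective _ _ x
    refine AdicCompletion.ext_evalₐ fun n => ?_
    rw [evalₐ_mapInt_mk, Algebra.TensorProduct.map_id, AlgHom.id_apply, AlgHom.id_apply,
      AdicCompletion.evalₐ_mk]
  rw [map, h]
  exact DFunLike.congr_fun (Algebra.TensorProduct.map_id (R := O) (S := L) (A := L)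
    (B := CompletedTensorInt k O K)) x

section Coefficients

variable (A : Type*) [CommRing A] [Algebra k A] [Algebra A O] [IsScalarTower k A O]

variable (K) in
/-- The canonical homomorphism `A ⊗ K → L ⊗̂ K` for an `O`-valued ring of coefficients `A`. -/
def coeffHom : A ⊗[k] K →+* CompletedTensor k O L K :=
  (Algebra.TensorProduct.includeRight :
      CompletedTensorInt k O K →ₐ[O] L ⊗[O] CompletedTensorInt k O K).toRingHom.comp
    ((algebraMap (O ⊗[k] K) (CompletedTensorInt k O K)).comp
      (Algebra.TensorProduct.map (IsScalarTower.toAlgHom k A O) (AlgHom.id k K)).toRingHom)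

lemma mapInt_algebraMap (f : K →ₐ[k] K') (x : O ⊗[k] K) :
    mapInt k O f (algebraMap _ _ x) =
      algebraMap _ _ (Algebra.TensorProduct.map (AlgHom.id O O) f x) := by
  refine AdicCompletion.ext_evalₐ fun n => ?_
  rw [evalₐ_mapInt, AlgHom.commutes, AlgHom.commutes]
  rfl

lemma map_coeffHom (f : K →ₐ[k] K') (x : A ⊗[k] K) :
    map k O L f (coeffHom k O L K A x) =
      coeffHom k O L K' A (Algebra.TensorProduct.map (AlgHom.id A A) f x) := by
  induction x using TensorProduct.induction_on with
  | zero => simp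
  | add x y hx hy => simp only [map_add, hx, hy]
  | tmul a ξ =>
    change (1 : L) ⊗ₜ[O] (mapInt k O f (algebraMap _ _ (algebraMap A O a ⊗ₜ[k] ξ))) = _
    rw [mapInt_algebraMap]
    rfl

instance : Algebra (A ⊗[k] K) (CompletedTensor k O L K) := (coeffHom k O L K A).toAlgebra

end Coefficients

section BaseChange

variable {k O L}
variable [Algebra K K'] [IsScalarTower k K K']

/-- `L ⊗̂ K'` as an algebra over `L ⊗̂ K` for an extension `K'` of `K`. The priority is low so that
this is never used for `K' = K`. -/
instance (priority := 10) baseChangeAlgebra :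
    Algebra (CompletedTensor k O L K) (CompletedTensor k O L K') :=
  (map k O L (IsScalarTower.toAlgHom k K K')).toRingHom.toAlgebra

lemma baseChange_algebraMap (x : CompletedTensor k O L K) :
    algebraMap (CompletedTensor k O L K) (CompletedTensor k O L K') x =
      map k O L (IsScalarTower.toAlgHom k K K') x := rfl

instance (priority := 10) baseChange_isScalarTower :
    IsScalarTower L (CompletedTensor k O L K) (CompletedTensor k O L K') :=
  IsScalarTower.of_algebraMap_eq fun x =>
    ((map k O L (IsScalarTower.toAlgHom k K K')).commutes x).symm

end BaseChange

end CompletedTensor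

end CompletedTensor

/-! ## Modules over a difference ring -/

section DifferenceModules

variable {R S R' S' : Type*} [CommRing R] [CommRing S] [CommRing R'] [CommRing S']
variable [Algebra R S] [Algebra R' S']
variable {M M' : Type*} [AddCommGroup M] [Module R M] [AddCommGroup M'] [Module R' M']

/-- The semilinear map `S ⊗ M → S' ⊗ M'`, `e ⊗ m ↦ s(e) ⊗ g(m)`, for a ring homomorphism `s`
extending `ρ` and a `ρ`-semilinear map `g`. -/
def semilinearBaseChange {ρ : R →+* R'} (s : S →+* S')
    (h : ∀ x, s (algebraMap R S x) = algebraMap R' S' (ρ x)) (g : M →ₛₗ[ρ] M') :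
    S ⊗[R] M →ₛₗ[s] S' ⊗[R'] M' :=
  let s' : S →ₛₗ[ρ] S' :=
    { toFun := s
      map_add' := map_add s
      map_smul' := fun r x => by simp [Algebra.smul_def, h] }
  { toFun := TensorProduct.map s' g
    map_add' := map_add _
    map_smul' := fun e x => by
      induction x using TensorProduct.induction_on with
      | zero => simp
      | add x y hx hy => simp only [smul_add, map_add, hx, hy]
      | tmul y m =>
        rw [TensorProduct.smul_tmul', TensorProduct.map_tmul, TensorProduct.map_tmul,
          TensorProduct.smul_tmul']
        congr 1
        exact map_mul s e y }

@[simp]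
lemma semilinearBaseChange_tmul {ρ : R →+* R'} (s : S →+* S')
    (h : ∀ x, s (algebraMap R S x) = algebraMap R' S' (ρ x)) (g : M →ₛₗ[ρ] M') (e : S) (m : M) :
    semilinearBaseChange s h g (e ⊗ₜ m) = s e ⊗ₜ g m := rfl

end DifferenceModules

/-! ## The `F_p`-isocrystal of a Drinfeld module and its slope zero Tate module -/

section Isocrystals

open IsDedekindDomain

variable {Fq : Type*} [Field Fq] [Fintype Fq]
variable {A : Type*} [CommRing A] [Algebra Fq A]

section Motive

variable {K : Type*} [Field K] [Algebra Fq K] {K' : Type*} [Field K'] [Algebra Fq K'] {r : ℕ}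

variable (Fq K) in
/-- The Frobenius endomorphism `ξ ↦ ξ ^ q` of `K`. -/
abbrev frob : K →ₐ[Fq] K := FiniteField.frobeniusAlgHom Fq K

lemma frob_comm (i : K →ₐ[Fq] K') : i.comp (frob Fq K) = (frob Fq K').comp i := by
  ext x
  simp

variable (A) in
/-- `A ⊗ K → A ⊗ K'`, `a ⊗ ξ ↦ a ⊗ i(ξ)`. For the Frobenius of `K` this is the partial Frobenius
endomorphism `σ` of `A ⊗ K`. -/
abbrev coeffMap (i : K →ₐ[Fq] K') : A ⊗[Fq] K →ₐ[A] A ⊗[Fq] K' :=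
  Algebra.TensorProduct.map (AlgHom.id A A) i

namespace DrinfeldModule

variable (φ : DrinfeldModule Fq A K r) (ψ : DrinfeldModule Fq A K r)
variable (φ' : DrinfeldModule Fq A K' r)

/-- The `A`-motive of `φ`: the additive group `K[τ]`. -/
def Motive (_φ : DrinfeldModule Fq A K r) : Type _ := TwistedPoly Fq K

instance : AddCommGroup φ.Motive := inferInstanceAs (AddCommGroup (TwistedPoly Fq K))

/-- The action of `A ⊗ K` on `K[τ]` with `(a ⊗ ξ) m = ξ m φ_a`. -/
def motiveAction : A ⊗[Fq] K →ₐ[Fq] Module.End Fq (TwistedPoly Fq K) :=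
  Algebra.TensorProduct.lift
    (AlgHom.ofLinearMap
      ((LinearMap.mul Fq (TwistedPoly Fq K)).flip.comp φ.toAlgHom.toLinearMap)
      (by ext m; simp)
      (fun a b => by
        ext m
        simp [mul_comm a b, mul_assoc]))
    ((Algebra.lmul Fq (TwistedPoly Fq K)).comp
      (AlgHom.mk (TwistedPoly.C : K →+* TwistedPoly Fq K) (fun _ => rfl)))
    (fun a ξ => show Commute _ _ from LinearMap.ext fun m =>
      mul_assoc (TwistedPoly.C ξ) m (φ.toAlgHom a))

lemma motiveAction_tmul (a : A) (ξ : K) (m : TwistedPoly Fq K) :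
    φ.motiveAction (a ⊗ₜ ξ) m = TwistedPoly.C ξ * m * φ.toAlgHom a := by
  rw [motiveAction, Algebra.TensorProduct.lift_tmul]
  rfl

instance : Module (A ⊗[Fq] K) φ.Motive :=
  letI : Module (Module.End Fq (TwistedPoly Fq K)) φ.Motive :=
    inferInstanceAs (Module (Module.End Fq (TwistedPoly Fq K)) (TwistedPoly Fq K))
  Module.compHom _ φ.motiveAction.toRingHom

/-- The underlying twisted polynomial of an element of the motive. -/
def Motive.toPoly : φ.Motive ≃+ TwistedPoly Fq K := AddEquiv.refl (TwistedPoly Fq K)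

lemma Motive.toPoly_smul (a : A) (ξ : K) (m : φ.Motive) :
    toPoly φ ((a ⊗ₜ[Fq] ξ) • m) = TwistedPoly.C ξ * toPoly φ m * φ.toAlgHom a :=
  φ.motiveAction_tmul a ξ m

/-- An additive map between motives that is semilinear with respect to the elements `a ⊗ ξ` is
semilinear. -/
def Motive.semilinear {φ : DrinfeldModule Fq A K r} {φ' : DrinfeldModule Fq A K' r}
    (ρ : A ⊗[Fq] K →+* A ⊗[Fq] K') (g : φ.Motive →+ φ'.Motive)
    (h : ∀ (a : A) (ξ : K) (m : φ.Motive), g ((a ⊗ₜ[Fq] ξ) • m) = ρ (a ⊗ₜ[Fq] ξ) • g m) :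
    φ.Motive →ₛₗ[ρ] φ'.Motive where
  toFun := g
  map_add' := map_add g
  map_smul' c m := by
    induction c using TensorProduct.induction_on with
    | zero => rw [zero_smul, map_zero, map_zero, zero_smul]
    | add x y hx hy => rw [add_smul, map_add, map_add, add_smul, hx, hy]
    | tmul a ξ => exact h a ξ m

/-- The semilinear map `m ↦ τ m` on the motive. -/
def Motive.tau : φ.Motive →ₛₗ[(coeffMap A (frob Fq K)).toRingHom] φ.Motive :=
  Motive.semilinear _
    ((toPoly φ).symm.toAddMonoidHom.comp
      ((AddMonoidHom.mulLeft TwistedPoly.tau).comp (toPoly φ).toAddMonoidHom))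
    (fun a ξ m => (toPoly φ).injective (by
      have h : (coeffMap A (frob Fq K)).toRingHom (a ⊗ₜ ξ) = a ⊗ₜ (ξ ^ Fintype.card Fq) := rfl
      rw [h, Motive.toPoly_smul]
      simp only [AddMonoidHom.comp_apply, AddEquiv.toAddMonoidHom_eq_coe, AddMonoidHom.coe_coe,
        AddEquiv.apply_symm_apply, Motive.toPoly_smul, AddMonoidHom.coe_mulLeft]
      simp only [← mul_assoc, TwistedPoly.tau_mul_C]))

lemma Motive.toPoly_tau (m : φ.Motive) :
    toPoly φ (Motive.tau φ m) = TwistedPoly.tau * toPoly φ m := rfl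

variable {φ ψ φ'}

/-- A homomorphism `u : φ → ψ` induces the linear map of motives `m ↦ m u` from that of `ψ` to
that of `φ`. -/
def Motive.mapHom {u : TwistedPoly Fq K} (hu : φ.IsHom ψ u) :
    ψ.Motive →ₛₗ[RingHom.id (A ⊗[Fq] K)] φ.Motive :=
  Motive.semilinear _
    ((toPoly φ).symm.toAddMonoidHom.comp
      ((AddMonoidHom.mulRight u).comp (toPoly ψ).toAddMonoidHom))
    (fun a ξ m => (toPoly φ).injective (by
      rw [RingHom.id_apply, Motive.toPoly_smul]
      simp only [AddMonoidHom.comp_apply, AddEquiv.toAddMonoidHom_eq_coe, AddMonoidHom.coe_coe,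
        AddEquiv.apply_symm_apply, Motive.toPoly_smul, AddMonoidHom.mulRight_apply]
      simp only [mul_assoc, hu a]))

lemma Motive.toPoly_mapHom {u : TwistedPoly Fq K} (hu : φ.IsHom ψ u) (m : ψ.Motive) :
    toPoly φ (Motive.mapHom hu m) = toPoly ψ m * u := rfl

/-- If `φ'` is the base change of `φ` along `i : K → K'`, applying `i` to coefficients defines
a semilinear map of motives. -/
def Motive.mapField {i : K →ₐ[Fq] K'} (hφ : φ.IsBaseChange φ' i) :
    φ.Motive →ₛₗ[(coeffMap A i).toRingHom] φ'.Motive :=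
  Motive.semilinear _
    ((toPoly φ').symm.toAddMonoidHom.comp
      ((TwistedPoly.map i).toAddMonoidHom.comp (toPoly φ).toAddMonoidHom))
    (fun a ξ m => (toPoly φ').injective (by
      have h : (coeffMap A i).toRingHom (a ⊗ₜ ξ) = a ⊗ₜ i ξ := rfl
      have hC : TwistedPoly.map i (TwistedPoly.C ξ) = TwistedPoly.C (i ξ) :=
        TwistedPoly.map_monomial i 0 ξ
      rw [h, Motive.toPoly_smul]
      simp only [AddMonoidHom.comp_apply, AddEquiv.toAddMonoidHom_eq_coe, AddMonoidHom.coe_coe,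
        AddEquiv.apply_symm_apply, Motive.toPoly_smul, RingHom.toAddMonoidHom_eq_coe,
        map_mul, hC, hφ a]))

lemma Motive.toPoly_mapField {i : K →ₐ[Fq] K'} (hφ : φ.IsBaseChange φ' i) (m : φ.Motive) :
    toPoly φ' (Motive.mapField hφ m) = TwistedPoly.map i (toPoly φ m) := rfl

end DrinfeldModule

end Motive

section SlopeZero

variable {O L : Type*} [CommRing O] [IsLocalRing O] [CommRing L] [Algebra Fq O] [Algebra O L]
variable {K : Type*} [Field K] [Algebra Fq K]
variable (Kb : Type*) [Field Kb] [Algebra Fq Kb] [Algebra K Kb] [IsScalarTower Fq K Kb]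
variable {K' : Type*} [Field K'] [Algebra Fq K']
variable {Kb' : Type*} [Field Kb'] [Algebra Fq Kb'] [Algebra K' Kb'] [IsScalarTower Fq K' Kb']

variable (Fq O L K) in
/-- The partial Frobenius endomorphism `σ` of `L ⊗̂ K`, given by `a ⊗ ξ ↦ a ⊗ ξ ^ q`. -/
abbrev partialFrob : CompletedTensor Fq O L K →ₐ[L] CompletedTensor Fq O L K :=
  CompletedTensor.map Fq O L (frob Fq K)

lemma partialFrob_comm (i : K →ₐ[Fq] K') (x : CompletedTensor Fq O L K) :
    CompletedTensor.map Fq O L i (partialFrob Fq O L K x) =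
      partialFrob Fq O L K' (CompletedTensor.map Fq O L i x) := by
  rw [CompletedTensor.map_map, CompletedTensor.map_map, frob_comm]

variable {N : Type*} [AddCommGroup N] [Module (CompletedTensor Fq O L K) N]
variable {N' : Type*} [AddCommGroup N'] [Module (CompletedTensor Fq O L K') N']

/-- The `σ`-semilinear map `e ⊗ n ↦ σ(e) ⊗ τ n` on the base change to `Kb` of a module `N` over
`L ⊗̂ K` with a `σ`-semilinear map `τ`. -/
def tauClosure (τ : N →ₛₗ[(partialFrob Fq O L K).toRingHom] N) :
    CompletedTensor Fq O L Kb ⊗[CompletedTensor Fq O L K] N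
      →ₛₗ[(partialFrob Fq O L Kb).toRingHom]
      CompletedTensor Fq O L Kb ⊗[CompletedTensor Fq O L K] N :=
  semilinearBaseChange (partialFrob Fq O L Kb).toRingHom
    (fun x => (partialFrob_comm (IsScalarTower.toAlgHom Fq K Kb) x).symm) τ

/-- The slope zero Tate module `T_0(N) = (N ⊗̂ Kb)^τ` of a module `N` over `L ⊗̂ K` with
a `σ`-semilinear map `τ`, where `Kb` is an algebraic closure of `K`. It is a vector space
over `L`. -/
def slopeZeroTate (τ : N →ₛₗ[(partialFrob Fq O L K).toRingHom] N) :
    Submodule L (CompletedTensor Fq O L Kb ⊗[CompletedTensor Fq O L K] N) where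
  carrier := {x | tauClosure Kb τ x = x}
  zero_mem' := map_zero _
  add_mem' {x y} hx hy := by
    change tauClosure Kb τ (x + y) = x + y
    rw [map_add, show tauClosure Kb τ x = x from hx, show tauClosure Kb τ y = y from hy]
  smul_mem' c x hx := by
    change tauClosure Kb τ (c • x) = c • x
    rw [← algebraMap_smul (CompletedTensor Fq O L Kb) c x, map_smulₛₗ,
      show tauClosure Kb τ x = x from hx]
    congr 1
    exact (partialFrob Fq O L Kb).commutes c

variable {Kb}

/-- The map `e ⊗ n ↦ s(e) ⊗ g(n)` on slope zero Tate modules. -/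
def slopeZeroTate.map {τ : N →ₛₗ[(partialFrob Fq O L K).toRingHom] N}
    {τ' : N' →ₛₗ[(partialFrob Fq O L K').toRingHom] N'}
    (s : CompletedTensor Fq O L Kb →ₐ[L] CompletedTensor Fq O L Kb')
    {ρ : CompletedTensor Fq O L K →+* CompletedTensor Fq O L K'}
    (hs : ∀ x, s (algebraMap (CompletedTensor Fq O L K) (CompletedTensor Fq O L Kb) x) =
      algebraMap (CompletedTensor Fq O L K') (CompletedTensor Fq O L Kb') (ρ x))
    (hσ : ∀ e, s (partialFrob Fq O L Kb e) = partialFrob Fq O L Kb' (s e))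
    (g : N →ₛₗ[ρ] N') (hg : ∀ n, g (τ n) = τ' (g n)) :
    slopeZeroTate Kb τ →ₗ[L] slopeZeroTate Kb' τ' where
  toFun x := ⟨semilinearBaseChange s.toRingHom hs g x, by
    have key : ∀ y, semilinearBaseChange s.toRingHom hs g (tauClosure Kb τ y) =
        tauClosure Kb' τ' (semilinearBaseChange s.toRingHom hs g y) := by
      intro y
      induction y using TensorProduct.induction_on with
      | zero => simp only [map_zero]
      | add y z hy hz => simp only [map_add, hy, hz]
      | tmul e n =>
        rw [tauClosure, tauClosure, semilinearBaseChange_tmul, semilinearBaseChange_tmul,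
          semilinearBaseChange_tmul, semilinearBaseChange_tmul, hg]
        exact congrArg (fun e' => e' ⊗ₜ[CompletedTensor Fq O L K'] τ' (g n)) (hσ e)
    have hx : tauClosure Kb τ x = x := x.2
    change tauClosure Kb' τ' _ = _
    rw [← key, hx]⟩
  map_add' x y := Subtype.ext (map_add _ _ _)
  map_smul' c x := Subtype.ext (by
    change semilinearBaseChange s.toRingHom hs g (c • x.1) =
      c • semilinearBaseChange s.toRingHom hs g x.1
    rw [← algebraMap_smul (CompletedTensor Fq O L Kb) c x.1, map_smulₛₗ,
      ← algebraMap_smul (CompletedTensor Fq O L Kb') c]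
    congr 1
    exact s.commutes c)

lemma slopeZeroTate.coe_map_apply {τ : N →ₛₗ[(partialFrob Fq O L K).toRingHom] N}
    {τ' : N' →ₛₗ[(partialFrob Fq O L K').toRingHom] N'}
    (s : CompletedTensor Fq O L Kb →ₐ[L] CompletedTensor Fq O L Kb')
    {ρ : CompletedTensor Fq O L K →+* CompletedTensor Fq O L K'}
    (hs : ∀ x, s (algebraMap (CompletedTensor Fq O L K) (CompletedTensor Fq O L Kb) x) =
      algebraMap (CompletedTensor Fq O L K') (CompletedTensor Fq O L Kb') (ρ x))
    (hσ : ∀ e, s (partialFrob Fq O L Kb e) = partialFrob Fq O L Kb' (s e))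
    (g : N →ₛₗ[ρ] N') (hg : ∀ n, g (τ n) = τ' (g n)) (x : slopeZeroTate Kb τ) :
    (slopeZeroTate.map (τ' := τ') s hs hσ g hg x).1 = semilinearBaseChange s.toRingHom hs g x.1 :=
  rfl

/-- The action of `γ ∈ Aut(Kb / K)` on `T_0(N)` is induced by `e ⊗ n ↦ γ(e) ⊗ n`. -/
def slopeZeroTate.galois (τ : N →ₛₗ[(partialFrob Fq O L K).toRingHom] N) (γ : Kb ≃ₐ[K] Kb) :
    slopeZeroTate Kb τ →ₗ[L] slopeZeroTate Kb τ :=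
  slopeZeroTate.map (CompletedTensor.map Fq O L (γ.toAlgHom.restrictScalars Fq))
    (ρ := RingHom.id _)
    (fun x => by
      rw [CompletedTensor.baseChange_algebraMap, CompletedTensor.map_map, RingHom.id_apply,
        CompletedTensor.baseChange_algebraMap]
      congr 2
      ext y
      exact γ.commutes y)
    (partialFrob_comm _) LinearMap.id (fun _ => rfl)

/-- The action of `Aut(Kb / K)` on `T_0(N)`. -/
def slopeZeroTate.galoisRep (τ : N →ₛₗ[(partialFrob Fq O L K).toRingHom] N) :
    Representation L (Kb ≃ₐ[K] Kb) (slopeZeroTate Kb τ) where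
  toFun γ := slopeZeroTate.galois τ γ
  map_one' := by
    ext x
    change semilinearBaseChange _ _ _ x.1 = x.1
    induction x.1 using TensorProduct.induction_on with
    | zero => simp only [map_zero]
    | add y z hy hz => rw [map_add, hy, hz]
    | tmul e n =>
      rw [semilinearBaseChange_tmul]
      exact congrArg (fun e' => e' ⊗ₜ[CompletedTensor Fq O L K] n) (CompletedTensor.map_id Fq O L e)
  map_mul' γ δ := by
    ext x
    change semilinearBaseChange _ _ _ x.1 =
      semilinearBaseChange _ _ _ (semilinearBaseChange _ _ _ x.1)
    induction x.1 using TensorProduct.induction_on with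
    | zero => simp only [map_zero]
    | add y z hy hz => simp only [map_add, hy, hz]
    | tmul e n =>
      rw [semilinearBaseChange_tmul, semilinearBaseChange_tmul, semilinearBaseChange_tmul]
      exact congrArg (fun e' => e' ⊗ₜ[CompletedTensor Fq O L K] n)
        (CompletedTensor.map_map Fq O L (δ.toAlgHom.restrictScalars Fq)
          (γ.toAlgHom.restrictScalars Fq) e).symm

end SlopeZero

section Local

variable [IsDedekindDomain A]
variable (F : Type*) [Field F] [Algebra A F] [IsFractionRing A F] (p : HeightOneSpectrum A)

/-- The `Fq`-algebra structure of `A_p`, through `A`. -/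
instance adicIntegersAlgebra : Algebra Fq (p.adicCompletionIntegers F) :=
  ((algebraMap A (p.adicCompletionIntegers F)).comp (algebraMap Fq A)).toAlgebra

instance adicIntegers_isScalarTower : IsScalarTower Fq A (p.adicCompletionIntegers F) :=
  IsScalarTower.of_algebraMap_eq fun _ => rfl

variable (Fq) in
/-- The ring `F_p ⊗̂ K` over `Fq`. -/
abbrev IsocrystalRing (K : Type*) [CommRing K] [Algebra Fq K] : Type _ :=
  CompletedTensor Fq (p.adicCompletionIntegers F) (p.adicCompletion F) K

variable {K : Type*} [Field K] [Algebra Fq K] {r : ℕ}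
variable (Kb : Type*) [Field Kb] [Algebra Fq Kb] [Algebra K Kb] [IsScalarTower Fq K Kb]
variable {K' : Type*} [Field K'] [Algebra Fq K']
variable (Kb' : Type*) [Field Kb'] [Algebra Fq Kb'] [Algebra K' Kb'] [IsScalarTower Fq K' Kb']

namespace DrinfeldModule

variable (φ : DrinfeldModule Fq A K r) (ψ : DrinfeldModule Fq A K r)
variable (φ' : DrinfeldModule Fq A K' r)

/-- The `F_p`-isocrystal `M_{F,p}` of `φ`: the base change of the motive `M` of `φ` along the
canonical homomorphism `A ⊗ K → F_p ⊗̂ K`. This homomorphism factors through the total ring of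
quotients of `F ⊗ K`, so this is also the base change of the `F`-isocrystal of `M`. -/
abbrev Isocrystal : Type _ := IsocrystalRing Fq F p K ⊗[A ⊗[Fq] K] φ.Motive

/-- The `σ`-semilinear map `e ⊗ m ↦ σ(e) ⊗ τ m` of the isocrystal. -/
def Isocrystal.tau : φ.Isocrystal F p
    →ₛₗ[(partialFrob Fq (p.adicCompletionIntegers F) (p.adicCompletion F) K).toRingHom]
    φ.Isocrystal F p :=
  semilinearBaseChange _ (CompletedTensor.map_coeffHom Fq _ _ A (frob Fq K)) (Motive.tau φ)

/-- The slope zero Tate module of the `F_p`-isocrystal of `φ`, formed with the algebraic closure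
`Kb` of `K`. -/
abbrev T0 : Type _ := slopeZeroTate Kb (Isocrystal.tau F p φ)

/-- The action of `Aut(Kb / K)` on the slope zero Tate module. -/
abbrev T0.galoisRep : Representation (p.adicCompletion F) (Kb ≃ₐ[K] Kb) (φ.T0 F p Kb) :=
  slopeZeroTate.galoisRep (Isocrystal.tau F p φ)

/-- The tensor product over `A` of the `F_p`-dual of the slope zero Tate module with the module of
differentials of `A` over `Fq`. -/
abbrev DualT0Omega : Type _ := Module.Dual (p.adicCompletion F) (φ.T0 F p Kb) ⊗[A] Ω[A⁄Fq]

/-- The action of `Aut(Kb / K)` on the dual of the slope zero Tate module tensored with the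
differentials: contragredient on the first factor and trivial on the second. -/
def DualT0Omega.galois (γ : Kb ≃ₐ[K] Kb) :
    φ.DualT0Omega F p Kb →ₗ[p.adicCompletion F] φ.DualT0Omega F p Kb :=
  TensorProduct.AlgebraTensorModule.map ((T0.galoisRep F p Kb φ).dual γ) LinearMap.id

variable {φ ψ φ' Kb Kb'}

/-- A homomorphism `u : φ → ψ` of Drinfeld modules induces `V_p(φ) → V_p(ψ)`. -/
def V.mapHom {u : TwistedPoly Fq K} (hu : φ.IsHom ψ u) :
    φ.V F p Kb →ₗ[p.adicCompletion F] ψ.V F p Kb :=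
  RationalTateModule.map F p (Points.mapHom Kb hu)

/-- An extension `ib : Kb → Kb'` of `i : K → K'` induces `V_p(φ) → V_p(φ')` for the base change
`φ'` of `φ`. -/
def V.mapField {i : K →ₐ[Fq] K'} (ib : Kb →ₐ[Fq] Kb')
    (hib : ∀ x : K, ib (algebraMap K Kb x) = algebraMap K' Kb' (i x))
    (hφ : φ.IsBaseChange φ' i) : φ.V F p Kb →ₗ[p.adicCompletion F] φ'.V F p Kb' :=
  RationalTateModule.map F p (Points.mapField ib hib hφ)

/-- A homomorphism `u : φ → ψ` of Drinfeld modules induces a map of isocrystals in the opposite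
direction. -/
def Isocrystal.mapHom {u : TwistedPoly Fq K} (hu : φ.IsHom ψ u) :
    ψ.Isocrystal F p →ₛₗ[RingHom.id (IsocrystalRing Fq F p K)] φ.Isocrystal F p :=
  semilinearBaseChange (RingHom.id _) (fun _ => rfl) (Motive.mapHom hu)

/-- The semilinear map of isocrystals for a base change `φ'` of `φ` along `i : K → K'`. -/
def Isocrystal.mapField {i : K →ₐ[Fq] K'} (hφ : φ.IsBaseChange φ' i) :
    φ.Isocrystal F p
      →ₛₗ[(CompletedTensor.map Fq (p.adicCompletionIntegers F) (p.adicCompletion F) i).toRingHom]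
      φ'.Isocrystal F p :=
  semilinearBaseChange _ (CompletedTensor.map_coeffHom Fq _ _ A i) (Motive.mapField hφ)

lemma Isocrystal.mapHom_tau {u : TwistedPoly Fq K} (hu : φ.IsHom ψ u) (n : ψ.Isocrystal F p) :
    mapHom F p hu (tau F p ψ n) = tau F p φ (mapHom F p hu n) := by
  induction n using TensorProduct.induction_on with
  | zero => simp only [map_zero]
  | add y z hy hz => simp only [map_add, hy, hz]
  | tmul e m =>
    have h : Motive.mapHom hu (Motive.tau ψ m) = Motive.tau φ (Motive.mapHom hu m) :=
      (Motive.toPoly φ).injective (mul_assoc TwistedPoly.tau (Motive.toPoly ψ m) u)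
    rw [mapHom, tau, tau, semilinearBaseChange_tmul, semilinearBaseChange_tmul,
      semilinearBaseChange_tmul, semilinearBaseChange_tmul, h]
    rfl

lemma Isocrystal.mapField_tau {i : K →ₐ[Fq] K'} (hφ : φ.IsBaseChange φ' i)
    (n : φ.Isocrystal F p) :
    mapField F p hφ (tau F p φ n) = tau F p φ' (mapField F p hφ n) := by
  induction n using TensorProduct.induction_on with
  | zero => simp only [map_zero]
  | add y z hy hz => simp only [map_add, hy, hz]
  | tmul e m =>
    have h : Motive.mapField hφ (Motive.tau φ m) = Motive.tau φ' (Motive.mapField hφ m) := by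
      refine (Motive.toPoly φ').injective ?_
      have ht : TwistedPoly.map i (TwistedPoly.tau : TwistedPoly Fq K) = TwistedPoly.tau := by
        rw [TwistedPoly.tau, TwistedPoly.map_monomial, map_one, TwistedPoly.tau]
      rw [Motive.toPoly_mapField, Motive.toPoly_tau, Motive.toPoly_tau, Motive.toPoly_mapField,
        map_mul, ht]
    rw [mapField, tau, tau, semilinearBaseChange_tmul, semilinearBaseChange_tmul,
      semilinearBaseChange_tmul, semilinearBaseChange_tmul, h]
    exact congrArg (fun e' => e' ⊗ₜ[A ⊗[Fq] K'] Motive.tau φ' (Motive.mapField hφ m))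
      (partialFrob_comm i e)

/-- A homomorphism `u : φ → ψ` induces `T_0` of the isocrystal of `ψ` to `T_0` of that of `φ`. -/
def T0.mapHom {u : TwistedPoly Fq K} (hu : φ.IsHom ψ u) :
    ψ.T0 F p Kb →ₗ[p.adicCompletion F] φ.T0 F p Kb :=
  slopeZeroTate.map (AlgHom.id _ _) (fun _ => rfl) (fun _ => rfl)
    (Isocrystal.mapHom F p hu) (Isocrystal.mapHom_tau F p hu)

/-- An extension `ib : Kb → Kb'` of `i : K → K'` induces `T_0` of the isocrystal of `φ` to `T_0` of
that of its base change `φ'`. -/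
def T0.mapField {i : K →ₐ[Fq] K'} (ib : Kb →ₐ[Fq] Kb')
    (hib : ∀ x : K, ib (algebraMap K Kb x) = algebraMap K' Kb' (i x))
    (hφ : φ.IsBaseChange φ' i) : φ.T0 F p Kb →ₗ[p.adicCompletion F] φ'.T0 F p Kb' :=
  slopeZeroTate.map (CompletedTensor.map Fq _ _ ib)
    (fun x => by
      rw [CompletedTensor.baseChange_algebraMap, CompletedTensor.baseChange_algebraMap,
        CompletedTensor.map_map]
      change _ = CompletedTensor.map Fq _ _ _ (CompletedTensor.map Fq _ _ i x)
      rw [CompletedTensor.map_map]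
      congr 2
      ext y
      exact hib y)
    (partialFrob_comm ib) (Isocrystal.mapField F p hφ) (Isocrystal.mapField_tau F p hφ)

/-- The map on `T_0^∨ ⊗ Ω` induced by a homomorphism `φ → ψ`. -/
def DualT0Omega.mapHom {u : TwistedPoly Fq K} (hu : φ.IsHom ψ u) :
    φ.DualT0Omega F p Kb →ₗ[p.adicCompletion F] ψ.DualT0Omega F p Kb :=
  TensorProduct.AlgebraTensorModule.map (T0.mapHom F p hu).dualMap LinearMap.id

/-- The map on `T_0^∨ ⊗ Ω` induced by an extension of the base field; it is contravariant. -/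
def DualT0Omega.mapField {i : K →ₐ[Fq] K'} (ib : Kb →ₐ[Fq] Kb')
    (hib : ∀ x : K, ib (algebraMap K Kb x) = algebraMap K' Kb' (i x))
    (hφ : φ.IsBaseChange φ' i) :
    φ'.DualT0Omega F p Kb' →ₗ[p.adicCompletion F] φ.DualT0Omega F p Kb :=
  TensorProduct.AlgebraTensorModule.map (T0.mapField F p ib hib hφ).dualMap LinearMap.id

end DrinfeldModule

end Local

end Isocrystals

end

/-! Write `O` for `A_p`, `L` for `F_p`, `k` for the algebraic closure of `K`, and `M = K[τ]`. An
element `f` of the Tate module and `m ∈ M` give the function `y ↦ m(f(y))` on `L / O`. The resulting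
pairing of `M` with `L / O` is `A`-balanced, `K`-linear in `m`, and turns `τ` into the `q`-th power.
Conversely such a pairing is determined by its values at `m = 1`, and these form an element of the
Tate module. So the Tate module is the module of Frobenius equivariant pairings
(`isFrobeniusPairing_tatePairing`, `exists_tatePairing_eq`).

Choose an `Fq`-linear functional `l` on `L / O` whose kernel contains no nonzero `O`-submodule; it
plays the role of the residue. Since `O / ϖ ^ n` is then dual to the `ϖ ^ n`-torsion of `L / O`, it
identifies `O ⊗̂ k` with `Hom(L / O, k)` (`eq_of_completedPairing_eq`,
`exists_completedPairing_eq`). A pairing thus becomes a semilinear map `M → O ⊗̂ k` that commutes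
with Frobenius. Its extension to the isocrystal over `k` sends `τ`-invariants to `σ`-invariants of
`L ⊗̂ k`, and these are the elements of `L`, by the same duality over `Fq`. This is the comparison
map from the Tate module to the dual of `T_0`.

To see that it is bijective after inverting a uniformizer `π`, consider `X = (O ⊗̂ k) ⊗ M`. It is
`π`-torsion free and `π`-adically complete, and all `X / π ^ n X` are finite-dimensional over `k`
(`IsUniformizedCompletion.isFrobeniusLattice`). The fixed vectors of `X` form a finitely generated
`O`-module that spans `T_0`. Over the algebraically closed field `k` the map `τ - 1` is surjective
on finite-dimensional spaces (`exists_frobenius_eq_add`). Hence fixed vectors modulo `π ^ n` lift to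
`X`, and an equivariant functional that vanishes on fixed vectors is zero; this gives injectivity.

For surjectivity one has to extend functionals from the fixed vectors to equivariant functionals on
`X / π ^ n X` (`exists_frobenius_functional`). Fixed vectors independent over `Fq` stay independent
over `k`, and modulo their span `τ` is nilpotent, so the extension exists. It is unique, hence
depends linearly on the element of `L / O`, and so it assembles to a pairing. No injectivity of `τ`
modulo `π` is needed, so the characteristic of `φ` may be `p`.

Finally, by Nakayama's lemma at `p` the differential `dπ` generates the module of differentials up
to torsion, and it is not torsion because `F` is not finite over `Fq`. So `t ↦ t ⊗ dπ` identifies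
any `L`-vector space with its tensor product with the differentials (`bijective_tmul_differential`).
As `l` and `π` are chosen once for all `K` and `φ`, naturality reduces to that of the expression
`m(f(y))`. -/

noncomputable section

/-! ## Frobenius-semilinear endomorphisms over an algebraically closed field -/

section FrobeniusModule

open Polynomial

/-- The polynomials that express the coefficients `c 0, …, c n` of a solution `x = ∑ c i • τ ^ i y`
of `τ x = x + b • y` through the last one. -/
def frobeniusRecursion {k : Type*} [CommRing k] (q : ℕ) (a : ℕ → k) (b : k) : ℕ → k[X]
  | 0 => C (a 0) * X ^ q - C b
  | n + 1 => frobeniusRecursion q a b n ^ q + C (a (n + 1)) * X ^ q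

/-- All exponents are multiples of `q`, which vanishes in `k`. This makes the equation `P(c) = c`
separable. -/
lemma derivative_frobeniusRecursion {k : Type*} [CommRing k] {q : ℕ} (hq : (q : k) = 0)
    (a : ℕ → k) (b : k) (n : ℕ) : derivative (frobeniusRecursion q a b n) = 0 := by
  have hq' : (C (q : k) : k[X]) = 0 := by rw [hq, C_0]
  cases n with
  | zero => simp [frobeniusRecursion, derivative_X_pow, hq]
  | succ n => simp [frobeniusRecursion, derivative_pow, hq]

/-- This serves to avoid the trivial solution `c = 0` of the homogeneous equation: with `P = X ^ 2
S`, the equation `P(c) = c` may be replaced by `c S(c) = 1`. -/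
lemma X_sq_dvd_frobeniusRecursion {k : Type*} [CommRing k] {q : ℕ} (hq : 2 ≤ q)
    (a : ℕ → k) (n : ℕ) : (X : k[X]) ^ 2 ∣ frobeniusRecursion q a 0 n := by
  have hX : (X : k[X]) ^ 2 ∣ X ^ q := pow_dvd_pow _ hq
  induction n with
  | zero => simpa [frobeniusRecursion] using hX.mul_left _
  | succ n ih =>
    exact dvd_add (ih.trans (dvd_pow_self _ (by omega))) (hX.mul_left _)

/-- A nonzero polynomial in the recursion has degree at least `2`, so its `q`-th power has degree
greater than `q` and cannot be cancelled by the added term of degree at most `q`. -/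
lemma le_natDegree_frobeniusRecursion {k : Type*} [Field k] {q : ℕ} (hq : 2 ≤ q)
    {a : ℕ → k} {i n : ℕ} (hi : a i ≠ 0) (hin : i ≤ n) :
    q ≤ (frobeniusRecursion q a 0 n).natDegree := by
  induction n with
  | zero =>
    obtain rfl : i = 0 := by omega
    simp [frobeniusRecursion, natDegree_C_mul_X_pow q (a 0) hi]
  | succ n ih =>
    have hle : (C (a (n + 1)) * X ^ q : k[X]).natDegree ≤ q := natDegree_C_mul_X_pow_le _ _
    by_cases hn : i ≤ n
    · have h1 := ih hn
      have h2 : q < (frobeniusRecursion q a 0 n ^ q).natDegree := by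
        rw [natDegree_pow]
        nlinarith
      rw [frobeniusRecursion, natDegree_add_eq_left_of_natDegree_lt (by omega)]
      exact h2.le
    · obtain rfl : i = n + 1 := by omega
      by_cases h0 : frobeniusRecursion q a 0 n = 0
      · rw [frobeniusRecursion, h0, zero_pow (by omega), zero_add, natDegree_C_mul_X_pow _ _ hi]
      · have h3 : 2 ≤ (frobeniusRecursion q a 0 n).natDegree := by
          have := natDegree_le_of_dvd (X_sq_dvd_frobeniusRecursion hq a n) h0
          simpa using this
        have h2 : q < (frobeniusRecursion q a 0 n ^ q).natDegree := by
          rw [natDegree_pow]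
          nlinarith
        rw [frobeniusRecursion, natDegree_add_eq_left_of_natDegree_lt (by omega)]
        exact h2.le

/-- The difference `P - X` has derivative `-1`, so it is not constant. -/
lemma exists_eval_frobeniusRecursion {k : Type*} [Field k] [IsAlgClosed k] {q : ℕ}
    (hq : (q : k) = 0) (a : ℕ → k) (b : k) (n : ℕ) :
    ∃ c, (frobeniusRecursion q a b n).eval c = c := by
  obtain ⟨c, hc⟩ := IsAlgClosed.exists_root (frobeniusRecursion q a b n - X) (fun h => by
    have h1 := eq_C_of_degree_eq_zero h
    have h2 := congrArg derivative h1
    rw [derivative_sub, derivative_frobeniusRecursion hq, derivative_X, derivative_C] at h2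
    simp at h2)
  exact ⟨c, by simpa [sub_eq_zero] using hc⟩

lemma exists_ne_zero_eval_frobeniusRecursion {k : Type*} [Field k] [IsAlgClosed k] {q : ℕ}
    (hq : 2 ≤ q) {a : ℕ → k} {i n : ℕ} (hi : a i ≠ 0) (hin : i ≤ n) :
    ∃ c, c ≠ 0 ∧ (frobeniusRecursion q a 0 n).eval c = c := by
  obtain ⟨S, hS⟩ := X_sq_dvd_frobeniusRecursion hq a n
  have hS0 : S ≠ 0 := by
    rintro rfl
    have := le_natDegree_frobeniusRecursion hq hi hin
    rw [hS] at this
    simp at this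
    omega
  -- A root of `X S - 1` is automatically nonzero and satisfies `P(c) = c ^ 2 S(c) = c`.
  obtain ⟨c, hc⟩ := IsAlgClosed.exists_root (X * S - C 1) (fun h => by
    rw [degree_sub_C] at h
    · rw [degree_mul, degree_X, degree_eq_natDegree hS0] at h
      norm_cast at h
      omega
    · rw [degree_mul, degree_X, degree_eq_natDegree hS0]
      norm_cast
      omega)
  have hc' : c * S.eval c = 1 := by simpa [sub_eq_zero] using hc
  refine ⟨c, left_ne_zero_of_mul_eq_one hc', ?_⟩
  rw [hS, eval_mul, eval_pow, eval_X, pow_two, mul_assoc, hc', mul_one]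

variable {k : Type*} [Field k] {X : Type*} [AddCommGroup X] [Module k X]
variable {σ : k →+* k} {q : ℕ} (hσ : ∀ c, σ c = c ^ q) (τ : X →ₛₗ[σ] X)

include hσ in
-- Insert `x = ∑ c i • τ ^ i y` into `τ x = x + b • y` and rewrite the top iterate by the given
-- relation. With `c = c n`, comparison of coefficients gives `c 0 = a 0 c ^ q - b` and `c (i + 1) =
-- c i ^ q + a (i + 1) c ^ q`, which is the recursion; the remaining condition is that its last
-- value is `c`.
lemma frobeniusRecursion_solution (a : ℕ → k) (b c : k) (n : ℕ) (y : X)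
    (hc : (frobeniusRecursion q a b n).eval c = c)
    (hy : τ (τ^[n] y) = ∑ i ∈ Finset.range (n + 1), a i • τ^[i] y) :
    τ (∑ i ∈ Finset.range (n + 1), (frobeniusRecursion q a b i).eval c • τ^[i] y) =
      (∑ i ∈ Finset.range (n + 1), (frobeniusRecursion q a b i).eval c • τ^[i] y) + b • y := by
  -- The truncated identity holds for every `m`; the closing condition is only used afterwards.
  have key : ∀ m, τ (∑ i ∈ Finset.range m, (frobeniusRecursion q a b i).eval c • τ^[i] y) +
      ∑ i ∈ Finset.range (m + 1), (c ^ q * a i) • τ^[i] y =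
      (∑ i ∈ Finset.range (m + 1), (frobeniusRecursion q a b i).eval c • τ^[i] y) + b • y := by
    intro m
    induction m with
    | zero =>
      simp only [Finset.range_zero, Finset.sum_empty, map_zero, zero_add, Finset.sum_range_one,
        frobeniusRecursion, eval_sub, eval_mul, eval_C, eval_pow, eval_X, Function.iterate_zero,
        id_eq, ← add_smul, sub_add_cancel, mul_comm (a 0)]
    | succ m ih =>
      rw [Finset.sum_range_succ, map_add, Finset.sum_range_succ _ (m + 1), map_smulₛₗ, hσ,
        Finset.sum_range_succ _ (m + 1), add_right_comm _ (_ • _) (b • y), ← ih]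
      simp only [frobeniusRecursion, eval_add, eval_pow, eval_mul, eval_C, eval_X, add_smul,
        Function.iterate_succ_apply', mul_comm (a (m + 1))]
      abel
  rw [Finset.sum_range_succ, map_add, map_smulₛₗ, hσ, hc, hy, Finset.smul_sum]
  simp only [smul_smul]
  rw [key n, Finset.sum_range_succ, hc]

/-- In a finite-dimensional space, some iterate of `y` depends linearly on the previous ones. -/
lemma exists_iterate_mem_span [Module.Finite k X] (y : X) :
    ∃ n, τ^[n] y ∈ Submodule.span k ((fun i => τ^[i] y) '' (Finset.range n : Set ℕ)) := by
  obtain ⟨n, hn⟩ := monotone_stabilizes_iff_noetherian.mpr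
    (inferInstance : IsNoetherian k X)
    ⟨fun n => Submodule.span k ((fun i => τ^[i] y) '' (Finset.range n : Set ℕ)), fun m n h =>
      Submodule.span_mono (Set.image_mono (by simpa using h))⟩
  refine ⟨n, ?_⟩
  have h := hn (n + 1) (Nat.le_succ n)
  change Submodule.span k _ = Submodule.span k _ at h
  rw [h]
  exact Submodule.subset_span ⟨n, by simp, rfl⟩

lemma exists_eq_sum_of_mem_span {n : ℕ} {y z : X}
    (h : z ∈ Submodule.span k ((fun i => τ^[i] y) '' (Finset.range n : Set ℕ))) :
    ∃ a : ℕ → k, z = ∑ i ∈ Finset.range n, a i • τ^[i] y := by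
  classical
  obtain ⟨a, ha⟩ := (Submodule.mem_span_image_finset_iff_exists_fun k).mp h
  refine ⟨fun i => if hi : i ∈ Finset.range n then a ⟨i, hi⟩ else 0, ?_⟩
  rw [← ha, ← Finset.sum_coe_sort (Finset.range n)]
  exact Finset.sum_congr rfl fun i _ => by simp only [dif_pos i.2, Subtype.coe_eta]

include hσ in
/-- The Artin–Schreier–Lang theorem: `τ - 1` is surjective. -/
theorem exists_frobenius_eq_add [IsAlgClosed k] [Module.Finite k X] (hq : (q : k) = 0)
    (N : Submodule k X) (hN : ∀ x ∈ N, τ x ∈ N) {y : X} (hy : y ∈ N) :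
    ∃ x ∈ N, τ x = x + y := by
  have hiter : ∀ i, τ^[i] y ∈ N := by
    intro i
    induction i with
    | zero => exact hy
    | succ i ih => rw [Function.iterate_succ_apply']; exact hN _ ih
  obtain ⟨n, hn⟩ := exists_iterate_mem_span τ y
  obtain ⟨a, ha⟩ := exists_eq_sum_of_mem_span τ hn
  cases n with
  | zero => exact ⟨0, N.zero_mem, by simp at ha; simp [ha]⟩
  | succ n =>
    -- The solution with `b = 1` is a combination of iterates of `y`, so it stays in the stable
    -- subspace `N`.
    obtain ⟨c, hc⟩ := exists_eval_frobeniusRecursion hq a 1 n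
    rw [Function.iterate_succ_apply'] at ha
    refine ⟨_, N.sum_mem fun i _ => N.smul_mem _ (hiter i),
      (frobeniusRecursion_solution hσ τ a 1 c n y hc ha).trans (by rw [one_smul])⟩

include hσ in
/-- Without nonzero fixed vectors, every vector is killed by an iterate of `τ`. -/
theorem exists_iterate_eq_zero [IsAlgClosed k] [Module.Finite k X] (hq : 2 ≤ q)
    (h0 : ∀ x, τ x = x → x = 0) (y : X) : ∃ n, τ^[n] y = 0 := by
  classical
  have hex := exists_iterate_mem_span τ y
  obtain ⟨a, ha⟩ := exists_eq_sum_of_mem_span τ (Nat.find_spec hex)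
  have hmin := fun m => Nat.find_min hex (m := m)
  generalize Nat.find hex = n at ha hmin
  cases n with
  | zero => exact ⟨0, by simpa using ha⟩
  | succ n =>
    by_cases hz : ∀ i ≤ n, a i = 0
    · refine ⟨n + 1, ha.trans (Finset.sum_eq_zero fun i hi => ?_)⟩
      rw [hz i (by simpa [Nat.lt_succ_iff] using hi), zero_smul]
    · push Not at hz
      obtain ⟨i, hin, hi⟩ := hz
      -- A relation with a nonzero coefficient yields a fixed vector in which `τ ^ n y` has the
      -- coefficient `c ≠ 0`. This vector vanishes by hypothesis, so `τ ^ n y` depends on earlier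
      -- iterates, against the minimal choice of the relation.
      obtain ⟨c, hc0, hc⟩ := exists_ne_zero_eval_frobeniusRecursion hq hi hin
      rw [Function.iterate_succ_apply'] at ha
      have hx := h0 _ ((frobeniusRecursion_solution hσ τ a 0 c n y hc ha).trans (by simp))
      rw [Finset.sum_range_succ, hc] at hx
      refine absurd ?_ (hmin n n.lt_succ_self)
      rw [← Submodule.smul_mem_iff _ hc0, ← neg_eq_iff_add_eq_zero.mpr hx]
      exact Submodule.neg_mem _ (Submodule.sum_mem _ fun i hi =>
        Submodule.smul_mem _ _ (Submodule.subset_span ⟨i, by simpa using hi, rfl⟩))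

include hσ in
/-- An equivariant functional that vanishes on the fixed vectors is zero. -/
theorem frobenius_functional_eq_zero [IsAlgClosed k] [Module.Finite k X] (hq : (q : k) = 0)
    (h : X →ₗ[k] k) (hh : ∀ x, h (τ x) = h x ^ q) (h0 : ∀ x, τ x = x → h x = 0) : h = 0 := by
  by_contra hne
  obtain ⟨x, hx⟩ : ∃ x, h x = 1 := by
    obtain ⟨x, hx⟩ := DFunLike.ne_iff.mp hne
    exact ⟨(h x)⁻¹ • x, by rw [map_smul, smul_eq_mul, inv_mul_cancel₀ hx]⟩
  have hq0 : q ≠ 0 := by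
    rintro rfl
    have h1 := hσ 0
    simp at h1
  -- The kernel of `h` is stable under `τ` and contains `τ x - x`. Solving `τ z - z = τ x - x`
  -- inside the kernel produces the fixed vector `x - z` with `h (x - z) = 1`.
  obtain ⟨z, hz, hz'⟩ := exists_frobenius_eq_add hσ τ hq (LinearMap.ker h)
    (fun x hx => by
      rw [LinearMap.mem_ker] at hx ⊢
      rw [hh, hx, zero_pow hq0]) (y := τ x - x) (by simp [hh, hx])
  have h1 := h0 (x - z) (by rw [map_sub, hz']; abel)
  rw [map_sub, hx, LinearMap.mem_ker.mp hz] at h1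
  simp at h1

end FrobeniusModule

/-! ### Fixed vectors over the finite field and equivariant extension of functionals. -/

section FrobeniusFixedVectors

open Polynomial

variable {k : Type*} [Field k] {X : Type*} [AddCommGroup X] [Module k X]
variable {σ : k →+* k} (τ : X →ₛₗ[σ] X)
variable {Fq : Type*} [Field Fq] [Fintype Fq]

/-- The polynomial `X ^ q - X` already splits over `Fq`, so it acquires no new roots in `k`. -/
lemma exists_algebraMap_eq_of_pow_card_eq [Algebra Fq k] {c : k} (hc : c ^ Fintype.card Fq = c) :
    ∃ a, algebraMap Fq k a = c := by
  have hs : (X ^ Fintype.card Fq - X : Fq[X]).Splits := by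
    rw [splits_iff_card_roots, FiniteField.roots_X_pow_card_sub_X,
      FiniteField.X_pow_card_sub_X_natDegree_eq Fq Fintype.one_lt_card]
    simp
  have h1 := hs.roots_map (algebraMap Fq k)
  rw [FiniteField.roots_X_pow_card_sub_X] at h1
  have h2 : c ∈ ((X ^ Fintype.card Fq - X : Fq[X]).map (algebraMap Fq k)).roots := by
    rw [mem_roots (Polynomial.map_ne_zero
      (FiniteField.X_pow_card_sub_X_ne_zero Fq Fintype.one_lt_card))]
    simp [hc]
  rw [h1, Multiset.mem_map] at h2
  obtain ⟨a, -, ha⟩ := h2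
  exact ⟨a, ha⟩

variable [Algebra Fq k] [Module Fq X] [IsScalarTower Fq k X]
variable (hσ : ∀ c, σ c = c ^ Fintype.card Fq)

include hσ in
/-- Fixed vectors that are linearly independent over the finite field remain so over `k`. -/
theorem LinearIndependent.of_frobenius_fixed {ι : Type*} {v : ι → X} (hv : ∀ i, τ (v i) = v i)
    (hli : LinearIndependent Fq v) : LinearIndependent k v := by
  classical
  rw [linearIndependent_iff']
  intro s
  induction s using Finset.strongInduction with
  | H s ih =>
    intro g hg
    by_contra! hne
    obtain ⟨j, hj, hgj⟩ := hne
    let f : ι → k := fun i => (g j)⁻¹ * g i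
    have hf : ∑ i ∈ s, f i • v i = 0 := by
      simp only [f, mul_smul]
      rw [← Finset.smul_sum, hg, smul_zero]
    have hfj : f j = 1 := inv_mul_cancel₀ hgj
    -- Artin's argument: subtracting the normalized relation from its image under `τ` removes the
    -- term at `j`. By induction the shorter relation is trivial, so all coefficients lie in `Fq`.
    have hf' : ∑ i ∈ s, (f i ^ Fintype.card Fq - f i) • v i = 0 := by
      simp only [sub_smul, Finset.sum_sub_distrib, hf, sub_zero]
      have h := congrArg τ hf
      rw [map_sum, map_zero] at h
      rw [← h]
      exact Finset.sum_congr rfl fun i _ => by rw [map_smulₛₗ, hσ, hv]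
    have hfix : ∀ i ∈ s, f i ^ Fintype.card Fq = f i := by
      rw [← Finset.add_sum_erase s _ hj, hfj, one_pow, sub_self, zero_smul, zero_add] at hf'
      intro i hi
      by_cases hij : i = j
      · rw [hij, hfj, one_pow]
      · exact sub_eq_zero.mp (ih _ (Finset.erase_ssubset hj) _ hf' i (Finset.mem_erase.mpr ⟨hij, hi⟩))
    choose! a ha using fun i hi => exists_algebraMap_eq_of_pow_card_eq (hfix i hi)
    have h0 : ∑ i ∈ s, a i • v i = 0 := by
      rw [← hf]
      exact Finset.sum_congr rfl fun i hi => by rw [← ha i hi, algebraMap_smul]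
    have h1 := linearIndependent_iff'.mp hli s a h0 j hj
    have h2 := ha j hj
    rw [h1, map_zero, hfj] at h2
    exact zero_ne_one h2

include hσ in
/-- The fixed vectors of a finite-dimensional space form a finite-dimensional space over the finite
field. -/
theorem finite_of_frobenius_fixed [Module.Finite k X] {W : Type*} [AddCommGroup W] [Module Fq W]
    (j : W →ₗ[Fq] X) (hinj : Function.Injective j) (hj : ∀ w, τ (j w) = j w) :
    Module.Finite Fq W := by
  let b := Module.Free.chooseBasis Fq W
  have h1 : LinearIndependent k (j ∘ b) := LinearIndependent.of_frobenius_fixed τ hσ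
    (fun i => hj _) (b.linearIndependent.map' j (LinearMap.ker_eq_bot.mpr hinj))
  have := h1.finite
  exact Module.Finite.of_basis b

include hσ in
/-- Functionals on the fixed vectors extend to equivariant functionals. -/
theorem exists_frobenius_functional [IsAlgClosed k] [Module.Finite k X]
    {W : Type*} [AddCommGroup W] [Module Fq W] (j : W →ₗ[Fq] X)
    (hj : ∀ x, τ x = x ↔ x ∈ LinearMap.range j) (l : W →ₗ[Fq] Fq)
    (hl : LinearMap.ker j ≤ LinearMap.ker l) :
    ∃ h : X →ₗ[k] k, (∀ x, h (τ x) = h x ^ Fintype.card Fq) ∧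
      ∀ w, h (j w) = algebraMap Fq k (l w) := by
  have hqk : ((Fintype.card Fq : ℕ) : k) = 0 := by
    rw [← map_natCast (algebraMap Fq k), FiniteField.cast_card_eq_zero, map_zero]
  have hq2 : 2 ≤ Fintype.card Fq := Fintype.one_lt_card
  -- the fixed vectors
  let l' : LinearMap.range j →ₗ[Fq] Fq :=
    ((LinearMap.ker j).liftQ l hl).comp j.quotKerEquivRange.symm.toLinearMap
  have hl' : ∀ w, l' ⟨j w, w, rfl⟩ = l w := by
    intro w
    change ((LinearMap.ker j).liftQ l hl) (j.quotKerEquivRange.symm _) = _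
    rw [show (⟨j w, w, rfl⟩ : LinearMap.range j) = j.quotKerEquivRange (Submodule.Quotient.mk w)
      from rfl, LinearEquiv.symm_apply_apply]
    rfl
  let b := Module.Free.chooseBasis Fq (LinearMap.range j)
  have hb : LinearIndependent k (fun i => (b i : X)) :=
    LinearIndependent.of_frobenius_fixed τ hσ (fun i => (hj _).mpr (b i).2)
      (b.linearIndependent.map' (LinearMap.range j).subtype (Submodule.ker_subtype _))
  -- Since an `Fq`-basis of the fixed vectors is independent over `k`, a linear left inverse yields
  -- a `k`-linear extension of `l'` to `X`. Its equivariance is only claimed on the span `Y` of the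
  -- fixed vectors.
  obtain ⟨g, hg⟩ := LinearMap.exists_leftInverse_of_injective _ (LinearMap.ker_eq_bot.mpr hb)
  let h1 : X →ₗ[k] k :=
    (Finsupp.linearCombination k (fun i => algebraMap Fq k (l' (b i)))).comp g
  have hh1 : ∀ w : LinearMap.range j, h1 w = algebraMap Fq k (l' w) := by
    have hh2 : (h1.restrictScalars Fq).comp (LinearMap.range j).subtype =
        (Algebra.linearMap Fq k).comp l' := by
      refine b.ext fun i => ?_
      have h3 : (b i : X) = Finsupp.linearCombination k (fun i => (b i : X))
          (Finsupp.single i 1) := by simp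
      have h4 := LinearMap.congr_fun hg (Finsupp.single i 1)
      change h1 (b i) = algebraMap Fq k (l' (b i))
      rw [h3]
      change Finsupp.linearCombination k _ ((g ∘ₗ Finsupp.linearCombination k _) _) = _
      rw [h4]
      simp
    exact fun w => LinearMap.congr_fun hh2 w
  let Y : Submodule k X := Submodule.span k (LinearMap.range j : Set X)
  have hY : ∀ y ∈ Y, τ y ∈ Y ∧ h1 (τ y) = h1 y ^ Fintype.card Fq := by
    intro y hy
    induction hy using Submodule.span_induction with
    | mem y hy =>
      have h2 := hh1 ⟨y, hy⟩
      simp only at h2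
      rw [(hj y).mpr hy]
      refine ⟨Submodule.subset_span hy, ?_⟩
      rw [h2, ← map_pow, FiniteField.pow_card]
    | zero => simp [Fintype.card_ne_zero]
    | add y z _ _ hy hz =>
      refine ⟨by rw [map_add]; exact Y.add_mem hy.1 hz.1, ?_⟩
      rw [map_add, map_add, map_add, hy.2, hz.2]
      exact (map_add (FiniteField.frobeniusAlgHom Fq k) _ _).symm
    | smul c y _ hy =>
      refine ⟨by rw [map_smulₛₗ]; exact Y.smul_mem _ hy.1, ?_⟩
      rw [map_smulₛₗ, map_smul, map_smul, hy.2, hσ, smul_eq_mul, smul_eq_mul, mul_pow]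
  -- some iterate of `τ` maps into their span
  have hnil : ∀ x, ∃ n, τ^[n] x ∈ Y := by
    let τ' : X ⧸ Y →ₛₗ[σ] X ⧸ Y := Submodule.mapQ Y Y τ fun y hy => (hY y hy).1
    have hτ' : ∀ n x, τ'^[n] (Submodule.Quotient.mk x) = Submodule.Quotient.mk (τ^[n] x) := by
      intro n x
      induction n with
      | zero => rfl
      | succ n ih => rw [Function.iterate_succ_apply', ih, Function.iterate_succ_apply']; rfl
    -- By surjectivity of `τ - 1` on `Y`, a fixed vector of `X / Y` lifts to a fixed vector of `X`,
    -- which lies in `Y`.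
    have h0 : ∀ x, τ' x = x → x = 0 := by
      intro x hx
      obtain ⟨x, rfl⟩ := Submodule.Quotient.mk_surjective _ x
      have h2 : τ x - x ∈ Y := (Submodule.Quotient.eq Y).mp hx
      obtain ⟨z, hz, hz'⟩ := exists_frobenius_eq_add hσ τ hqk Y (fun y hy => (hY y hy).1) h2
      have h3 : x - z ∈ Y := Submodule.subset_span ((hj _).mp (by rw [map_sub, hz']; abel))
      rw [Submodule.Quotient.mk_eq_zero]
      simpa using Y.add_mem h3 hz
    intro x
    obtain ⟨n, hn⟩ := exists_iterate_eq_zero hσ τ' hq2 h0 (Submodule.Quotient.mk x)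
    rw [hτ', Submodule.Quotient.mk_eq_zero] at hn
    exact ⟨n, hn⟩
  have hsmul : ∀ n (c : k) x, τ^[n] (c • x) = (c ^ Fintype.card Fq ^ n) • τ^[n] x := by
    intro n c x
    induction n with
    | zero => simp
    | succ n ih =>
      rw [Function.iterate_succ_apply', ih, map_smulₛₗ, hσ, Function.iterate_succ_apply', pow_succ,
        pow_mul]
  have hadd : ∀ n x y, τ^[n] (x + y) = τ^[n] x + τ^[n] y := fun n x y =>
    iterate_map_add τ n x y
  have hmono : ∀ {m n x}, m ≤ n → τ^[m] x ∈ Y → τ^[n] x ∈ Y := by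
    intro m n x hmn hm
    obtain ⟨d, rfl⟩ := Nat.exists_eq_add_of_le' hmn
    rw [Function.iterate_add_apply]
    generalize τ^[m] x = y at hm
    induction d with
    | zero => exact hm
    | succ d ih =>
      rw [Function.iterate_succ_apply']
      exact (hY _ (ih (by omega))).1
  -- The exponent can be chosen uniformly: the subspaces of vectors mapped into `Y` by `τ ^ n`
  -- increase with `n` and stabilize.
  obtain ⟨N, hN⟩ : ∃ N, ∀ x, τ^[N] x ∈ Y := by
    let Z : ℕ →o Submodule k X :=
      { toFun := fun n =>
          { carrier := {x | τ^[n] x ∈ Y}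
            zero_mem' := by
              have := hsmul n 0 0
              simp only [smul_zero, zero_pow (pow_ne_zero n Fintype.card_ne_zero), zero_smul] at this
              simp [this]
            add_mem' := fun {x y} hx hy => by
              simp only [Set.mem_ofPred_eq, hadd] at *
              exact Y.add_mem hx hy
            smul_mem' := fun c x hx => by
              simp only [Set.mem_ofPred_eq, hsmul] at *
              exact Y.smul_mem _ hx }
        monotone' := fun m n hmn x hx => hmono hmn hx }
    obtain ⟨N, hN⟩ := monotone_stabilizes_iff_noetherian.mpr (inferInstance : IsNoetherian k X) Z
    refine ⟨N, fun x => ?_⟩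
    obtain ⟨n, hn⟩ := hnil x
    rcases le_total N n with h | h
    · have hx : x ∈ Z n := hn
      rw [← hN n h] at hx
      exact hx
    · exact hmono h hn
  -- divide by a power of the Frobenius of `k`
  let Fr : k →ₐ[Fq] k := FiniteField.frobeniusAlgHom Fq k ^ N
  have hFr : ∀ c, Fr c = c ^ Fintype.card Fq ^ N := by
    have h2 : ∀ n c, (FiniteField.frobeniusAlgHom Fq k ^ n) c = c ^ Fintype.card Fq ^ n := by
      intro n c
      induction n with
      | zero => simp
      | succ n ih =>
        rw [pow_succ', AlgHom.mul_apply, ih, FiniteField.coe_frobeniusAlgHom, pow_succ, pow_mul]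
    exact h2 N
  let e : k ≃ₐ[Fq] k := AlgEquiv.ofBijective Fr ⟨Fr.toRingHom.injective, fun c => by
    obtain ⟨d, hd⟩ := IsAlgClosed.exists_pow_nat_eq c
      (n := Fintype.card Fq ^ N) (pow_pos Fintype.card_pos N)
    exact ⟨d, (hFr d).trans hd⟩⟩
  have he : ∀ c, e c = c ^ Fintype.card Fq ^ N := hFr
  -- Equivariance forces the `q ^ N`-th power of the value at `x` to be the value at `τ ^ N x`,
  -- which lies in `Y`. This determines the functional because `k` is perfect.
  refine ⟨{ toFun := fun x => e.symm (h1 (τ^[N] x))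
            map_add' := fun x y => by rw [hadd, map_add, map_add]
            map_smul' := fun c x => by
              rw [hsmul, map_smul, smul_eq_mul, map_mul, ← he, AlgEquiv.symm_apply_apply]
              rfl }, fun x => ?_, fun w => ?_⟩
  · change e.symm (h1 (τ^[N] (τ x))) = e.symm (h1 (τ^[N] x)) ^ Fintype.card Fq
    rw [← Function.iterate_succ_apply, Function.iterate_succ_apply', (hY _ (hN x)).2, map_pow]
  · change e.symm (h1 (τ^[N] (j w))) = _
    have h2 : τ^[N] (j w) = j w := Function.iterate_fixed ((hj _).mpr ⟨w, rfl⟩) N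
    have h3 := hh1 ⟨j w, w, rfl⟩
    rw [hl'] at h3
    rw [h2, h3, AlgEquiv.commutes]

end FrobeniusFixedVectors

end

noncomputable section

/-! ## Frobenius modules over a complete discrete valuation ring -/

/-- Let `X` be a vector space over `k` and, compatibly, a module over `O`, on which `ϖ ∈ O` is
injective, which is complete for the `ϖ`-adic topology, and such that the quotients `X / ϖ ^ n X`
are finite-dimensional over `k`. -/
structure IsFrobeniusLattice (Fq k : Type*) {O X : Type*} [Field Fq] [Field k] [CommRing O]
    [Algebra Fq k] [Algebra Fq O] [AddCommGroup X] [Module Fq X] [Module k X] [Module O X]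
    [SMulCommClass O k X] (ϖ : O) : Prop where
  eq_zero_of_smul : ∀ x : X, ϖ • x = 0 → x = 0
  isAdicComplete : IsAdicComplete (Ideal.span {ϖ}) X
  finite : ∀ n, Module.Finite k (X ⧸ LinearMap.range (DistribSMul.toLinearMap k X (ϖ ^ n)))

lemma mem_span_pow_smul_top {O X : Type*} [CommRing O] [AddCommGroup X] [Module O X]
    (ϖ : O) (n : ℕ) (x : X) :
    x ∈ (Ideal.span {ϖ} ^ n • ⊤ : Submodule O X) ↔ ∃ y, ϖ ^ n • y = x := by
  rw [Ideal.span_singleton_pow, Submodule.ideal_span_singleton_smul,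
    Submodule.mem_smul_pointwise_iff_exists]
  simp

/-- The fixed vectors of an `O`-linear endomorphism. -/
def fixedSubmodule (O : Type*) {X : Type*} [CommRing O] [AddCommGroup X] [Module O X]
    (τ : X →+ X) (hτ : ∀ (b : O) x, τ (b • x) = b • τ x) : Submodule O X where
  carrier := {x | τ x = x}
  zero_mem' := map_zero τ
  add_mem' {x y} hx hy := by
    rw [Set.mem_ofPred_eq] at *
    rw [map_add, hx, hy]
  smul_mem' b x hx := by
    rw [Set.mem_ofPred_eq] at *
    rw [hτ, hx]

namespace IsFrobeniusLattice

variable {Fq k O X : Type*} [Field Fq] [Fintype Fq] [Field k] [IsAlgClosed k] [CommRing O]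
variable [Algebra Fq k] [Algebra Fq O] [AddCommGroup X] [Module Fq X] [Module k X] [Module O X]
variable [SMulCommClass O k X]
variable {ϖ : O} (hX : IsFrobeniusLattice Fq k (X := X) ϖ)
variable {σ : k →+* k} (hσ : ∀ c, σ c = c ^ Fintype.card Fq)
variable (τ : X →ₛₗ[σ] X) (hτ : ∀ (b : O) x, τ (b • x) = b • τ x)

/-- The reduction of `τ` modulo `ϖ ^ n`. -/
def reduction (ϖ : O) (n : ℕ) :
    X ⧸ LinearMap.range (DistribSMul.toLinearMap k X (ϖ ^ n)) →ₛₗ[σ]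
      X ⧸ LinearMap.range (DistribSMul.toLinearMap k X (ϖ ^ n)) :=
  Submodule.mapQ _ _ τ (by
    rintro _ ⟨x, rfl⟩
    exact ⟨τ x, (hτ _ _).symm⟩)

lemma reduction_mk (n : ℕ) (x : X) :
    reduction τ hτ ϖ n (Submodule.Quotient.mk x) = Submodule.Quotient.mk (τ x) := rfl

lemma mk_eq_mk_iff (n : ℕ) (x y : X) :
    (Submodule.Quotient.mk x : X ⧸ LinearMap.range (DistribSMul.toLinearMap k X (ϖ ^ n))) =
      Submodule.Quotient.mk y ↔ ∃ z, ϖ ^ n • z = x - y :=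
  Submodule.Quotient.eq _

include hX in
lemma eq_zero_of_pow_smul (n : ℕ) {x : X} (hx : ϖ ^ n • x = 0) : x = 0 := by
  induction n generalizing x with
  | zero => simpa using hx
  | succ n ih =>
    rw [pow_succ', mul_smul] at hx
    exact ih (hX.eq_zero_of_smul _ hx)

include hX hσ hτ in
-- The `O`-linear map `τ - 1` is surjective modulo `ϖ` by the finite-dimensional case, and
-- completeness of `X` propagates this to `X`.
lemma exists_eq_add (y : X) : ∃ x, τ x = x + y := by
  have hqk : ((Fintype.card Fq : ℕ) : k) = 0 := by
    rw [← map_natCast (algebraMap Fq k), FiniteField.cast_card_eq_zero, map_zero]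
  have := hX.isAdicComplete
  let f : X →ₗ[O] X :=
    { toFun := fun x => τ x - x
      map_add' := fun x y => by rw [map_add]; abel
      map_smul' := fun b x => by rw [hτ, RingHom.id_apply, smul_sub] }
  obtain ⟨x, hx⟩ := surjective_of_mkQ_comp_surjective (I := Ideal.span {ϖ}) (f := f) (fun z => by
    obtain ⟨z, rfl⟩ := Submodule.Quotient.mk_surjective _ z
    have := hX.finite 1
    obtain ⟨x, -, hx⟩ := exists_frobenius_eq_add hσ (reduction τ hτ ϖ 1) hqk ⊤
      (fun _ _ => trivial) (y := Submodule.Quotient.mk z) trivial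
    obtain ⟨x, rfl⟩ := Submodule.Quotient.mk_surjective _ x
    rw [reduction_mk, ← Submodule.Quotient.mk_add, mk_eq_mk_iff] at hx
    obtain ⟨w, hw⟩ := hx
    refine ⟨x, ?_⟩
    refine (Submodule.Quotient.eq _).mpr ?_
    rw [← pow_one (Ideal.span {ϖ}), mem_span_pow_smul_top]
    refine ⟨w, hw.trans ?_⟩
    change _ = (τ x - x) - z
    abel) y
  exact ⟨x, by rw [← hx]; change τ x = x + (τ x - x); abel⟩

include hX hσ hτ in
/-- Fixed vectors modulo `ϖ ^ n` lift to fixed vectors. -/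
lemma exists_fixed_lift (n : ℕ) {x : X} (hx : ∃ z, ϖ ^ n • z = τ x - x) :
    ∃ w, τ w = w ∧ ∃ z, ϖ ^ n • z = x - w := by
  obtain ⟨y, hy⟩ := hx
  obtain ⟨z, hz⟩ := hX.exists_eq_add hσ τ hτ y
  -- With `τ x - x = ϖ ^ n y` and `τ z = z + y`, subtracting `ϖ ^ n z` cancels the defect.
  refine ⟨x - ϖ ^ n • z, ?_, z, by abel⟩
  rw [map_sub, hτ, hz, smul_add, hy]
  abel

include hX hτ in
-- Because `ϖ` is injective on `X`, the fixed vectors are saturated: those divisible by `ϖ ^ n` in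
-- `X` are `ϖ ^ n` times fixed vectors.
lemma fixed_of_pow_smul (n : ℕ) {z : X} (hz : τ (ϖ ^ n • z) = ϖ ^ n • z) : τ z = z := by
  rw [hτ] at hz
  exact sub_eq_zero.mp (hX.eq_zero_of_pow_smul n (by rw [smul_sub, hz, sub_self]))

include hX hσ hτ in
/-- An equivariant functional that kills `ϖ ^ n X` and the fixed vectors is zero. -/
theorem functional_eq_zero (n : ℕ) (h : X →ₗ[k] k) (hh : ∀ x, h (τ x) = h x ^ Fintype.card Fq)
    (hn : ∀ x, h (ϖ ^ n • x) = 0) (h0 : ∀ x, τ x = x → h x = 0) : h = 0 := by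
  have hqk : ((Fintype.card Fq : ℕ) : k) = 0 := by
    rw [← map_natCast (algebraMap Fq k), FiniteField.cast_card_eq_zero, map_zero]
  have := hX.finite n
  let N := LinearMap.range (DistribSMul.toLinearMap k X (ϖ ^ n))
  let h' : X ⧸ N →ₗ[k] k := N.liftQ h (by
    rintro _ ⟨x, rfl⟩
    exact hn x)
  -- Fixed vectors of the quotient lift to fixed vectors of `X`, so the finite-dimensional statement
  -- applies to `h'`.
  have h1 : h' = 0 := by
    refine frobenius_functional_eq_zero hσ (reduction τ hτ ϖ n) hqk h' (fun x => ?_)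
      (fun x hx => ?_)
    · obtain ⟨x, rfl⟩ := Submodule.Quotient.mk_surjective _ x
      exact hh x
    · obtain ⟨x, rfl⟩ := Submodule.Quotient.mk_surjective _ x
      rw [reduction_mk, mk_eq_mk_iff] at hx
      obtain ⟨w, hw, z, hz⟩ := hX.exists_fixed_lift hσ τ hτ n hx
      change h x = 0
      rw [← sub_add_cancel x w, ← hz, map_add, hn, h0 w hw, add_zero]
  exact LinearMap.ext fun x => LinearMap.congr_fun h1 (Submodule.Quotient.mk x)

variable [IsScalarTower Fq k X] [IsScalarTower Fq O X]

include hX hσ hτ in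
/-- Functionals on the fixed vectors extend to equivariant functionals. -/
theorem exists_functional (n : ℕ) (l : fixedSubmodule O τ.toAddMonoidHom hτ →ₗ[Fq] Fq)
    (hl : ∀ w, l (ϖ ^ n • w) = 0) :
    ∃ h : X →ₗ[k] k, (∀ x, h (τ x) = h x ^ Fintype.card Fq) ∧ (∀ x, h (ϖ ^ n • x) = 0) ∧
      ∀ w, h w.1 = algebraMap Fq k (l w) := by
  have := hX.finite n
  let N := LinearMap.range (DistribSMul.toLinearMap k X (ϖ ^ n))
  let j : fixedSubmodule O τ.toAddMonoidHom hτ →ₗ[Fq] X ⧸ N :=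
    (N.mkQ.restrictScalars Fq).comp
      ((fixedSubmodule O τ.toAddMonoidHom hτ).subtype.restrictScalars Fq)
  obtain ⟨h, h1, h2⟩ := exists_frobenius_functional (reduction τ hτ ϖ n) hσ j (fun x => by
    constructor
    · intro hx
      obtain ⟨x, rfl⟩ := Submodule.Quotient.mk_surjective _ x
      rw [reduction_mk, mk_eq_mk_iff] at hx
      obtain ⟨w, hw, hz⟩ := hX.exists_fixed_lift hσ τ hτ n hx
      exact ⟨⟨w, hw⟩, ((mk_eq_mk_iff n x w).mpr hz).symm⟩
    · rintro ⟨w, rfl⟩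
      exact congrArg Submodule.Quotient.mk w.2) l (fun w hw => by
    -- By saturation, a fixed vector that dies modulo `ϖ ^ n` is `ϖ ^ n` times a fixed vector, and
    -- `l` kills it.
    obtain ⟨z, hz⟩ := (Submodule.Quotient.mk_eq_zero N).mp (LinearMap.mem_ker.mp hw)
    have hz' : ϖ ^ n • z = w.1 := hz
    have hzf : τ z = z := hX.fixed_of_pow_smul τ hτ n (by rw [hz']; exact w.2)
    have : w = ϖ ^ n • (⟨z, hzf⟩ : fixedSubmodule O τ.toAddMonoidHom hτ) := Subtype.ext hz'.symm
    rw [LinearMap.mem_ker, this, hl])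
  refine ⟨h.comp N.mkQ, fun x => h1 (Submodule.Quotient.mk x), fun x => ?_, h2⟩
  have : N.mkQ (ϖ ^ n • x) = 0 := (Submodule.Quotient.mk_eq_zero N).mpr ⟨x, rfl⟩
  rw [LinearMap.comp_apply, this, map_zero]

include hX hσ in
/-- The fixed vectors form a finitely generated module. -/
theorem finite_fixedSubmodule (hO : IsPrecomplete (Ideal.span {ϖ}) O) :
    Module.Finite O (fixedSubmodule O τ.toAddMonoidHom hτ) := by
  have := hX.finite 1
  have hc := hX.isAdicComplete
  set H := fixedSubmodule O τ.toAddMonoidHom hτ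
  let N := LinearMap.range (DistribSMul.toLinearMap k X (ϖ ^ 1))
  let j : H →ₗ[Fq] X ⧸ N := (N.mkQ.restrictScalars Fq).comp (H.subtype.restrictScalars Fq)
  -- The image modulo `ϖ` consists of vectors fixed by the reduction of `τ`; an `Fq`-basis of it is
  -- independent over `k`, hence finite.
  have hfin : Module.Finite Fq (LinearMap.range j) :=
    finite_of_frobenius_fixed (reduction τ hτ ϖ 1) hσ (LinearMap.range j).subtype
      Subtype.val_injective (by
        rintro ⟨_, w, rfl⟩
        exact congrArg Submodule.Quotient.mk w.2)
  obtain ⟨s, g, hg⟩ := Module.Finite.exists_fin (R := Fq) (M := LinearMap.range j)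
  choose w hw using fun i => (g i).2
  have hprec : IsPrecomplete (Ideal.span {ϖ}) (Fin s → O) := ⟨fun f hf => by
    have h1 : ∀ i, ∃ l : O, ∀ n, f n i ≡ l [SMOD (Ideal.span {ϖ} ^ n • ⊤ : Submodule O O)] := by
      refine fun i => hO.prec' _ fun {m n} hmn => ?_
      have h := hf hmn
      rw [SModEq.sub_mem, mem_span_pow_smul_top] at h ⊢
      obtain ⟨y, hy⟩ := h
      exact ⟨y i, congrFun hy i⟩
    choose l hl using h1
    refine ⟨l, fun n => ?_⟩
    have h2 := fun i => (mem_span_pow_smul_top ϖ n _).mp (SModEq.sub_mem.mp (hl i n))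
    choose y hy using h2
    rw [SModEq.sub_mem, mem_span_pow_smul_top]
    exact ⟨y, funext hy⟩⟩
  have hH : IsHausdorff (Ideal.span {ϖ}) H := ⟨fun x hx => Subtype.ext (by
    refine hc.haus' x.1 fun n => ?_
    have h := hx n
    rw [SModEq.sub_mem, mem_span_pow_smul_top] at h ⊢
    obtain ⟨y, hy⟩ := h
    exact ⟨y.1, congrArg Subtype.val hy⟩)⟩
  -- A topological Nakayama argument: lifts of generators modulo `ϖ` generate, as `O ^ s` is
  -- precomplete and the fixed submodule is Hausdorff. Saturation ensures that congruence modulo `ϖ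
  -- X` gives congruence modulo `ϖ` inside the fixed submodule.
  have hsurj : Function.Surjective (Fintype.linearCombination O w) := by
    refine surjective_of_mkQ_comp_surjective (I := Ideal.span {ϖ}) fun x => ?_
    obtain ⟨x, rfl⟩ := Submodule.Quotient.mk_surjective _ x
    have hx : (⟨j x, x, rfl⟩ : LinearMap.range j) ∈ Submodule.span Fq (Set.range g) := by
      rw [hg]; trivial
    obtain ⟨c, hc⟩ := (Submodule.mem_span_range_iff_exists_fun Fq).mp hx
    refine ⟨fun i => algebraMap Fq O (c i), (Submodule.Quotient.eq _).mpr ?_⟩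
    have h1 : j (∑ i, c i • w i - x) = 0 := by
      rw [map_sub, map_sum, sub_eq_zero]
      refine Eq.trans ?_ (congrArg Subtype.val hc)
      rw [AddSubmonoidClass.coe_finsetSum]
      exact Finset.sum_congr rfl fun i _ => by rw [map_smul, hw]; rfl
    obtain ⟨z, hz⟩ := (Submodule.Quotient.mk_eq_zero N).mp h1
    have hz' : ϖ ^ 1 • z = (∑ i, c i • w i - x : H).1 := hz
    have hzf : τ z = z := hX.fixed_of_pow_smul τ hτ 1 (by
      rw [hz']; exact (∑ i, c i • w i - x : H).2)
    rw [← pow_one (Ideal.span {ϖ}), mem_span_pow_smul_top]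
    refine ⟨⟨z, hzf⟩, Subtype.ext (hz'.trans (congrArg Subtype.val ?_))⟩
    rw [Fintype.linearCombination_apply]
    simp only [algebraMap_smul]
  exact Module.Finite.of_surjective _ hsurj

end IsFrobeniusLattice

end

noncomputable section

/-! ## Pairings induced by functionals on modules over an algebra -/

section QuotientPairing

variable {Fq O Y : Type*} [Field Fq] [CommRing O] [Algebra Fq O] [AddCommGroup Y] [Module O Y]
variable [Module Fq Y] [IsScalarTower Fq O Y]

/-- The pairing between `O ⊗ V` and an `O`-module `Y` given by a functional on `Y`. -/
def quotientPairing (l : Y →ₗ[Fq] Fq) (V : Type*) [AddCommGroup V]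
    [Module Fq V] : O ⊗[Fq] V →ₗ[Fq] Y →ₗ[Fq] V :=
  TensorProduct.lift (LinearMap.mk₂ Fq
    (fun b v => (LinearMap.toSpanSingleton Fq V v).comp
      (l.comp (Algebra.lsmul Fq Fq Y b)))
    (fun b c v => by ext y; simp [add_smul])
    (fun a b v => by ext y; simp [mul_smul])
    (fun b v w => by ext y; simp)
    (fun a b v => by ext y; simp [smul_smul, mul_comm]))

variable (l : Y →ₗ[Fq] Fq) {V : Type*} [AddCommGroup V] [Module Fq V]

lemma quotientPairing_tmul (b : O) (v : V) (y : Y) :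
    quotientPairing l V (b ⊗ₜ v) y = l (b • y) • v := rfl

lemma quotientPairing_smul (b : O) (c : O ⊗[Fq] V) (y : Y) :
    quotientPairing l V (b • c) y = quotientPairing l V c (b • y) := by
  induction c using TensorProduct.induction_on with
  | zero => simp
  | add c d hc hd => simp only [smul_add, map_add, LinearMap.add_apply, hc, hd]
  | tmul a v =>
    rw [TensorProduct.smul_tmul', quotientPairing_tmul, quotientPairing_tmul, smul_eq_mul,
      mul_comm, mul_smul]

end QuotientPairing

/-! ## Duality between `O ⊗̂ K` and `L / O` -/

section LocalDuality

/-- The quotient `L / O` of the fraction field `L` of `O`. -/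
abbrev FractionQuotient (O L : Type*) [CommRing O] [CommRing L] [Algebra O L] : Type _ :=
  L ⧸ LinearMap.range (Algebra.linearMap O L)

lemma FractionQuotient.mk_eq_zero_iff {O L : Type*} [CommRing O] [CommRing L] [Algebra O L]
    {x : L} :
    (Submodule.Quotient.mk x : FractionQuotient O L) = 0 ↔ ∃ b : O, algebraMap O L b = x :=
  Submodule.Quotient.mk_eq_zero _

variable {Fq O L : Type*} [Field Fq] [CommRing O] [IsDomain O] [IsDiscreteValuationRing O]
variable [Algebra Fq O] [Field L] [Algebra O L] [IsFractionRing O L] [Algebra Fq L]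
variable [IsScalarTower Fq O L]

variable {ϖ : O} (hϖ : Irreducible ϖ)

include hϖ in
lemma FractionQuotient.exists_pow_smul_eq_zero (y : FractionQuotient O L) :
    ∃ n, ϖ ^ n • y = 0 := by
  obtain ⟨x, rfl⟩ := Submodule.Quotient.mk_surjective _ y
  obtain ⟨a, s, hs, rfl⟩ := IsFractionRing.div_surjective (A := O) x
  obtain ⟨n, u, hu⟩ := IsDiscreteValuationRing.associated_pow_irreducible
    (nonZeroDivisors.ne_zero hs) hϖ
  refine ⟨n, ?_⟩
  rw [← Submodule.Quotient.mk_smul, FractionQuotient.mk_eq_zero_iff]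
  refine ⟨u * a, ?_⟩
  have hs0 : algebraMap O L s ≠ 0 :=
    (map_ne_zero_iff _ (IsFractionRing.injective O L)).mpr (nonZeroDivisors.ne_zero hs)
  rw [Algebra.smul_def, ← hu, map_mul, map_mul]
  field_simp

include hϖ in
lemma FractionQuotient.exists_eq_smul {n : ℕ} {y : FractionQuotient O L} (hy : ϖ ^ n • y = 0) :
    ∃ b : O, y = b • Submodule.Quotient.mk (algebraMap O L (ϖ ^ n))⁻¹ := by
  obtain ⟨x, rfl⟩ := Submodule.Quotient.mk_surjective _ y
  rw [← Submodule.Quotient.mk_smul, FractionQuotient.mk_eq_zero_iff] at hy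
  obtain ⟨b, hb⟩ := hy
  have h0 : algebraMap O L (ϖ ^ n) ≠ 0 :=
    (map_ne_zero_iff _ (IsFractionRing.injective O L)).mpr (pow_ne_zero n hϖ.ne_zero)
  refine ⟨b, ?_⟩
  rw [← Submodule.Quotient.mk_smul, Algebra.smul_def, hb, Algebra.smul_def,
    mul_right_comm, mul_inv_cancel₀ h0, one_mul]

include hϖ in
lemma FractionQuotient.pow_dvd_of_smul_eq_zero {n : ℕ} {b : O}
    (h : b • (Submodule.Quotient.mk (algebraMap O L (ϖ ^ n))⁻¹ : FractionQuotient O L) = 0) :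
    ∃ c, ϖ ^ n * c = b := by
  rw [← Submodule.Quotient.mk_smul, FractionQuotient.mk_eq_zero_iff] at h
  obtain ⟨c, hc⟩ := h
  have h0 : algebraMap O L (ϖ ^ n) ≠ 0 :=
    (map_ne_zero_iff _ (IsFractionRing.injective O L)).mpr (pow_ne_zero n hϖ.ne_zero)
  refine ⟨c, IsFractionRing.injective O L ?_⟩
  rw [map_mul, hc, Algebra.smul_def]
  field_simp

/-- An `Fq`-linear functional on `L / O` is nondegenerate if its kernel does not contain a nonzero
`O`-submodule. -/
def IsNondegenerateFunctional (l : FractionQuotient O L →ₗ[Fq] Fq) : Prop :=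
  ∀ y, (∀ b : O, l (b • y) = 0) → y = 0

variable (Fq O L) in
-- It suffices that `l` is nonzero on the class of `ϖ⁻¹`, because every nonzero submodule of `L / O`
-- contains this class: if `x` is not in `O`, then `x⁻¹ = ϖ c` with `c ∈ O`, so `c x = ϖ⁻¹`.
lemma exists_isNondegenerateFunctional :
    ∃ l : FractionQuotient O L →ₗ[Fq] Fq, IsNondegenerateFunctional l := by
  obtain ⟨ϖ, hϖ⟩ := IsDiscreteValuationRing.exists_irreducible O
  have h0 : algebraMap O L ϖ ≠ 0 :=
    (map_ne_zero_iff _ (IsFractionRing.injective O L)).mpr hϖ.ne_zero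
  have hy : (Submodule.Quotient.mk (algebraMap O L ϖ)⁻¹ : FractionQuotient O L) ≠ 0 := by
    rw [Ne, FractionQuotient.mk_eq_zero_iff]
    rintro ⟨b, hb⟩
    refine hϖ.not_isUnit (IsUnit.of_mul_eq_one b (IsFractionRing.injective O L ?_))
    rw [map_mul, hb, mul_inv_cancel₀ h0, map_one]
  obtain ⟨l, hl⟩ := Module.Projective.exists_dual_ne_zero Fq hy
  refine ⟨l, fun y hy => ?_⟩
  by_contra hne
  obtain ⟨x, rfl⟩ := Submodule.Quotient.mk_surjective _ y
  rw [FractionQuotient.mk_eq_zero_iff] at hne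
  obtain ⟨b, hb⟩ | ⟨b, hb⟩ := ValuationRing.isInteger_or_isInteger O x
  · exact hne ⟨b, hb⟩
  · have hb' : b ∈ IsLocalRing.maximalIdeal O := by
      rw [IsLocalRing.mem_maximalIdeal, mem_nonunits_iff]
      rintro ⟨u, rfl⟩
      refine hne ⟨(u⁻¹ : Oˣ), ?_⟩
      rw [← inv_inj, ← hb]
      refine inv_eq_of_mul_eq_one_left ?_
      rw [← map_mul, Units.mul_inv, map_one]
    rw [hϖ.maximalIdeal_eq, Ideal.mem_span_singleton] at hb'
    obtain ⟨c, rfl⟩ := hb'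
    refine hl ?_
    rw [← hy c, ← Submodule.Quotient.mk_smul]
    congr 2
    have hx : x ≠ 0 := by
      rintro rfl
      exact hne ⟨0, map_zero _⟩
    rw [Algebra.smul_def]
    rw [map_mul] at hb
    field_simp
    rw [hb, inv_mul_cancel₀ hx]

section Pairing

variable {l : FractionQuotient O L →ₗ[Fq] Fq} {V : Type*} [AddCommGroup V] [Module Fq V]
variable (hl : IsNondegenerateFunctional l)

include hϖ hl in
-- The class of `b ϖ ^ (-n)` and all its multiples are killed by `l`, so nondegeneracy puts `b ϖ ^
-- (-n)` in `O`.
lemma exists_pow_mul_eq_of_pairing_eq_zero {n : ℕ} {b : O}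
    (h : ∀ y : FractionQuotient O L, ϖ ^ n • y = 0 → l (b • y) = 0) : ∃ c, ϖ ^ n * c = b := by
  refine FractionQuotient.pow_dvd_of_smul_eq_zero hϖ (L := L) (hl _ fun c => ?_)
  rw [smul_comm]
  refine h _ ?_
  rw [smul_comm, ← Submodule.Quotient.mk_smul, FractionQuotient.mk_eq_zero_iff.mpr, smul_zero]
  refine ⟨1, ?_⟩
  rw [Algebra.smul_def, map_one, mul_inv_cancel₀]
  exact (map_ne_zero_iff _ (IsFractionRing.injective O L)).mpr (pow_ne_zero n hϖ.ne_zero)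

include hϖ hl in
-- Coordinates with respect to a basis of `V` reduce this to the case of scalars.
lemma exists_pow_smul_eq_of_quotientPairing_eq_zero {n : ℕ} {c : O ⊗[Fq] V}
    (h : ∀ y : FractionQuotient O L, ϖ ^ n • y = 0 → quotientPairing l V c y = 0) :
    ∃ c', ϖ ^ n • c' = c := by
  let v := Module.Free.chooseBasis Fq V
  obtain ⟨b, rfl⟩ := (TensorProduct.equivFinsuppOfBasisRight v).symm.surjective c
  rw [TensorProduct.equivFinsuppOfBasisRight_symm_apply] at h ⊢
  have h1 : ∀ i, ∃ c, ϖ ^ n * c = b i := by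
    refine fun i => exists_pow_mul_eq_of_pairing_eq_zero hϖ hl fun y hy => ?_
    by_cases hbi : b i = 0
    · rw [hbi, zero_smul, map_zero]
    have h2 := congrArg (fun w => v.repr w i) (h y hy)
    simpa [hbi, Finsupp.sum, quotientPairing_tmul, Finsupp.single_apply] using h2
  choose c hc using h1
  refine ⟨b.sum fun i _ => c i ⊗ₜ v i, ?_⟩
  rw [Finsupp.sum, Finset.smul_sum]
  exact Finset.sum_congr rfl fun i _ => by
    rw [TensorProduct.smul_tmul', smul_eq_mul, hc]

include hϖ hl in
-- The `ϖ ^ n`-torsion `G` of `L / O` is finite, being a cyclic `O`-module killed by `ϖ ^ n`.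
-- Nondegeneracy says that no nonzero element of `G` is annihilated by the functionals `y ↦ l (b •
-- y)`, so these exhaust the dual of `G`, and a functional with values in `V` is assembled from a
-- dual basis.
lemma exists_pairing_eq (hfin : ∀ n : ℕ, Finite (O ⧸ Ideal.span {ϖ ^ n})) (n : ℕ)
    (μ : FractionQuotient O L →ₗ[Fq] V) :
    ∃ c : O ⊗[Fq] V, ∀ y : FractionQuotient O L, ϖ ^ n • y = 0 → quotientPairing l V c y = μ y := by
  let G : Submodule Fq (FractionQuotient O L) :=
    LinearMap.ker (Algebra.lsmul Fq Fq (FractionQuotient O L) (ϖ ^ n))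
  have hG : Finite G := by
    have := hfin n
    have hy0 : ϖ ^ n • (Submodule.Quotient.mk (algebraMap O L (ϖ ^ n))⁻¹ :
        FractionQuotient O L) = 0 := by
      rw [← Submodule.Quotient.mk_smul, FractionQuotient.mk_eq_zero_iff]
      refine ⟨1, ?_⟩
      rw [Algebra.smul_def, map_one, mul_inv_cancel₀]
      exact (map_ne_zero_iff _ (IsFractionRing.injective O L)).mpr (pow_ne_zero n hϖ.ne_zero)
    let g : O ⧸ Ideal.span {ϖ ^ n} →ₗ[O] FractionQuotient O L :=
      Submodule.liftQ _ (LinearMap.toSpanSingleton O _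
        (Submodule.Quotient.mk (algebraMap O L (ϖ ^ n))⁻¹)) (by
          rw [Ideal.span_le, Set.singleton_subset_iff]
          exact hy0)
    have hfr : (Set.range g).Finite := Set.finite_range g
    refine (hfr.subset ?_).to_subtype (s := (G : Set (FractionQuotient O L)))
    intro y hy
    obtain ⟨b, rfl⟩ := FractionQuotient.exists_eq_smul hϖ (n := n) (y := y) hy
    exact ⟨Submodule.Quotient.mk b, rfl⟩
  have : Module.Finite Fq G := Module.Finite.of_finite
  let f : O →ₗ[Fq] Module.Dual Fq G :=
    { toFun := fun b => (l.comp (Algebra.lsmul Fq Fq (FractionQuotient O L) b)).comp G.subtype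
      map_add' := fun b c => by ext y; simp
      map_smul' := fun a b => by ext y; simp }
  have hf : LinearMap.range f = ⊤ := by
    have h1 : (LinearMap.range f).dualCoannihilator = ⊥ := by
      rw [eq_bot_iff]
      intro y hy
      rw [Submodule.mem_dualCoannihilator] at hy
      exact Subtype.ext (hl y.1 fun b => hy (f b) ⟨b, rfl⟩)
    rw [← Subspace.dualCoannihilator_dualAnnihilator_eq (W := LinearMap.range f), h1,
      Submodule.dualAnnihilator_bot]
  let e := Module.finBasis Fq G
  have h2 : ∀ i, ∃ b, f b = e.coord i := fun i => by
    have : e.coord i ∈ LinearMap.range f := by rw [hf]; trivial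
    exact this
  choose b hb using h2
  refine ⟨∑ i, b i ⊗ₜ μ (e i), fun y hy => ?_⟩
  have h3 := e.sum_repr ⟨y, hy⟩
  have h4 := congrArg (fun z => μ (G.subtype z)) h3
  rw [map_sum, LinearMap.sum_apply]
  refine Eq.trans ?_ h4
  simp only [map_sum, map_smul]
  refine Finset.sum_congr rfl fun i _ => ?_
  rw [quotientPairing_tmul]
  congr 1
  exact LinearMap.congr_fun (hb i) ⟨y, hy⟩

end Pairing

section Completion

variable {K : Type*} [Field K] [Algebra Fq K]

include hϖ in
lemma mem_tensorIdeal_pow_iff (n : ℕ) (c : O ⊗[Fq] K) :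
    c ∈ tensorIdeal Fq O K ^ n ↔ ∃ c', ϖ ^ n • c' = c := by
  rw [tensorIdeal, hϖ.maximalIdeal_eq, Ideal.map_span, Set.image_singleton,
    Ideal.span_singleton_pow, Ideal.mem_span_singleton, ← map_pow]
  constructor
  · rintro ⟨c', rfl⟩
    exact ⟨c', Algebra.smul_def _ _⟩
  · rintro ⟨c', rfl⟩
    exact ⟨c', Algebra.smul_def _ _⟩

variable (l : FractionQuotient O L →ₗ[Fq] Fq)

open scoped Classical in
/-- The extension to `O ⊗̂ K` of the pairing of `O ⊗ K` with `L / O`. -/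
def completedPairing (l : FractionQuotient O L →ₗ[Fq] Fq) (e : CompletedTensorInt Fq O K)
    (y : FractionQuotient O L) : K :=
  -- The exponent is measured by powers of the maximal ideal, so that no uniformizer enters. The
  -- default value `0` is never taken, since every element of `L / O` is torsion.
  if h : ∃ n, ∀ b ∈ IsLocalRing.maximalIdeal O ^ n, b • y = 0 then
    quotientPairing l K (Quotient.out (AdicCompletion.evalₐ (tensorIdeal Fq O K) (Nat.find h) e)) y
  else 0

include hϖ in
lemma pow_smul_eq_zero_iff (n : ℕ) (y : FractionQuotient O L) :
    (∀ b ∈ IsLocalRing.maximalIdeal O ^ n, b • y = 0) ↔ ϖ ^ n • y = 0 := by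
  rw [hϖ.maximalIdeal_eq, Ideal.span_singleton_pow]
  constructor
  · exact fun h => h _ (Ideal.mem_span_singleton_self _)
  · rintro h b hb
    obtain ⟨c, rfl⟩ := Ideal.mem_span_singleton'.mp hb
    rw [mul_smul, h, smul_zero]

include hϖ in
-- Two representatives of `e` modulo `ϖ ^ m` differ by a multiple of `ϖ ^ m`, which pairs to zero
-- with `y` as soon as `ϖ ^ m` kills `y`. So neither the representative nor the exponent matters.
lemma completedPairing_eq {n : ℕ} {y : FractionQuotient O L} (hy : ϖ ^ n • y = 0)
    {e : CompletedTensorInt Fq O K} {c : O ⊗[Fq] K}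
    (hc : AdicCompletion.evalₐ (tensorIdeal Fq O K) n e = Ideal.Quotient.mk _ c) :
    completedPairing l e y = quotientPairing l K c y := by
  classical
  have hex : ∃ n, ∀ b ∈ IsLocalRing.maximalIdeal O ^ n, b • y = 0 :=
    ⟨n, (pow_smul_eq_zero_iff hϖ n y).mpr hy⟩
  rw [completedPairing, dif_pos hex]
  have hspec := (pow_smul_eq_zero_iff hϖ _ y).mp (Nat.find_spec hex)
  have hle : Nat.find hex ≤ n := Nat.find_le ((pow_smul_eq_zero_iff hϖ n y).mpr hy)
  generalize Nat.find hex = m at hspec hle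
  obtain ⟨s, rfl⟩ := AdicCompletion.mk_surjective _ _ e
  rw [AdicCompletion.evalₐ_mk] at hc ⊢
  set d := Quotient.out (Ideal.Quotient.mk (tensorIdeal Fq O K ^ m) (s.val m))
  have hd : Ideal.Quotient.mk (tensorIdeal Fq O K ^ m) d =
      Ideal.Quotient.mk (tensorIdeal Fq O K ^ m) (s.val m) := Quotient.out_eq _
  have h1 : d - c ∈ tensorIdeal Fq O K ^ m := by
    rw [← Ideal.Quotient.eq, hd, AdicCompletion.Ideal.mk_eq_mk _ hle s |>.symm]
    rw [Ideal.Quotient.eq] at hc ⊢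
    exact Ideal.pow_le_pow_right hle hc
  obtain ⟨c', hc'⟩ := (mem_tensorIdeal_pow_iff hϖ m _).mp h1
  rw [← sub_eq_zero, ← LinearMap.sub_apply, ← map_sub, ← hc', quotientPairing_smul, hspec, map_zero]

/-- Every element of `O ⊗̂ K` is represented modulo `m ^ n` by an element of `O ⊗ K`. -/
lemma exists_evalₐ_eq_mk (n : ℕ) (e : CompletedTensorInt Fq O K) :
    ∃ c, AdicCompletion.evalₐ (tensorIdeal Fq O K) n e = Ideal.Quotient.mk _ c :=
  ⟨_, (Ideal.Quotient.mk_surjective _).choose_spec.symm⟩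

lemma completedPairing_add_left (e e' : CompletedTensorInt Fq O K) (y : FractionQuotient O L) :
    completedPairing l (e + e') y = completedPairing l e y + completedPairing l e' y := by
  obtain ⟨ϖ, hϖ⟩ := IsDiscreteValuationRing.exists_irreducible O
  obtain ⟨n, hn⟩ := FractionQuotient.exists_pow_smul_eq_zero hϖ y
  obtain ⟨c, hc⟩ := exists_evalₐ_eq_mk n e
  obtain ⟨c', hc'⟩ := exists_evalₐ_eq_mk n e'
  rw [completedPairing_eq hϖ l hn hc, completedPairing_eq hϖ l hn hc',
    completedPairing_eq hϖ l hn (c := c + c') (by rw [map_add, hc, hc', map_add]), map_add,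
    LinearMap.add_apply]

/-- The pairing as a linear functional on `L / O`. -/
def completedPairingRight (e : CompletedTensorInt Fq O K) : FractionQuotient O L →ₗ[Fq] K where
  toFun := completedPairing l e
  map_add' y z := by
    obtain ⟨ϖ, hϖ⟩ := IsDiscreteValuationRing.exists_irreducible O
    obtain ⟨m, hm⟩ := FractionQuotient.exists_pow_smul_eq_zero hϖ y
    obtain ⟨n, hn⟩ := FractionQuotient.exists_pow_smul_eq_zero hϖ z
    have hm' : ϖ ^ (m + n) • y = 0 := by rw [pow_add, mul_comm, mul_smul, hm, smul_zero]
    have hn' : ϖ ^ (m + n) • z = 0 := by rw [pow_add, mul_smul, hn, smul_zero]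
    obtain ⟨c, hc⟩ := exists_evalₐ_eq_mk (m + n) e
    rw [completedPairing_eq hϖ l hm' hc, completedPairing_eq hϖ l hn' hc,
      completedPairing_eq hϖ l (by rw [smul_add, hm', hn', add_zero]) hc, map_add]
  map_smul' a y := by
    obtain ⟨ϖ, hϖ⟩ := IsDiscreteValuationRing.exists_irreducible O
    obtain ⟨n, hn⟩ := FractionQuotient.exists_pow_smul_eq_zero hϖ y
    obtain ⟨c, hc⟩ := exists_evalₐ_eq_mk n e
    rw [completedPairing_eq hϖ l hn hc,
      completedPairing_eq hϖ l (by rw [smul_comm, hn, smul_zero]) hc, map_smul, RingHom.id_apply]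

lemma completedPairing_algebraMap_tmul_mul (b : O) (x : K) (e : CompletedTensorInt Fq O K)
    (y : FractionQuotient O L) :
    completedPairing l (algebraMap (O ⊗[Fq] K) _ (b ⊗ₜ x) * e) y =
      x * completedPairing l e (b • y) := by
  obtain ⟨ϖ, hϖ⟩ := IsDiscreteValuationRing.exists_irreducible O
  obtain ⟨n, hn⟩ := FractionQuotient.exists_pow_smul_eq_zero hϖ y
  obtain ⟨c, hc⟩ := exists_evalₐ_eq_mk n e
  rw [completedPairing_eq hϖ l (by rw [smul_comm, hn, smul_zero]) hc,
    completedPairing_eq hϖ l hn (c := (b ⊗ₜ x) * c)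
      (by rw [map_mul, map_mul, hc, AlgHom.commutes]; rfl), ← quotientPairing_smul]
  clear hc
  induction c using TensorProduct.induction_on with
  | zero => simp
  | add c d hc hd => simp only [smul_add, map_add, LinearMap.add_apply, mul_add, hc, hd]
  | tmul a v =>
    rw [Algebra.TensorProduct.tmul_mul_tmul, TensorProduct.smul_tmul', quotientPairing_tmul,
      quotientPairing_tmul, smul_eq_mul, mul_smul_comm]

lemma completedPairing_smul (b : O) (e : CompletedTensorInt Fq O K) (y : FractionQuotient O L) :
    completedPairing l (b • e) y = completedPairing l e (b • y) := by
  have h := completedPairing_algebraMap_tmul_mul l b (1 : K) e y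
  rw [one_mul] at h
  rw [← h, Algebra.smul_def]
  rfl

lemma completedPairing_algebraMap (b : O) (y : FractionQuotient O L) :
    completedPairing l (algebraMap O (CompletedTensorInt Fq O K) b) y =
      algebraMap Fq K (l (b • y)) := by
  obtain ⟨ϖ, hϖ⟩ := IsDiscreteValuationRing.exists_irreducible O
  obtain ⟨n, hn⟩ := FractionQuotient.exists_pow_smul_eq_zero hϖ y
  rw [completedPairing_eq hϖ l hn (c := b ⊗ₜ 1) (by
    rw [IsScalarTower.algebraMap_apply O (O ⊗[Fq] K), AlgHom.commutes]; rfl), quotientPairing_tmul,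
    Algebra.smul_def, mul_one]

/-- For the Frobenius of `K` this translates `σ` on `O ⊗̂ K` into raising values to the `q`-th
power; for general `i` it controls field extensions and Galois actions. -/
lemma completedPairing_mapInt {K' : Type*} [Field K'] [Algebra Fq K'] (i : K →ₐ[Fq] K')
    (e : CompletedTensorInt Fq O K) (y : FractionQuotient O L) :
    completedPairing l (CompletedTensor.mapInt Fq O i e) y = i (completedPairing l e y) := by
  obtain ⟨ϖ, hϖ⟩ := IsDiscreteValuationRing.exists_irreducible O
  obtain ⟨n, hn⟩ := FractionQuotient.exists_pow_smul_eq_zero hϖ y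
  obtain ⟨c, hc⟩ := exists_evalₐ_eq_mk n e
  rw [completedPairing_eq hϖ l hn hc, completedPairing_eq hϖ l hn
    (c := Algebra.TensorProduct.map (AlgHom.id O O) i c)
    (by rw [CompletedTensor.evalₐ_mapInt, hc]; rfl)]
  clear hc
  induction c using TensorProduct.induction_on with
  | zero => simp
  | add c d hc hd => simp only [map_add, LinearMap.add_apply, hc, hd]
  | tmul a v =>
    rw [Algebra.TensorProduct.map_tmul, quotientPairing_tmul, quotientPairing_tmul,
      map_smul i]
    rfl

variable {l} (hl : IsNondegenerateFunctional l)

include hl in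
-- This and `exists_completedPairing_eq` are the two halves of the duality between `O ⊗̂ K` and
-- `Hom(L / O, K)`. Here the pairing with the `ϖ ^ n`-torsion detects the class modulo `ϖ ^ n`.
lemma eq_of_completedPairing_eq {e e' : CompletedTensorInt Fq O K}
    (h : ∀ y, completedPairing l e y = completedPairing l e' y) : e = e' := by
  obtain ⟨ϖ, hϖ⟩ := IsDiscreteValuationRing.exists_irreducible O
  refine AdicCompletion.ext_evalₐ fun n => ?_
  obtain ⟨c, hc⟩ := exists_evalₐ_eq_mk n e
  obtain ⟨c', hc'⟩ := exists_evalₐ_eq_mk n e'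
  rw [hc, hc', Ideal.Quotient.eq, mem_tensorIdeal_pow_iff hϖ]
  refine exists_pow_smul_eq_of_quotientPairing_eq_zero hϖ hl fun y hy => ?_
  rw [map_sub, LinearMap.sub_apply, ← completedPairing_eq hϖ l hy hc,
    ← completedPairing_eq hϖ l hy hc', h, sub_self]

include hl in
lemma exists_completedPairing_eq (hfin : ∀ (ϖ : O), Irreducible ϖ →
    ∀ n : ℕ, Finite (O ⧸ Ideal.span {ϖ ^ n})) (μ : FractionQuotient O L →ₗ[Fq] K) :
    ∃ e : CompletedTensorInt Fq O K, ∀ y, completedPairing l e y = μ y := by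
  obtain ⟨ϖ, hϖ⟩ := IsDiscreteValuationRing.exists_irreducible O
  choose c hc using fun n => exists_pairing_eq hϖ hl (hfin ϖ hϖ) n μ
  -- The restriction of `μ` to the `ϖ ^ n`-torsion determines `c n` modulo `ϖ ^ n`, so the
  -- approximations form a Cauchy sequence.
  have hcauchy : ∀ n, c n ≡ c (n + 1)
      [SMOD (tensorIdeal Fq O K ^ n • ⊤ : Submodule (O ⊗[Fq] K) (O ⊗[Fq] K))] := by
    intro n
    rw [SModEq.sub_mem, smul_eq_mul, Ideal.mul_top, mem_tensorIdeal_pow_iff hϖ]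
    refine exists_pow_smul_eq_of_quotientPairing_eq_zero hϖ hl fun y hy => ?_
    rw [map_sub, LinearMap.sub_apply, hc n y hy, hc (n + 1) y
      (by rw [pow_succ', mul_smul, hy, smul_zero]), sub_self]
  refine ⟨AdicCompletion.mk _ _ (AdicCompletion.AdicCauchySequence.mk _ _ c hcauchy), fun y => ?_⟩
  obtain ⟨n, hn⟩ := FractionQuotient.exists_pow_smul_eq_zero hϖ y
  rw [completedPairing_eq hϖ l hn (AdicCompletion.evalₐ_mk _ _ _)]
  exact hc n y hn

include hl in
/-- Every functional on `L / O` is induced by an element of `O`, if `O` is complete with finite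
residue field. -/
lemma exists_pairing_eq_of_isPrecomplete (hfin : ∀ (ϖ : O), Irreducible ϖ →
    ∀ n : ℕ, Finite (O ⧸ Ideal.span {ϖ ^ n}))
    [hO : IsPrecomplete (IsLocalRing.maximalIdeal O) O] (μ : FractionQuotient O L →ₗ[Fq] Fq) :
    ∃ b : O, ∀ y, l (b • y) = μ y := by
  obtain ⟨ϖ, hϖ⟩ := IsDiscreteValuationRing.exists_irreducible O
  choose c hc using fun n => exists_pairing_eq hϖ hl (hfin ϖ hϖ) n μ
  -- With values in `Fq` the coefficients lie in `O ⊗ Fq = O`, and completeness of `O` supplies the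
  -- limit.
  let d : ℕ → O := fun n => TensorProduct.rid Fq O (c n)
  have hd : ∀ n (y : FractionQuotient O L), ϖ ^ n • y = 0 → l (d n • y) = μ y := by
    intro n y hy
    rw [← hc n y hy]
    simp only [d]
    generalize c n = z
    induction z using TensorProduct.induction_on with
    | zero => simp
    | add z w hz hw => simp only [map_add, add_smul, LinearMap.add_apply, hz, hw]
    | tmul a v =>
      rw [TensorProduct.rid_tmul, quotientPairing_tmul, smul_assoc, map_smul, smul_eq_mul,
        smul_eq_mul, mul_comm]
  rw [hϖ.maximalIdeal_eq] at hO
  have hdiv : ∀ {m n}, m ≤ n → ∃ z, ϖ ^ m * z = d m - d n := by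
    intro m n hmn
    refine exists_pow_mul_eq_of_pairing_eq_zero hϖ hl fun y hy => ?_
    rw [sub_smul, map_sub, hd m y hy, hd n y, sub_self]
    obtain ⟨j, rfl⟩ := Nat.exists_eq_add_of_le' hmn
    rw [pow_add, mul_smul, hy, smul_zero]
  obtain ⟨b, hb⟩ := hO.prec' d fun hmn => by
    rw [SModEq.sub_mem, mem_span_pow_smul_top]
    exact hdiv hmn
  refine ⟨b, fun y => ?_⟩
  obtain ⟨n, hn⟩ := FractionQuotient.exists_pow_smul_eq_zero hϖ y
  obtain ⟨z, hz⟩ := (mem_span_pow_smul_top _ _ _).mp (SModEq.sub_mem.mp (hb n))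
  rw [← hd n y hn, ← sub_eq_zero, ← map_sub, ← sub_smul, ← neg_sub, ← hz, neg_smul, smul_eq_mul,
    mul_comm, mul_smul, hn, smul_zero, neg_zero, map_zero]

end Completion

end LocalDuality

end

noncomputable section

/-! ## Degrees of twisted polynomials -/

namespace TwistedPoly

variable {Fq : Type*} [Field Fq] [Fintype Fq] {K : Type*} [CommRing K] [Algebra Fq K]

lemma coeff_zero (n : ℕ) : (0 : TwistedPoly Fq K).coeff n = 0 := rfl

lemma coeff_add (f g : TwistedPoly Fq K) (n : ℕ) : (f + g).coeff n = f.coeff n + g.coeff n :=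
  SkewPolynomial.coeff_add f g n

lemma coeff_sub (f g : TwistedPoly Fq K) (n : ℕ) : (f - g).coeff n = f.coeff n - g.coeff n := by
  rw [eq_sub_iff_add_eq, ← coeff_add, sub_add_cancel]

lemma coeff_monomial (n m : ℕ) (x : K) :
    (monomial n x : TwistedPoly Fq K).coeff m = if n = m then x else 0 :=
  SkewPolynomial.coeff_monomial

lemma ext {f g : TwistedPoly Fq K} (h : ∀ n, f.coeff n = g.coeff n) : f = g :=
  SkewPolynomial.ext h

lemma coeff_monomial_mul (n k : ℕ) (x : K) (g : TwistedPoly Fq K) :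
    (monomial n x * g).coeff (n + k) = x * g.coeff k ^ Fintype.card Fq ^ n := by
  induction g using induction_on with
  | add f g hf hg =>
    have h : ∀ a b : K, (a + b) ^ Fintype.card Fq ^ n =
        a ^ Fintype.card Fq ^ n + b ^ Fintype.card Fq ^ n := by
      intro a b
      have h := map_add (((FiniteField.frobeniusAlgHom Fq K).toRingHom) ^ n) a b
      have h' : ∀ y : K, (((FiniteField.frobeniusAlgHom Fq K).toRingHom) ^ n) y =
        y ^ Fintype.card Fq ^ n := frobeniusAction_smul (Fq := Fq) n
      rwa [h', h', h'] at h
    rw [mul_add, coeff_add, coeff_add, hf, hg, h, mul_add]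
  | mon m y =>
    rw [monomial_mul_monomial, coeff_monomial, coeff_monomial]
    by_cases h : m = k
    · rw [if_pos h, if_pos (by rw [h])]
    · rw [if_neg h, if_neg (by omega), zero_pow (pow_ne_zero _ Fintype.card_ne_zero), mul_zero]

lemma exists_coeff_eq_zero (f : TwistedPoly Fq K) : ∃ n, ∀ k, n ≤ k → f.coeff k = 0 := by
  induction f using induction_on with
  | add f g hf hg =>
    obtain ⟨m, hm⟩ := hf
    obtain ⟨n, hn⟩ := hg
    exact ⟨max m n, fun k hk => by
      rw [coeff_add, hm k (le_trans (le_max_left _ _) hk), hn k (le_trans (le_max_right _ _) hk),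
        add_zero]⟩
  | mon m x => exact ⟨m + 1, fun k hk => by rw [coeff_monomial, if_neg (by omega)]⟩

/-- A polynomial of degree at most `n` is the sum of its top term and a polynomial of degree less
than `n`. -/
lemma coeff_sub_monomial_eq_zero {f : TwistedPoly Fq K} {n : ℕ}
    (hf : ∀ k, n + 1 ≤ k → f.coeff k = 0) (k : ℕ) (hk : n ≤ k) :
    (f - monomial n (f.coeff n)).coeff k = 0 := by
  rw [coeff_sub, coeff_monomial]
  by_cases h : n = k
  · rw [if_pos h, h, sub_self]
  · rw [if_neg h, hf k (by omega), sub_zero]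

lemma coeff_mul_eq_zero {g : TwistedPoly Fq K} {d : ℕ} (hg : ∀ k, d < k → g.coeff k = 0) (n : ℕ)
    {f : TwistedPoly Fq K} (hf : ∀ k, n ≤ k → f.coeff k = 0) (k : ℕ) (hk : n + d ≤ k) :
    (f * g).coeff k = 0 := by
  induction n generalizing f k with
  | zero =>
    rw [show f = 0 from ext fun k => hf k (Nat.zero_le k), zero_mul, coeff_zero]
  | succ n ih =>
    have h := ih (coeff_sub_monomial_eq_zero hf) k (by omega)
    obtain ⟨j, rfl⟩ : ∃ j, k = n + j := ⟨k - n, by omega⟩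
    rwa [sub_mul, coeff_sub, coeff_monomial_mul, hg j (by omega),
      zero_pow (pow_ne_zero _ Fintype.card_ne_zero), mul_zero, sub_zero] at h

/-- The top coefficient of a product. -/
lemma coeff_mul_add {f g : TwistedPoly Fq K} {n d : ℕ} (hf : ∀ k, n + 1 ≤ k → f.coeff k = 0)
    (hg : ∀ k, d < k → g.coeff k = 0) :
    (f * g).coeff (n + d) = f.coeff n * g.coeff d ^ Fintype.card Fq ^ n := by
  have h := coeff_mul_eq_zero hg n (coeff_sub_monomial_eq_zero hf) (n + d) le_rfl
  rwa [sub_mul, coeff_sub, coeff_monomial_mul, sub_eq_zero] at h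

/-- The top coefficient of the product is that of `f` times a power of the unit leading `g`, so it
would be nonzero. -/
lemma IsElliptic.eq_zero_of_mul_eq_zero {f g : TwistedPoly Fq K} {d : ℕ} (hg : g.IsElliptic d)
    (h : f * g = 0) : f = 0 := by
  classical
  by_contra hf
  have hex := exists_coeff_eq_zero f
  have hspec := Nat.find_spec hex
  cases hn : Nat.find hex with
  | zero => exact hf (ext fun k => hspec k (by omega))
  | succ n =>
    rw [hn] at hspec
    have h1 := coeff_mul_add hspec hg.2
    rw [h, coeff_zero, eq_comm, (hg.1.pow _).mul_left_eq_zero] at h1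
    refine Nat.find_min hex (m := n) (by omega) fun k hk => ?_
    rcases hk.eq_or_lt with rfl | hk
    · exact h1
    · exact hspec k hk

end TwistedPoly

/-! ## The motive of a Drinfeld module is finitely generated and torsion free -/

/-- The quotient of a one-dimensional noetherian algebra of finite type over a field by a nonzero
principal ideal is finite-dimensional. -/
lemma finite_quotient_span_singleton (k : Type*) [Field k] {A : Type*} [CommRing A] [IsDedekindDomain A]
    [Algebra k A] [Algebra.FiniteType k A] {t : A} (ht : t ≠ 0) :
    Module.Finite k (A ⧸ Ideal.span {t}) := by
  -- A prime of the quotient pulls back to a prime containing `t ≠ 0`, which is maximal in a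
  -- Dedekind domain.
  have : Ring.KrullDimLE 0 (A ⧸ Ideal.span {t}) := by
    refine Ring.KrullDimLE.mk₀ fun I hI => ?_
    have h := Ideal.comap_isPrime (Ideal.Quotient.mk (Ideal.span {t})) I
    have h0 : I.comap (Ideal.Quotient.mk (Ideal.span {t})) ≠ ⊥ := by
      intro h0
      have : t ∈ I.comap (Ideal.Quotient.mk (Ideal.span {t})) := by
        rw [Ideal.mem_comap, Ideal.Quotient.eq_zero_iff_mem.mpr (Ideal.mem_span_singleton_self t)]
        exact I.zero_mem
      rw [h0] at this
      exact ht this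
    have hm := h.isMaximal h0
    have hs := Ideal.Quotient.mk_surjective (I := Ideal.span {t})
    have h2 := Ideal.map_eq_top_or_isMaximal_of_surjective _ hs hm
    rw [Ideal.map_comap_of_surjective _ hs] at h2
    exact h2.resolve_left hI.ne_top
  exact (Module.finite_iff_krullDimLE_zero k _).mpr this

namespace DrinfeldModule

variable {Fq : Type*} [Field Fq] [Fintype Fq] {A : Type*} [CommRing A] [Algebra Fq A]
variable {K : Type*} [Field K] [Algebra Fq K] {r : ℕ} (φ : DrinfeldModule Fq A K r)

lemma Motive.eq_zero_of_smul {a : A} (ha : a ≠ 0) {m : φ.Motive}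
    (h : (a ⊗ₜ[Fq] (1 : K)) • m = 0) : m = 0 := by
  have h1 := Motive.toPoly_smul φ a 1 m
  rw [h, map_zero, map_one, one_mul] at h1
  exact (toPoly φ).map_eq_zero_iff.mp ((φ.elliptic a ha).eq_zero_of_mul_eq_zero h1.symm)

open TwistedPoly in
/-- The motive is finitely generated over `A ⊗ K`. -/
theorem Motive.finite [IsDedekindDomain A] [Algebra.FiniteType Fq A] (hr : 1 ≤ r) {t : A}
    (ht : t ≠ 0) (ht' : ¬ IsUnit t) : Module.Finite (A ⊗[Fq] K) φ.Motive := by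
  have hfin := finite_quotient_span_singleton Fq ht
  have : Nontrivial (A ⧸ Ideal.span {t}) :=
    Ideal.Quotient.nontrivial_iff.mpr (by rwa [Ne, Ideal.span_singleton_eq_top])
  have hd : 0 < r * Module.finrank Fq (A ⧸ Ideal.span {t}) :=
    Nat.mul_pos hr Module.finrank_pos
  set d := r * Module.finrank Fq (A ⧸ Ideal.span {t})
  have hell := φ.elliptic t ht
  -- The powers `τ ^ j` with `j < d` generate, by right division by `φ_t`: its leading coefficient
  -- is invertible, and its degree `d` is positive as `t` is not a unit and `r ≥ 1`.
  let v : ℕ → φ.Motive := fun j => (toPoly φ).symm (monomial j 1)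
  let N : Submodule (A ⊗[Fq] K) φ.Motive := Submodule.span _ (v '' Set.Iio d)
  have key : ∀ (n : ℕ) (f : TwistedPoly Fq K), (∀ k, n ≤ k → f.coeff k = 0) →
      (toPoly φ).symm f ∈ N := by
    intro n
    induction n with
    | zero =>
      intro f hf
      rw [show f = 0 from TwistedPoly.ext fun k => hf k (Nat.zero_le k), map_zero]
      exact N.zero_mem
    | succ n ih =>
      intro f hf
      suffices h : ∃ g, (toPoly φ).symm g ∈ N ∧ (∀ k, n + 1 ≤ k → g.coeff k = 0) ∧
          g.coeff n = f.coeff n by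
        obtain ⟨g, hgN, hg, hgn⟩ := h
        rw [← sub_add_cancel f g, map_add]
        refine N.add_mem (ih _ fun k hk => ?_) hgN
        rw [TwistedPoly.coeff_sub]
        rcases hk.eq_or_lt with rfl | hk
        · rw [hgn, sub_self]
        · rw [hf k hk, hg k hk, sub_self]
      by_cases hn : n < d
      · refine ⟨monomial n (f.coeff n), ?_, fun k hk => ?_, ?_⟩
        · have h : (toPoly φ).symm (monomial n (f.coeff n)) =
              ((1 : A) ⊗ₜ[Fq] f.coeff n) • v n := by
            apply (toPoly φ).injective
            rw [Motive.toPoly_smul, AddEquiv.apply_symm_apply, AddEquiv.apply_symm_apply, map_one,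
              mul_one, C_eq_monomial, monomial_mul_monomial, zero_add, one_pow, mul_one]
          rw [h]
          exact N.smul_mem _ (Submodule.subset_span ⟨n, hn, rfl⟩)
        · rw [TwistedPoly.coeff_monomial, if_neg (by omega)]
        · rw [TwistedPoly.coeff_monomial, if_pos rfl]
      -- The term of degree `m + d` is matched by `c τ ^ m φ_t`, which is `t` acting on `c τ ^ m`.
      -- The latter has smaller degree because `d > 0`, so the induction hypothesis covers it.
      · obtain ⟨m, rfl⟩ : ∃ m, n = m + d := ⟨n - d, by omega⟩
        obtain ⟨c, hc⟩ : ∃ c, c * (φ.toAlgHom t).coeff d ^ Fintype.card Fq ^ m =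
            f.coeff (m + d) :=
          ⟨f.coeff (m + d) / (φ.toAlgHom t).coeff d ^ Fintype.card Fq ^ m,
            div_mul_cancel₀ _ (hell.1.pow _).ne_zero⟩
        refine ⟨monomial m c * φ.toAlgHom t, ?_, fun k hk => ?_, ?_⟩
        · have h : (toPoly φ).symm (monomial m c * φ.toAlgHom t) =
              (t ⊗ₜ[Fq] (1 : K)) • (toPoly φ).symm (monomial m c) := by
            apply (toPoly φ).injective
            rw [Motive.toPoly_smul, AddEquiv.apply_symm_apply, AddEquiv.apply_symm_apply, map_one,
              one_mul]
          rw [h]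
          refine N.smul_mem _ (ih _ fun k hk => ?_)
          rw [TwistedPoly.coeff_monomial, if_neg (by omega)]
        · obtain ⟨j, rfl⟩ : ∃ j, k = m + j := ⟨k - m, by omega⟩
          rw [coeff_monomial_mul, hell.2 j (by omega),
            zero_pow (pow_ne_zero _ Fintype.card_ne_zero), mul_zero]
        · rw [coeff_monomial_mul, hc]
  refine Module.finite_def.mpr ⟨((Set.finite_Iio d).image v).toFinset, ?_⟩
  rw [Set.Finite.coe_toFinset, eq_top_iff]
  rintro m -
  obtain ⟨n, hn⟩ := exists_coeff_eq_zero (toPoly φ m)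
  have h := key n _ hn
  rwa [AddEquiv.symm_apply_apply] at h

end DrinfeldModule

end

noncomputable section

/-! ## The completion of a Dedekind domain at a prime -/

section AdicIntegers

open IsDedekindDomain WithZero

variable {A : Type*} [CommRing A] [IsDedekindDomain A]
variable (F : Type*) [Field F] [Algebra A F] [IsFractionRing A F] (p : HeightOneSpectrum A)

lemma adicIntegers_valued_algebraMap (a : A) :
    Valued.v ((algebraMap A (p.adicCompletionIntegers F) a : p.adicCompletionIntegers F) :
      p.adicCompletion F) = p.intValuation a :=
  (p.valuedAdicCompletion_eq_valuation (K := F) a).trans (p.valuation_of_algebraMap a)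

variable {F p} {π : A} (hπ : p.intValuation π = exp (-1 : ℤ))

include hπ in
lemma adicIntegers_valued_uniformizer_pow (n : ℕ) :
    Valued.v (((algebraMap A (p.adicCompletionIntegers F) π ^ n :
      p.adicCompletionIntegers F)) : p.adicCompletion F) = exp (-(n : ℤ)) := by
  rw [SubmonoidClass.coe_pow, map_pow, adicIntegers_valued_algebraMap, hπ, ← exp_nsmul]
  simp

include hπ in
-- Division by `π ^ n` in the field converts a bound on the valuation into divisibility. All later
-- passages between the valuation topology and powers of ideals rest on this.
lemma adicIntegers_valued_le_iff (n : ℕ) (x : p.adicCompletionIntegers F) :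
    Valued.v (x : p.adicCompletion F) ≤ exp (-(n : ℤ)) ↔
      ∃ y, algebraMap A (p.adicCompletionIntegers F) π ^ n * y = x := by
  have hv := adicIntegers_valued_uniformizer_pow (F := F) hπ n
  constructor
  · intro h
    have h0 : (((algebraMap A (p.adicCompletionIntegers F) π ^ n :
        p.adicCompletionIntegers F)) : p.adicCompletion F) ≠ 0 := by
      rw [← Valuation.ne_zero_iff Valued.v, hv]
      exact exp_ne_zero
    refine ⟨⟨(x : p.adicCompletion F) / ((algebraMap A (p.adicCompletionIntegers F) π ^ n :
      p.adicCompletionIntegers F)), ?_⟩, Subtype.ext ?_⟩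
    · rw [HeightOneSpectrum.mem_adicCompletionIntegers, map_div₀, hv]
      exact div_le_one_of_le₀ h zero_le
    · exact mul_div_cancel₀ _ h0
  · rintro ⟨y, rfl⟩
    have hy : Valued.v (y : p.adicCompletion F) ≤ 1 := y.2
    calc _ = exp (-(n : ℤ)) * Valued.v (y : p.adicCompletion F) := by
          rw [← hv, ← map_mul]; rfl
      _ ≤ exp (-(n : ℤ)) * 1 := by gcongr
      _ = _ := mul_one _

include hπ in
lemma adicIntegers_maximalIdeal_eq :
    IsLocalRing.maximalIdeal (p.adicCompletionIntegers F) =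
      Ideal.span {algebraMap A (p.adicCompletionIntegers F) π} := by
  ext x
  have h := adicIntegers_valued_le_iff hπ 1 x
  rw [IsLocalRing.mem_maximalIdeal, mem_nonunits_iff,
    HeightOneSpectrum.adicCompletionIntegers.isUnit_iff_valued_eq_one, Ideal.mem_span_singleton']
  have h1 : Valued.v (x : p.adicCompletion F) ≤ 1 := x.2
  -- The value group is discrete: a value below `1` is at most `exp (-1)`.
  have h2 : ¬ Valued.v (x : p.adicCompletion F) = 1 ↔
      Valued.v (x : p.adicCompletion F) ≤ exp (-((1 : ℕ) : ℤ)) := by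
    rw [← Ne, ← h1.lt_iff_ne, ← lt_mul_exp_iff_le exp_ne_zero, ← exp_add]
    simp
  rw [h2, h]
  simp [mul_comm]

include hπ in
lemma adicIntegers_irreducible : Irreducible (algebraMap A (p.adicCompletionIntegers F) π) := by
  rw [IsDiscreteValuationRing.irreducible_iff_uniformizer]
  exact adicIntegers_maximalIdeal_eq hπ

include hπ in
/-- `A` is dense in its completion. -/
lemma adicIntegers_exists_sub_eq (n : ℕ) (x : p.adicCompletionIntegers F) :
    ∃ (a : A) (y : p.adicCompletionIntegers F),
      x - algebraMap A _ a = algebraMap A _ π ^ n * y := by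
  suffices h : ∃ a : A, Valued.v (((x - algebraMap A (p.adicCompletionIntegers F) a :
      p.adicCompletionIntegers F)) : p.adicCompletion F) ≤ exp (-(n : ℤ)) by
    obtain ⟨a, ha⟩ := h
    obtain ⟨y, hy⟩ := (adicIntegers_valued_le_iff hπ n _).mp ha
    exact ⟨a, y, hy.symm⟩
  have hx : Valued.v (x : p.adicCompletion F) ≤ 1 := x.2
  let γ : (ℤᵐ⁰)ˣ := Units.mk0 (exp (-(n : ℤ))) exp_ne_zero
  -- The approximation has two stages: `x` by an element `c` of `F`, which is then `p`-integral, and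
  -- `c` by an element of `A`.
  obtain ⟨c, hc⟩ : ∃ c : F, Valued.v ((x : p.adicCompletion F) - algebraMap F _ c) < γ := by
    have h := (HeightOneSpectrum.denseRange_algebraMap F p)
    have ho : {y : p.adicCompletion F | Valued.v (y - (x : p.adicCompletion F)) < γ} ∈
        nhds (x : p.adicCompletion F) := by
      obtain ⟨π, hπ⟩ := p.intValuation_exists_uniformizer
      have hγ : Valued.v ((algebraMap A (p.adicCompletionIntegers F) π ^ n :
          p.adicCompletionIntegers F) : p.adicCompletion F) = γ :=
        adicIntegers_valued_uniformizer_pow hπ n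
      refine Valued.mem_nhds.mpr ⟨Units.mk0 (Valued.v.restrict
        ((algebraMap A (p.adicCompletionIntegers F) π ^ n :
          p.adicCompletionIntegers F) : p.adicCompletion F)) ?_, fun y hy => ?_⟩
      · rw [Valuation.ne_zero_iff, ← Valuation.ne_zero_iff Valued.v, hγ]
        exact γ.ne_zero
      · rw [Set.mem_ofPred_eq, Units.val_mk0, Valuation.restrict_lt_iff, hγ] at hy
        exact hy
    obtain ⟨c, hc⟩ := h.mem_nhds ho
    exact ⟨c, by rw [Valuation.map_sub_swap]; exact hc⟩
  have hγ : (γ : ℤᵐ⁰) ≤ 1 := by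
    change exp (-(n : ℤ)) ≤ exp 0
    rw [exp_le_exp]
    omega
  have hc1 : p.valuation F c ≤ 1 := by
    rw [← HeightOneSpectrum.valuedAdicCompletion_eq_valuation' p c]
    have := Valuation.map_sub Valued.v (x : p.adicCompletion F) ((x : p.adicCompletion F) - algebraMap F _ c)
    rw [sub_sub_cancel] at this
    exact this.trans (max_le hx (hc.le.trans hγ))
  obtain ⟨a, ha⟩ := p.exists_valuation_sub_lt_of_integer hc1 γ
  refine ⟨a, ?_⟩
  rw [← HeightOneSpectrum.valuedAdicCompletion_eq_valuation'] at ha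
  have := Valuation.map_sub Valued.v ((x : p.adicCompletion F) - algebraMap F _ c)
    (algebraMap F (p.adicCompletion F) (algebraMap A F a - c))
  have h2 : ((x : p.adicCompletion F) - algebraMap F _ c) -
    (algebraMap F (p.adicCompletion F) (algebraMap A F a - c)) =
    (((x - algebraMap A (p.adicCompletionIntegers F) a :
      p.adicCompletionIntegers F)) : p.adicCompletion F) := by
    rw [map_sub, sub_sub_sub_cancel_right, ← IsScalarTower.algebraMap_apply]
    rfl
  rw [h2] at this
  exact this.trans (max_le hc.le ha.le)

include hπ in
lemma adicIntegers_mem_pow_iff (n : ℕ) (a : A) :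
    (∃ y : p.adicCompletionIntegers F, algebraMap A _ π ^ n * y = algebraMap A _ a) ↔
      a ∈ p.asIdeal ^ n := by
  rw [← adicIntegers_valued_le_iff hπ, adicIntegers_valued_algebraMap,
    HeightOneSpectrum.intValuation_le_pow_iff_mem]

variable (F p) in
-- A sequence that is Cauchy for the powers of the maximal ideal is Cauchy for the valuation and
-- converges in `F_p`. The limit satisfies the required congruences because closed balls are closed.
instance adicIntegers_isPrecomplete : IsPrecomplete
    (IsLocalRing.maximalIdeal (p.adicCompletionIntegers F)) (p.adicCompletionIntegers F) where
  prec' f hf := by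
    obtain ⟨π, hπ⟩ := p.intValuation_exists_uniformizer
    have hmem : ∀ (n : ℕ) (x : p.adicCompletionIntegers F),
        x ∈ (IsLocalRing.maximalIdeal (p.adicCompletionIntegers F) ^ n • ⊤ :
          Ideal (p.adicCompletionIntegers F)) ↔
        Valued.v (x : p.adicCompletion F) ≤ exp (-(n : ℤ)) := by
      intro n x
      rw [adicIntegers_maximalIdeal_eq hπ, mem_span_pow_smul_top, adicIntegers_valued_le_iff hπ]
      rfl
    have hf' : ∀ {m n}, m ≤ n → Valued.v ((f m : p.adicCompletion F) - f n) ≤ exp (-(m : ℤ)) :=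
      fun {m n} hmn => by
        have h := hf hmn
        rw [SModEq.sub_mem, hmem] at h
        exact h
    have hcauchy : CauchySeq fun n => (f n : p.adicCompletion F) := by
      rw [(Valued.hasBasis_uniformity (p.adicCompletion F) ℤᵐ⁰).cauchySeq_iff']
      rintro γ -
      obtain ⟨n, hn⟩ := exists_exp_neg_natCast_lt (x := MonoidWithZeroHom.ValueGroup₀.embedding γ.1)
        (by simp)
      refine ⟨n, fun k hk => ?_⟩
      rw [Set.mem_ofPred_eq, Valuation.restrict_lt_iff_lt_embedding]
      exact (hf' hk).trans_lt hn
    obtain ⟨x, hx⟩ := cauchySeq_tendsto_of_complete hcauchy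
    have hlim : ∀ n, Valued.v ((f n : p.adicCompletion F) - x) ≤ exp (-(n : ℤ)) := by
      intro n
      have h := (Valued.isClosed_closedBall (p.adicCompletion F) (Valued.v.restrict
        ((algebraMap A (p.adicCompletionIntegers F) π ^ n :
          p.adicCompletionIntegers F) : p.adicCompletion F))).mem_of_tendsto
        (hx.const_sub (f n : p.adicCompletion F)) (Filter.eventually_atTop.mpr ⟨n, fun k hk => by
          rw [Set.mem_ofPred_eq, Valuation.restrict_le_iff, adicIntegers_valued_uniformizer_pow hπ]
          exact hf' hk⟩)
      rwa [Set.mem_ofPred_eq, Valuation.restrict_le_iff,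
        adicIntegers_valued_uniformizer_pow hπ] at h
    have hx1 : x ∈ p.adicCompletionIntegers F := by
      rw [HeightOneSpectrum.mem_adicCompletionIntegers]
      have := Valuation.map_sub Valued.v (f 0 : p.adicCompletion F) ((f 0 : p.adicCompletion F) - x)
      rw [sub_sub_cancel] at this
      refine this.trans (max_le (f 0).2 ?_)
      simpa using hlim 0
    refine ⟨⟨x, hx1⟩, fun n => ?_⟩
    rw [SModEq.sub_mem, hmem]
    exact hlim n

include hπ in
variable (F) in
-- By density of `A`, this quotient is an image of the finite ring `A / p ^ n`.
lemma adicIntegers_finite_quotient [hfin : Finite (A ⧸ p.asIdeal)] (n : ℕ) :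
    Finite (p.adicCompletionIntegers F ⧸
      Ideal.span {algebraMap A (p.adicCompletionIntegers F) π ^ n}) := by
  have : Finite (A ⧸ p.asIdeal ^ n) := Ideal.finite_quotient_pow (IsNoetherian.noetherian _) n
  let g : A →+* p.adicCompletionIntegers F ⧸
      Ideal.span {algebraMap A (p.adicCompletionIntegers F) π ^ n} :=
    (Ideal.Quotient.mk _).comp (algebraMap A _)
  have hg : ∀ a ∈ p.asIdeal ^ n, g a = 0 := by
    intro a ha
    obtain ⟨y, hy⟩ := (adicIntegers_mem_pow_iff (F := F) hπ n a).mpr ha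
    refine Ideal.Quotient.eq_zero_iff_mem.mpr (Ideal.mem_span_singleton.mpr ⟨y, hy.symm⟩)
  refine Finite.of_surjective (Ideal.Quotient.lift _ g hg) fun x => ?_
  obtain ⟨x, rfl⟩ := Ideal.Quotient.mk_surjective x
  obtain ⟨a, y, h⟩ := adicIntegers_exists_sub_eq hπ n x
  refine ⟨Ideal.Quotient.mk _ a, ?_⟩
  rw [Ideal.Quotient.lift_mk]
  refine ((Ideal.Quotient.mk_eq_mk_iff_sub_mem _ _).mpr ?_).symm
  exact Ideal.mem_span_singleton.mpr ⟨y, h⟩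

end AdicIntegers

end

noncomputable section

/-! ## Differentials of a curve over a finite field -/

section Differentials

open IsDedekindDomain WithZero KaehlerDifferential

variable (Fq : Type*) [Field Fq] [Fintype Fq]
variable {A : Type*} [CommRing A] [IsDedekindDomain A] [Algebra Fq A] [Algebra.FiniteType Fq A]

include Fq in
lemma finite_quotient_of_isMaximal (I : Ideal A) [I.IsMaximal] : Finite (A ⧸ I) := by
  let := Ideal.Quotient.field I
  have := finite_of_finite_type_of_isJacobsonRing Fq (A ⧸ I)
  exact Module.finite_of_finite Fq

variable {p : HeightOneSpectrum A} {π : A} (hπ : p.intValuation π = exp (-1 : ℤ))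

include hπ in
lemma mem_of_intValuation_eq_exp : π ∈ p.asIdeal := by
  have h := (p.intValuation_le_pow_iff_mem π 1).mp (by rw [hπ]; simp)
  rwa [pow_one] at h

include hπ in
/-- A prime `p` is generated modulo `p ^ 2` by a uniformizer. -/
lemma exists_sub_mul_mem_sq {y : A} (hy : y ∈ p.asIdeal) : ∃ a, y - π * a ∈ p.asIdeal ^ 2 := by
  obtain ⟨z, hz⟩ := (adicIntegers_mem_pow_iff (F := FractionRing A) hπ 1 y).mpr (by rwa [pow_one])
  obtain ⟨a, w, hw⟩ := adicIntegers_exists_sub_eq hπ 1 z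
  refine ⟨a, (adicIntegers_mem_pow_iff (F := FractionRing A) hπ 2 _).mp ⟨w, ?_⟩⟩
  rw [map_sub, map_mul, ← hz]
  linear_combination (-algebraMap A (p.adicCompletionIntegers (FractionRing A)) π) * hw

include hπ in
/-- The module of differentials is generated by the differential of a uniformizer at `p`, up to
torsion. -/
theorem exists_smul_differential_eq :
    ∃ s : A, s ≠ 0 ∧ ∀ ω : Ω[A⁄Fq], ∃ a : A, s • ω = a • D Fq A π := by
  have := p.isMaximal
  have hfin := finite_quotient_of_isMaximal Fq p.asIdeal
  have := Fintype.ofFinite (A ⧸ p.asIdeal)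
  let := Ideal.Quotient.field p.asIdeal
  let N : Submodule A Ω[A⁄Fq] := Submodule.span A {D Fq A π}
  -- Modulo `p ^ 2`, `y` is a multiple of `π`, and by the Leibniz rule elements of `p ^ 2` have
  -- differentials in `p Ω`.
  have hsub : ∀ y ∈ p.asIdeal, D Fq A y ∈ N ⊔ p.asIdeal • (⊤ : Submodule A Ω[A⁄Fq]) := by
    intro y hy
    have hmem : ∀ b ∈ p.asIdeal, ∀ ω : Ω[A⁄Fq],
        b • ω ∈ N ⊔ p.asIdeal • (⊤ : Submodule A Ω[A⁄Fq]) :=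
      fun b hb ω => Submodule.mem_sup_right (Submodule.smul_mem_smul hb trivial)
    obtain ⟨a, ha⟩ := exists_sub_mul_mem_sq hπ hy
    rw [← sub_add_cancel y (π * a), map_add]
    generalize y - π * a = x at ha
    refine Submodule.add_mem _ ?_ ?_
    · rw [pow_two] at ha
      induction ha using Submodule.mul_induction_on' with
      | mem_mul_mem b hb c hc =>
        rw [Derivation.leibniz]
        exact Submodule.add_mem _ (hmem _ hb _) (hmem _ hc _)
      | add x _ y _ hx hy => rw [map_add]; exact Submodule.add_mem _ hx hy
    · rw [Derivation.leibniz]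
      exact Submodule.add_mem _ (hmem _ (mem_of_intValuation_eq_exp hπ) _)
        (Submodule.mem_sup_left (N.smul_mem _ (Submodule.mem_span_singleton_self _)))
  have htop : (⊤ : Submodule A Ω[A⁄Fq]) ≤ N ⊔ p.asIdeal • ⊤ := by
    refine (span_range_derivation Fq A).symm.le.trans (Submodule.span_le.mpr ?_)
    rintro _ ⟨x, rfl⟩
    -- With `Q` the order of the residue field, the differential of `x ^ Q` vanishes in
    -- characteristic dividing `Q`. So `dx` is, up to sign, the differential of `x ^ Q - x ∈ p`.
    have hx : x ^ Fintype.card (A ⧸ p.asIdeal) - x ∈ p.asIdeal := by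
      rw [← Ideal.Quotient.eq_zero_iff_mem, map_sub, map_pow, FiniteField.pow_card, sub_self]
    have hc : ((Fintype.card (A ⧸ p.asIdeal) : ℕ) : A) = 0 := by
      have hd : (Fintype.card Fq) ∣ Fintype.card (A ⧸ p.asIdeal) := by
        rw [Module.card_eq_pow_finrank (K := Fq) (V := A ⧸ p.asIdeal)]
        exact dvd_pow_self _ (Module.finrank_pos (R := Fq) (M := A ⧸ p.asIdeal)).ne'
      obtain ⟨c, hc⟩ := hd
      rw [hc, Nat.cast_mul, ← map_natCast (algebraMap Fq A) (Fintype.card Fq),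
        FiniteField.cast_card_eq_zero, map_zero, zero_mul]
    have h := hsub _ hx
    rw [map_sub, Derivation.leibniz_pow, ← Nat.cast_smul_eq_nsmul A, hc, zero_smul, zero_sub] at h
    exact (Submodule.neg_mem_iff _).mp h
  have hfg : (⊤ : Submodule A (Ω[A⁄Fq] ⧸ N)).FG := Module.Finite.fg_top
  -- Nakayama's lemma for the quotient by `A dπ` gives an annihilator `s ≡ 1` modulo `p`, which is
  -- therefore nonzero.
  obtain ⟨s, hs, hs0⟩ := Submodule.exists_sub_one_mem_and_smul_eq_zero_of_fg_of_le_smul p.asIdeal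
    (⊤ : Submodule A (Ω[A⁄Fq] ⧸ N)) hfg (by
      have h := Submodule.map_mono (f := N.mkQ) htop
      rwa [Submodule.map_top, N.range_mkQ, Submodule.map_sup, Submodule.map_smul'',
        Submodule.map_top, N.range_mkQ, N.mkQ_map_self, bot_sup_eq] at h)
  refine ⟨s, ?_, fun ω => ?_⟩
  · rintro rfl
    refine p.isPrime.ne_top ((Ideal.eq_top_iff_one _).mpr ?_)
    rw [zero_sub] at hs
    exact (Submodule.neg_mem_iff _).mp hs
  · have h := hs0 (N.mkQ ω) trivial
    rw [← map_smul, Submodule.mkQ_apply, Submodule.Quotient.mk_eq_zero,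
      Submodule.mem_span_singleton] at h
    obtain ⟨a, ha⟩ := h
    exact ⟨a, ha.symm⟩

include hπ in
/-- The differential of a uniformizer is not a torsion element. -/
theorem exists_functional_differential_ne_zero (F : Type*) [Field F] [Algebra A F]
    [IsFractionRing A F] : ∃ δ : Ω[A⁄Fq] →ₗ[A] F, δ (D Fq A π) ≠ 0 := by
  let : Algebra Fq F := ((algebraMap A F).comp (algebraMap Fq A)).toAlgebra
  have : IsScalarTower Fq A F := IsScalarTower.of_algebraMap_eq fun _ => rfl
  -- A functional that vanishes at `dπ` vanishes identically, since `dπ` generates up to torsion and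
  -- `F` is torsion free.
  suffices h : ∃ δ : Ω[A⁄Fq] →ₗ[A] F, δ ≠ 0 by
    obtain ⟨δ, hδ⟩ := h
    refine ⟨δ, fun h0 => hδ (LinearMap.ext fun ω => ?_)⟩
    obtain ⟨s, hs, h⟩ := exists_smul_differential_eq Fq hπ
    obtain ⟨a, ha⟩ := h ω
    have h1 : s • δ ω = 0 := by rw [← map_smul, ha, map_smul, h0, smul_zero]
    rw [Algebra.smul_def] at h1
    exact (mul_eq_zero.mp h1).resolve_left
      ((map_ne_zero_iff _ (IsFractionRing.injective A F)).mpr hs)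
  -- Without nonzero functionals the differentials of `F` over `Fq` vanish. Then `F`, essentially of
  -- finite type and formally unramified over `Fq`, would be finite, and the finite domain `A` would
  -- be a field, contradicting `p ≠ 0`.
  by_contra! hall
  have hD : ∀ a : A, D Fq F (algebraMap A F a) = 0 := by
    intro a
    rw [← Module.forall_dual_apply_eq_zero_iff F]
    intro l
    have h := hall ((l.restrictScalars A).comp (KaehlerDifferential.map Fq Fq A F))
    have h2 := LinearMap.congr_fun h (D Fq A a)
    simpa using h2
  have hsub : Subsingleton Ω[F⁄Fq] := by
    rw [← Submodule.subsingleton_iff F, ← subsingleton_iff_bot_eq_top, eq_comm, eq_bot_iff,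
      ← span_range_map_derivation_of_isLocalization Fq A F (nonZeroDivisors A), Submodule.span_le]
    rintro _ ⟨a, rfl⟩
    rw [Function.comp_apply, map_D]
    exact hD a
  have hunr : Algebra.FormallyUnramified Fq F := ⟨hsub⟩
  have : Algebra.EssFiniteType A F := .of_isLocalization F (nonZeroDivisors A)
  have : Algebra.EssFiniteType Fq F := .comp Fq A F
  have : Module.Finite Fq F := Algebra.FormallyUnramified.finite_of_free Fq F
  have : Finite F := Module.finite_of_finite Fq
  have : Finite A := Finite.of_injective _ (IsFractionRing.injective A F)
  have hf : IsField A := Finite.isField_of_domain A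
  let := hf.toField
  exact p.isPrime.ne_top ((Ideal.eq_bot_or_top p.asIdeal).resolve_left p.ne_bot)

include hπ in
/-- For a vector space `T` over an extension of the fraction field of `A`, the tensor product with
the module of differentials is identified with `T` by the choice of a uniformizer. -/
theorem bijective_tmul_differential (F : Type*) [Field F] [Algebra A F] [IsFractionRing A F]
    (L : Type*) [Field L] [Algebra A L] [Algebra F L] [IsScalarTower A F L]
    (T : Type*) [AddCommGroup T] [Module L T] [Module A T] [IsScalarTower A L T] :
    Function.Bijective fun t : T => t ⊗ₜ[A] D Fq A π := by
  have hinj : Function.Injective (algebraMap A L) := by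
    rw [IsScalarTower.algebraMap_eq A F L]
    exact (algebraMap F L).injective.comp (IsFractionRing.injective A F)
  constructor
  · obtain ⟨δ, hδ⟩ := exists_functional_differential_ne_zero Fq hπ F
    let ev : T ⊗[A] Ω[A⁄Fq] →ₗ[A] T := TensorProduct.lift
      (((LinearMap.lsmul L T).restrictScalars A).flip.compl₂
        ((IsScalarTower.toAlgHom A F L).toLinearMap.comp δ))
    have hev : ∀ t, ev (t ⊗ₜ D Fq A π) = algebraMap F L (δ (D Fq A π)) • t := fun t => rfl
    intro t t' h
    have h1 := congrArg ev h
    simp only [hev] at h1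
    exact smul_right_injective T ((map_ne_zero _).mpr hδ) h1
  · obtain ⟨s, hs, h⟩ := exists_smul_differential_eq Fq hπ
    have hs' : algebraMap A L s ≠ 0 := (map_ne_zero_iff _ hinj).mpr hs
    intro x
    induction x using TensorProduct.induction_on with
    | zero => exact ⟨0, TensorProduct.zero_tmul _ _⟩
    | add x y hx hy =>
      obtain ⟨t, rfl⟩ := hx
      obtain ⟨u, rfl⟩ := hy
      exact ⟨t + u, TensorProduct.add_tmul _ _ _⟩
    | tmul t ω =>
      obtain ⟨a, ha⟩ := h ω
      -- From `s ω = a dπ` and the invertibility of `s` in `L` one gets `t ⊗ ω = (a / s) t ⊗ dπ`.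
      refine ⟨a • (algebraMap A L s)⁻¹ • t, ?_⟩
      change (a • (algebraMap A L s)⁻¹ • t) ⊗ₜ[A] D Fq A π = t ⊗ₜ[A] ω
      rw [TensorProduct.smul_tmul, ← ha, ← TensorProduct.smul_tmul, ← algebraMap_smul L s,
        smul_inv_smul₀ hs']

end Differentials

end

noncomputable section

/-! ## Precomplete modules -/

lemma IsPrecomplete.of_surjective {R M N : Type*} [CommRing R] (I : Ideal R) [AddCommGroup M]
    [Module R M] [AddCommGroup N] [Module R N] [IsPrecomplete I M] (f : M →ₗ[R] N)
    (hf : Function.Surjective f) : IsPrecomplete I N := by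
  rw [← AdicCompletion.of_surjective_iff]
  intro y
  obtain ⟨x, rfl⟩ := AdicCompletion.map_surjective I hf y
  obtain ⟨x, rfl⟩ := AdicCompletion.of_surjective I M x
  exact ⟨f x, (AdicCompletion.map_of I f x).symm⟩

lemma IsPrecomplete.pi_span_singleton {R M ι : Type*} [CommRing R] (ϖ : R) [AddCommGroup M]
    [Module R M] [IsPrecomplete (Ideal.span {ϖ}) M] : IsPrecomplete (Ideal.span {ϖ}) (ι → M) := by
  constructor
  intro f hf
  simp only [SModEq.sub_mem, mem_span_pow_smul_top] at hf
  have h : ∀ i, ∃ x : M, ∀ n, f n i ≡ x [SMOD (Ideal.span {ϖ} ^ n • ⊤ : Submodule R M)] := by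
    refine fun i => IsPrecomplete.prec ‹_› fun {m n} hmn => ?_
    obtain ⟨y, hy⟩ := hf hmn
    rw [SModEq.sub_mem, mem_span_pow_smul_top]
    exact ⟨y i, congrFun hy i⟩
  choose x hx using h
  refine ⟨x, fun n => ?_⟩
  simp only [SModEq.sub_mem, mem_span_pow_smul_top] at hx ⊢
  choose y hy using fun i => hx i n
  exact ⟨y, funext hy⟩

/-- A finitely generated module over a precomplete ring is precomplete. -/
lemma IsPrecomplete.of_finite {R M : Type*} [CommRing R] (ϖ : R) [AddCommGroup M] [Module R M]
    [IsPrecomplete (Ideal.span {ϖ}) R] [Module.Finite R M] :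
    IsPrecomplete (Ideal.span {ϖ}) M := by
  obtain ⟨n, f, hf⟩ := Module.Finite.exists_fin' R M
  have := IsPrecomplete.pi_span_singleton (ι := Fin n) (M := R) ϖ
  exact IsPrecomplete.of_surjective _ f hf

/-! ## The map of tensor products induced by an extension of both factors -/

section TensorAlgebra

variable (k A O K K' : Type*) [CommRing k] [CommRing A] [CommRing O] [CommRing K] [CommRing K']
variable [Algebra k A] [Algebra k O] [Algebra A O] [IsScalarTower k A O]
variable [Algebra k K] [Algebra k K'] [Algebra K K'] [IsScalarTower k K K']

/-- `O ⊗ K'` as an algebra over `A ⊗ K`. -/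
@[reducible]
def tensorAlgebra : Algebra (A ⊗[k] K) (O ⊗[k] K') :=
  (Algebra.TensorProduct.map (IsScalarTower.toAlgHom k A O)
    (IsScalarTower.toAlgHom k K K')).toRingHom.toAlgebra

attribute [local instance 10] tensorAlgebra

lemma tensorAlgebra_algebraMap_tmul (a : A) (x : K) :
    algebraMap (A ⊗[k] K) (O ⊗[k] K') (a ⊗ₜ x) = algebraMap A O a ⊗ₜ algebraMap K K' x := rfl

lemma tensorAlgebra_isScalarTower :
    IsScalarTower (A ⊗[k] K) (A ⊗[k] K') (O ⊗[k] K') := by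
  refine IsScalarTower.of_algebraMap_eq fun x => ?_
  induction x using TensorProduct.induction_on with
  | zero => simp only [map_zero]
  | add x y hx hy => simp only [map_add, hx, hy]
  | tmul a x => rfl

end TensorAlgebra

attribute [local instance 10] tensorAlgebra

attribute [local instance] Algebra.TensorProduct.rightAlgebra in
-- By transitivity of pushouts, `A ⊗ K'` is the base change along `K → A ⊗ K` of `K'`, which is flat
-- over the field `K`.
lemma tensorAlgebra_flat (k A K K' : Type*) [CommRing k] [CommRing A] [Field K] [CommRing K']
    [Algebra k A] [Algebra k K] [Algebra k K'] [Algebra K K'] [IsScalarTower k K K'] :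
    Module.Flat (A ⊗[k] K) (A ⊗[k] K') := by
  let : Algebra K (A ⊗[k] K') :=
    ((algebraMap K' (A ⊗[k] K')).comp (algebraMap K K')).toAlgebra
  have : IsScalarTower A (A ⊗[k] K) (A ⊗[k] K') := IsScalarTower.of_algebraMap_eq fun x => by
    change _ = algebraMap A A x ⊗ₜ[k] algebraMap K K' 1
    rw [map_one]; rfl
  have : IsScalarTower K (A ⊗[k] K) (A ⊗[k] K') := IsScalarTower.of_algebraMap_eq fun x => by
    change _ = algebraMap A A 1 ⊗ₜ[k] algebraMap K K' x
    rw [map_one]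
    rfl
  have h1 : Algebra.IsPushout k K' A (A ⊗[k] K') := inferInstance
  have h2 : Algebra.IsPushout k K A (A ⊗[k] K) := inferInstance
  have : IsScalarTower K K' (A ⊗[k] K') := IsScalarTower.of_algebraMap_eq fun x => rfl
  have h3 := ((Algebra.IsPushout.comp_iff k K A (A ⊗[k] K) (T := K') (T' := A ⊗[k] K')).mp h1).symm
  exact Module.Flat.isBaseChange (R := K) (M := K') (S := A ⊗[k] K) (N := A ⊗[k] K') h3.out

end

noncomputable section

attribute [local instance 10] tensorAlgebra

/-! ## Completions of `A ⊗ K` and of `O ⊗ K` -/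

/-- `O` is a complete discrete valuation ring with finite residue field, and is the completion
of `A` at the ideal `p`; the element `π` of `A` is a uniformizer. -/
structure IsUniformizedCompletion {A : Type*} [CommRing A] (p : Ideal A) (O : Type*) [CommRing O]
    [IsDomain O] [IsDiscreteValuationRing O] [Algebra A O] (π : A) : Prop where
  irreducible : Irreducible (algebraMap A O π)
  exists_sub_eq : ∀ (n : ℕ) (x : O), ∃ (a : A) (y : O),
    x - algebraMap A O a = algebraMap A O π ^ n * y
  mem_pow_iff : ∀ (n : ℕ) (a : A), (∃ y, algebraMap A O π ^ n * y = algebraMap A O a) ↔ a ∈ p ^ n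
  isPrecomplete : IsPrecomplete (IsLocalRing.maximalIdeal O) O
  finite : ∀ n : ℕ, Finite (O ⧸ Ideal.span {algebraMap A O π ^ n})

namespace IsUniformizedCompletion

variable {Fq A O K K' : Type*} [Field Fq] [CommRing A] [CommRing O] [IsDomain O]
variable [IsDiscreteValuationRing O] [Algebra A O] [Algebra Fq A] [Algebra Fq O]
variable [IsScalarTower Fq A O] [Field K] [Algebra Fq K] [Field K'] [Algebra Fq K'] [Algebra K K']
variable [IsScalarTower Fq K K']
variable {p : Ideal A} {π : A} (h : IsUniformizedCompletion p O π)

include h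

lemma mem : π ∈ p := by
  have h1 := (h.mem_pow_iff 1 π).mp ⟨1, by rw [pow_one, mul_one]⟩
  rwa [pow_one] at h1

lemma finite_of_irreducible {ϖ : O} (hϖ : Irreducible ϖ) (n : ℕ) :
    Finite (O ⧸ Ideal.span {ϖ ^ n}) := by
  have := h.finite n
  rwa [← Ideal.span_singleton_pow, ← h.irreducible.maximalIdeal_eq, hϖ.maximalIdeal_eq,
    Ideal.span_singleton_pow] at this

lemma exists_sub_algebraMap_eq (n : ℕ) (s : O ⊗[Fq] K) :
    ∃ (b : A ⊗[Fq] K) (s' : O ⊗[Fq] K), s - algebraMap _ _ b = algebraMap A O π ^ n • s' := by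
  induction s using TensorProduct.induction_on with
  | zero => exact ⟨0, 0, by simp⟩
  | add s t hs ht =>
    obtain ⟨b, s', hb⟩ := hs
    obtain ⟨c, t', hc⟩ := ht
    exact ⟨b + c, s' + t', by rw [map_add, smul_add, ← hb, ← hc]; ring⟩
  | tmul x ξ =>
    obtain ⟨a, y, hy⟩ := h.exists_sub_eq n x
    refine ⟨a ⊗ₜ ξ, y ⊗ₜ ξ, ?_⟩
    rw [tensorAlgebra_algebraMap_tmul, TensorProduct.smul_tmul', smul_eq_mul, ← hy,
      TensorProduct.sub_tmul]
    rfl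

/-- In coordinates for an `Fq`-basis of `K` this is the defining property of `A → O`. Together with
`exists_sub_algebraMap_eq` it shows that `A ⊗ K` and `O ⊗ K` agree modulo `π ^ n`. -/
lemma mem_pow_of_algebraMap_eq {n : ℕ} {b : A ⊗[Fq] K} {s : O ⊗[Fq] K}
    (hb : algebraMap _ _ b = algebraMap A O π ^ n • s) :
    b ∈ p.map (algebraMap A (A ⊗[Fq] K)) ^ n := by
  let v := Module.Free.chooseBasis Fq K
  obtain ⟨c, rfl⟩ := (TensorProduct.equivFinsuppOfBasisRight v).symm.surjective b
  obtain ⟨d, rfl⟩ := (TensorProduct.equivFinsuppOfBasisRight v).symm.surjective s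
  have h1 : algebraMap (A ⊗[Fq] K) (O ⊗[Fq] K) ((TensorProduct.equivFinsuppOfBasisRight v).symm c) =
      (TensorProduct.equivFinsuppOfBasisRight v).symm
        (c.mapRange (algebraMap A O) (map_zero _)) := by
    rw [TensorProduct.equivFinsuppOfBasisRight_symm_apply,
      TensorProduct.equivFinsuppOfBasisRight_symm_apply, Finsupp.sum_mapRange_index (by simp),
      Finsupp.sum, map_sum]
    rfl
  have h2 : algebraMap A O π ^ n • (TensorProduct.equivFinsuppOfBasisRight v).symm d =
      (TensorProduct.equivFinsuppOfBasisRight v).symm (algebraMap A O π ^ n • d) := by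
    rw [TensorProduct.equivFinsuppOfBasisRight_symm_apply,
      TensorProduct.equivFinsuppOfBasisRight_symm_apply, Finsupp.sum_smul_index' (by simp),
      Finsupp.smul_sum]
    rfl
  rw [h1, h2, EmbeddingLike.apply_eq_iff_eq] at hb
  rw [TensorProduct.equivFinsuppOfBasisRight_symm_apply, ← Ideal.map_pow]
  refine Ideal.sum_mem _ fun i _ => ?_
  have hi : c i ∈ p ^ n := (h.mem_pow_iff n _).mp ⟨d i, by
    have := DFunLike.congr_fun hb i
    rw [Finsupp.mapRange_apply] at this
    exact this.symm⟩
  have h3 := Ideal.mul_mem_right ((1 : A) ⊗ₜ[Fq] v i) _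
    (Ideal.mem_map_of_mem (algebraMap A (A ⊗[Fq] K)) hi)
  rwa [Algebra.TensorProduct.algebraMap_apply, Algebra.TensorProduct.tmul_mul_tmul, mul_one,
    one_mul] at h3

lemma algebraMap_mem_tensorIdeal_pow {n : ℕ} {b : A ⊗[Fq] K}
    (hb : b ∈ p.map (algebraMap A (A ⊗[Fq] K)) ^ n) :
    algebraMap (A ⊗[Fq] K) (O ⊗[Fq] K) b ∈ tensorIdeal Fq O K ^ n := by
  have hle : (p.map (algebraMap A (A ⊗[Fq] K))).map (algebraMap (A ⊗[Fq] K) (O ⊗[Fq] K)) ≤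
      tensorIdeal Fq O K := by
    rw [Ideal.map_map, Ideal.map_le_iff_le_comap]
    intro a ha
    obtain ⟨y, hy⟩ := (h.mem_pow_iff 1 a).mpr (by rwa [pow_one])
    have h1 : algebraMap A O a ∈ IsLocalRing.maximalIdeal O := by
      rw [h.irreducible.maximalIdeal_eq, ← hy, pow_one]
      exact Ideal.mul_mem_right _ _ (Ideal.mem_span_singleton_self _)
    have h2 := Ideal.mem_map_of_mem (algebraMap O (O ⊗[Fq] K)) h1
    rw [Ideal.mem_comap]
    convert! h2
  exact Ideal.pow_right_mono hle n (by
    rw [← Ideal.map_pow]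
    exact Ideal.mem_map_of_mem _ hb)

/-- The two completions have the same quotients at every level. The gain is that `A ⊗ K` is
noetherian for `A` of finite type, so the theory of completions of noetherian rings applies to `O ⊗̂
K`. -/
lemma exists_linearEquiv_adicCompletion :
    Nonempty (AdicCompletion (p.map (algebraMap A (A ⊗[Fq] K))) (A ⊗[Fq] K) ≃ₗ[A ⊗[Fq] K]
      CompletedTensorInt Fq O K) := by
  let I := p.map (algebraMap A (A ⊗[Fq] K))
  let f : ∀ n, (A ⊗[Fq] K) ⧸ I ^ n →ₐ[A ⊗[Fq] K] (O ⊗[Fq] K) ⧸ tensorIdeal Fq O K ^ n := fun n =>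
    Ideal.quotientMapₐ _ (Algebra.ofId _ _) fun b hb => h.algebraMap_mem_tensorIdeal_pow hb
  let g : AdicCompletion I (A ⊗[Fq] K) →ₐ[A ⊗[Fq] K] CompletedTensorInt Fq O K :=
    AdicCompletion.liftAlgHom (tensorIdeal Fq O K) (fun n => (f n).comp (AdicCompletion.evalₐ I n))
      (by
        intro m n hle
        ext x
        obtain ⟨s, rfl⟩ := AdicCompletion.mk_surjective _ _ x
        simp only [AlgHom.comp_apply, AdicCompletion.evalₐ_mk]
        rw [← AdicCompletion.Ideal.mk_eq_mk _ hle s]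
        rfl)
  have hg : ∀ n x, AdicCompletion.evalₐ _ n (g x) = f n (AdicCompletion.evalₐ I n x) :=
    fun n x => AdicCompletion.evalₐ_liftAlgHom _ _ _ _ _
  have hfmk : ∀ n b, f n (Ideal.Quotient.mk _ b) = Ideal.Quotient.mk _ (algebraMap _ _ b) :=
    fun n b => rfl
  have hfinj : ∀ n, Function.Injective (f n) := by
    intro n
    rw [injective_iff_map_eq_zero]
    intro x hx
    obtain ⟨b, rfl⟩ := Ideal.Quotient.mk_surjective x
    rw [hfmk, Ideal.Quotient.eq_zero_iff_mem, mem_tensorIdeal_pow_iff h.irreducible] at hx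
    obtain ⟨s, hs⟩ := hx
    exact Ideal.Quotient.eq_zero_iff_mem.mpr (h.mem_pow_of_algebraMap_eq hs.symm)
  refine ⟨LinearEquiv.ofBijective g.toLinearMap ⟨?_, fun e => ?_⟩⟩
  · intro x y hxy
    refine AdicCompletion.ext_evalₐ fun n => hfinj n ?_
    rw [← hg, ← hg]
    exact congrArg _ hxy
  · choose c hc using fun n => exists_evalₐ_eq_mk n e
    choose b s hb using fun n => h.exists_sub_algebraMap_eq n (c n)
    have hbc : ∀ n, AdicCompletion.evalₐ (tensorIdeal Fq O K) n e =
        f n (Ideal.Quotient.mk _ (b n)) := by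
      intro n
      rw [hc, hfmk, Ideal.Quotient.eq, mem_tensorIdeal_pow_iff h.irreducible]
      exact ⟨s n, (hb n).symm⟩
    have hcauchy : ∀ n, b n ≡ b (n + 1) [SMOD (I ^ n • ⊤ : Submodule (A ⊗[Fq] K) (A ⊗[Fq] K))] := by
      intro n
      rw [SModEq.sub_mem, smul_eq_mul, Ideal.mul_top, ← Ideal.Quotient.eq]
      apply hfinj n
      rw [← hbc]
      have h1 : Ideal.Quotient.factor (Ideal.pow_le_pow_right n.le_succ)
          (AdicCompletion.evalₐ (tensorIdeal Fq O K) (n + 1) e) =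
          AdicCompletion.evalₐ (tensorIdeal Fq O K) n e := by
        obtain ⟨t, rfl⟩ := AdicCompletion.mk_surjective _ _ e
        rw [AdicCompletion.evalₐ_mk, AdicCompletion.evalₐ_mk,
          ← AdicCompletion.Ideal.mk_eq_mk _ n.le_succ t]
        rfl
      rw [← h1, hbc]
      rfl
    refine ⟨AdicCompletion.mk I _ (AdicCompletion.AdicCauchySequence.mk I _ b hcauchy), ?_⟩
    refine AdicCompletion.ext_evalₐ fun n => ?_
    change AdicCompletion.evalₐ _ n (g _) = _
    rw [hg, AdicCompletion.evalₐ_mk, hbc]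
    rfl

end IsUniformizedCompletion

end

noncomputable section

attribute [local instance 10] tensorAlgebra

/-- If `E` is isomorphic to the `I`-adic completion of a noetherian `R`-algebra `B`, then the base
change to `E` of a finitely generated `R`-module is Hausdorff. -/
lemma eq_zero_of_forall_exists_pow_smul_eq_tensorProduct {R B E M : Type*} [CommRing R] [CommRing B]
    [CommRing E] [Algebra R B] [Algebra B E] [Algebra R E] [IsScalarTower R B E]
    [IsNoetherianRing B] [AddCommGroup M] [Module R M] [Module.Finite R M] {I : Ideal B}
    (e : AdicCompletion I B ≃ₗ[B] E) {c : B} (hc : c ∈ I) {x : E ⊗[R] M}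
    (hx : ∀ n : ℕ, ∃ y : E ⊗[R] M, c ^ n • y = x) : x = 0 := by
  obtain ⟨d, f, hf⟩ := Module.Finite.exists_fin' B (B ⊗[R] M)
  -- Over a noetherian ring, tensoring a finite module with the completion gives its completion,
  -- where an element divisible by all `c ^ n` vanishes at each level.
  let g : E ⊗[R] M ≃ₗ[B] AdicCompletion I ((Fin d → B) ⧸ LinearMap.ker f) :=
    (TensorProduct.AlgebraTensorModule.cancelBaseChange R B B E M).symm ≪≫ₗ
    (TensorProduct.congr e.symm (f.quotKerEquivOfSurjective hf).symm) ≪≫ₗ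
    (AdicCompletion.ofTensorProductEquivOfFiniteNoetherian I
      ((Fin d → B) ⧸ LinearMap.ker f)).restrictScalars B
  suffices hg : g x = 0 from g.map_eq_zero_iff.mp hg
  refine AdicCompletion.ext fun n => ?_
  obtain ⟨y, hy⟩ := hx n
  rw [← hy, map_smul]
  change c ^ n • (g y).val n = 0
  obtain ⟨z, hz⟩ := Submodule.Quotient.mk_surjective _ ((g y).val n)
  rw [← hz, ← Submodule.Quotient.mk_smul, Submodule.Quotient.mk_eq_zero]
  exact Submodule.smul_mem_smul (Ideal.pow_mem_pow hc n) trivial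

/-! ## The base change of an `A ⊗ K`-module to `O ⊗̂ k` -/

section CompletedModule

variable (Fq A O k K M : Type*) [Field Fq] [CommRing A] [CommRing O] [IsLocalRing O]
variable [Algebra A O] [Algebra Fq A] [Algebra Fq O]
variable [IsScalarTower Fq A O] [Field K] [Algebra Fq K] [Field k] [Algebra Fq k] [Algebra K k]
variable [IsScalarTower Fq K k] [AddCommGroup M] [Module (A ⊗[Fq] K) M]

/-- The base change of an `A ⊗ K`-module along `A ⊗ K → O ⊗̂ k`. -/
def CompletedModule : Type _ := CompletedTensorInt Fq O k ⊗[A ⊗[Fq] K] M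

namespace CompletedModule

instance : AddCommGroup (CompletedModule Fq A O k K M) :=
  inferInstanceAs (AddCommGroup (CompletedTensorInt Fq O k ⊗[A ⊗[Fq] K] M))

instance : Module (CompletedTensorInt Fq O k) (CompletedModule Fq A O k K M) :=
  inferInstanceAs (Module _ (CompletedTensorInt Fq O k ⊗[A ⊗[Fq] K] M))

/-- The underlying tensor product. -/
def toTensor : CompletedModule Fq A O k K M ≃ₗ[CompletedTensorInt Fq O k]
    CompletedTensorInt Fq O k ⊗[A ⊗[Fq] K] M := LinearEquiv.refl _ _

instance : Module O (CompletedModule Fq A O k K M) :=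
  Module.compHom _ (algebraMap O (CompletedTensorInt Fq O k))

/-- The constants `k → O ⊗̂ k`. -/
def constHom : k →+* CompletedTensorInt Fq O k :=
  (algebraMap (O ⊗[Fq] k) (CompletedTensorInt Fq O k)).comp
    (Algebra.TensorProduct.includeRight : k →ₐ[Fq] O ⊗[Fq] k).toRingHom

instance : Module k (CompletedModule Fq A O k K M) :=
  Module.compHom _ (constHom Fq O k)

instance : Module Fq (CompletedModule Fq A O k K M) :=
  Module.compHom _ ((algebraMap O (CompletedTensorInt Fq O k)).comp (algebraMap Fq O))

variable {Fq A O k K M}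

lemma smul_def (b : O) (x : CompletedModule Fq A O k K M) :
    b • x = algebraMap O (CompletedTensorInt Fq O k) b • x := rfl

lemma const_smul_def (c : k) (x : CompletedModule Fq A O k K M) :
    c • x = constHom Fq O k c • x := rfl

instance : IsScalarTower O (CompletedTensorInt Fq O k) (CompletedModule Fq A O k K M) :=
  ⟨fun b e x => by rw [Algebra.smul_def, mul_smul]; rfl⟩

instance : SMulCommClass O k (CompletedModule Fq A O k K M) :=
  ⟨fun b c x => by rw [const_smul_def, const_smul_def, smul_def, smul_def, smul_comm]⟩

instance : IsScalarTower Fq O (CompletedModule Fq A O k K M) :=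
  ⟨fun a b x => by
    rw [Algebra.smul_def, mul_smul]
    rfl⟩

lemma constHom_algebraMap (a : Fq) :
    constHom Fq O k (algebraMap Fq k a) = algebraMap O _ (algebraMap Fq O a) := by
  have h : (1 : O) ⊗ₜ[Fq] algebraMap Fq k a = algebraMap Fq O a ⊗ₜ 1 := by
    rw [Algebra.algebraMap_eq_smul_one, Algebra.algebraMap_eq_smul_one, TensorProduct.smul_tmul]
  change algebraMap (O ⊗[Fq] k) _ (1 ⊗ₜ algebraMap Fq k a) = _
  rw [h]
  rfl

instance : IsScalarTower Fq k (CompletedModule Fq A O k K M) :=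
  ⟨fun a c x => by
    rw [Algebra.smul_def, mul_smul, const_smul_def, constHom_algebraMap]
    rfl⟩

/-- The pure tensor `e ⊗ m`. -/
def tmul (e : CompletedTensorInt Fq O k) (m : M) : CompletedModule Fq A O k K M :=
  e ⊗ₜ[A ⊗[Fq] K] m

lemma smul_tmul (e e' : CompletedTensorInt Fq O k) (m : M) :
    e • (tmul e' m : CompletedModule Fq A O k K M) = tmul (e * e') m := rfl

lemma tmul_smul (e : CompletedTensorInt Fq O k) (r : A ⊗[Fq] K) (m : M) :
    (tmul e (r • m) : CompletedModule Fq A O k K M) =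
      tmul (algebraMap (O ⊗[Fq] k) _ (algebraMap (A ⊗[Fq] K) (O ⊗[Fq] k) r) * e) m := by
  refine (TensorProduct.tmul_smul r e m).trans ?_
  rw [TensorProduct.smul_tmul', Algebra.smul_def]
  rfl

lemma induction_on {P : CompletedModule Fq A O k K M → Prop} (x : CompletedModule Fq A O k K M)
    (zero : P 0) (add : ∀ x y, P x → P y → P (x + y)) (tmul : ∀ e m, P (tmul e m)) : P x :=
  TensorProduct.induction_on x zero tmul add

end CompletedModule

end CompletedModule

/-! ### The lattice `(O ⊗̂ k) ⊗ M`: flatness, completeness and finite quotients. -/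

namespace IsUniformizedCompletion

variable {Fq A O k K M : Type*} [Field Fq] [CommRing A] [CommRing O] [IsDomain O]
variable [IsDiscreteValuationRing O] [Algebra A O] [Algebra Fq A] [Algebra Fq O]
variable [IsScalarTower Fq A O] [Field K] [Algebra Fq K] [Field k] [Algebra Fq k] [Algebra K k]
variable [IsScalarTower Fq K k] [AddCommGroup M] [Module (A ⊗[Fq] K) M]
variable {p : Ideal A} {π : A} (h : IsUniformizedCompletion p O π)

lemma isScalarTower_completedTensorInt :
    IsScalarTower (A ⊗[Fq] K) (A ⊗[Fq] k) (CompletedTensorInt Fq O k) := by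
  have := tensorAlgebra_isScalarTower Fq A O K k
  exact IsScalarTower.of_algebraMap_eq fun x => congrArg
    (algebraMap (O ⊗[Fq] k) (CompletedTensorInt Fq O k))
    (IsScalarTower.algebraMap_apply (A ⊗[Fq] K) (A ⊗[Fq] k) (O ⊗[Fq] k) x)

lemma isNoetherianRing_tensorProduct [Algebra.FiniteType Fq A] : IsNoetherianRing (A ⊗[Fq] k) := by
  have : IsNoetherianRing (k ⊗[Fq] A) := Algebra.FiniteType.isNoetherianRing k _
  exact isNoetherianRing_of_ringEquiv _ (Algebra.TensorProduct.comm Fq k A).toRingEquiv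

include h

/-- The map factors through `A ⊗ k`: the first step is flat by base change from fields, the second
as a completion of a noetherian ring. -/
lemma flat_completedTensorInt [Algebra.FiniteType Fq A] :
    Module.Flat (A ⊗[Fq] K) (CompletedTensorInt Fq O k) := by
  have := isNoetherianRing_tensorProduct (Fq := Fq) (A := A) (k := k)
  have := isScalarTower_completedTensorInt (Fq := Fq) (A := A) (O := O) (K := K) (k := k)
  obtain ⟨e⟩ := h.exists_linearEquiv_adicCompletion (Fq := Fq) (K := k)
  have h1 : Module.Flat (A ⊗[Fq] k) (CompletedTensorInt Fq O k) := Module.Flat.of_linearEquiv e.symm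
  have h2 := tensorAlgebra_flat Fq A K k
  exact Module.Flat.trans (A ⊗[Fq] K) (A ⊗[Fq] k) _

lemma isPrecomplete_completedTensorInt :
    IsPrecomplete (Ideal.span {algebraMap O (CompletedTensorInt Fq O k) (algebraMap A O π)})
      (CompletedTensorInt Fq O k) := by
  have h1 : (tensorIdeal Fq O k).FG := by
    rw [tensorIdeal, h.irreducible.maximalIdeal_eq]
    have h0 : (Ideal.span {algebraMap A O π}).FG := Submodule.fg_span_singleton _
    exact h0.map _
  have h2 : IsPrecomplete (tensorIdeal Fq O k) (CompletedTensorInt Fq O k) :=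
    (AdicCompletion.isAdicComplete h1).toIsPrecomplete
  have h3 : IsPrecomplete (IsLocalRing.maximalIdeal O) (CompletedTensorInt Fq O k) :=
    IsPrecomplete.map_algebraMap_iff.mp h2
  rw [h.irreducible.maximalIdeal_eq] at h3
  rwa [← Set.image_singleton, ← Ideal.map_span, IsPrecomplete.map_algebraMap_iff]

/-- For a finitely generated ideal, the kernel of the projection from the completion to the `n`-th
quotient is generated by the `n`-th power of the ideal; here the ideal is principal. -/
lemma exists_pow_smul_eq_of_evalₐ_eq_zero {n : ℕ} {e : CompletedTensorInt Fq O k}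
    (he : AdicCompletion.evalₐ (tensorIdeal Fq O k) n e = 0) :
    ∃ e', algebraMap A O π ^ n • e' = e := by
  have h1 : (tensorIdeal Fq O k).FG := by
    rw [tensorIdeal, h.irreducible.maximalIdeal_eq]
    have h0 : (Ideal.span {algebraMap A O π}).FG := Submodule.fg_span_singleton _
    exact h0.map _
  have h2 : e ∈ (AdicCompletion.eval (tensorIdeal Fq O k) (O ⊗[Fq] k) n).ker := by
    rw [LinearMap.mem_ker, ← AdicCompletion.factor_evalₐ_eq_eval _ e (by simp), he, map_zero]
  rw [← AdicCompletion.pow_smul_top_eq_ker_eval h1] at h2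
  have h3 : tensorIdeal Fq O k ^ n =
      Ideal.span {algebraMap O (O ⊗[Fq] k) (algebraMap A O π ^ n)} := by
    ext c
    rw [mem_tensorIdeal_pow_iff h.irreducible, Ideal.mem_span_singleton']
    simp only [Algebra.smul_def, mul_comm]
  rw [h3, Submodule.ideal_span_singleton_smul, Submodule.mem_smul_pointwise_iff_exists] at h2
  obtain ⟨e', -, he'⟩ := h2
  exact ⟨e', by rw [← he', algebraMap_smul]⟩

lemma isPrecomplete_completedModule [Module.Finite (A ⊗[Fq] K) M] :
    IsPrecomplete (Ideal.span {algebraMap A O π}) (CompletedModule Fq A O k K M) := by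
  have := h.isPrecomplete_completedTensorInt (Fq := Fq) (k := k)
  have : Module.Finite (CompletedTensorInt Fq O k) (CompletedModule Fq A O k K M) :=
    inferInstanceAs (Module.Finite _ (CompletedTensorInt Fq O k ⊗[A ⊗[Fq] K] M))
  have h2 := IsPrecomplete.of_finite (M := CompletedModule Fq A O k K M)
    (algebraMap O (CompletedTensorInt Fq O k) (algebraMap A O π))
  rwa [← Set.image_singleton, ← Ideal.map_span, IsPrecomplete.map_algebraMap_iff] at h2

lemma eq_zero_of_forall_exists_pow_smul_eq [Algebra.FiniteType Fq A] [Module.Finite (A ⊗[Fq] K) M]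
    {x : CompletedModule Fq A O k K M} (hx : ∀ n : ℕ, ∃ y, algebraMap A O π ^ n • y = x) :
    x = 0 := by
  have := isNoetherianRing_tensorProduct (Fq := Fq) (A := A) (k := k)
  have := isScalarTower_completedTensorInt (Fq := Fq) (A := A) (O := O) (K := K) (k := k)
  obtain ⟨e⟩ := h.exists_linearEquiv_adicCompletion (Fq := Fq) (K := k)
  refine (CompletedModule.toTensor Fq A O k K M).map_eq_zero_iff.mp
    (eq_zero_of_forall_exists_pow_smul_eq_tensorProduct e
      (Ideal.mem_map_of_mem (algebraMap A (A ⊗[Fq] k)) h.mem) fun n => ?_)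
  obtain ⟨y, hy⟩ := hx n
  refine ⟨CompletedModule.toTensor Fq A O k K M y, ?_⟩
  have h1 : algebraMap (A ⊗[Fq] k) (CompletedTensorInt Fq O k)
      (algebraMap A (A ⊗[Fq] k) π ^ n) = algebraMap O _ (algebraMap A O π ^ n) := by
    rw [← map_pow, ← map_pow, Algebra.TensorProduct.algebraMap_apply]
    change algebraMap (O ⊗[Fq] k) _ (algebraMap A O (π ^ n) ⊗ₜ algebraMap k k 1) = _
    rw [map_one]
    rfl
  rw [← hy, CompletedModule.smul_def, map_smul, ← algebraMap_smul (CompletedTensorInt Fq O k)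
    (algebraMap A (A ⊗[Fq] k) π ^ n), h1]

/-- Multiplication by `π` is injective on `M`, and flatness of `O ⊗̂ k` over `A ⊗ K` preserves this.
-/
lemma eq_zero_of_smul_completedModule [Algebra.FiniteType Fq A]
    (hM : ∀ m : M, (π ⊗ₜ[Fq] (1 : K)) • m = 0 → m = 0) {x : CompletedModule Fq A O k K M}
    (hx : algebraMap A O π • x = 0) : x = 0 := by
  have := h.flat_completedTensorInt (Fq := Fq) (K := K) (k := k)
  have hinj : Function.Injective (LinearMap.lsmul (A ⊗[Fq] K) M (π ⊗ₜ[Fq] (1 : K))) :=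
    (injective_iff_map_eq_zero _).mpr hM
  let T := CompletedModule.toTensor Fq A O k K M
  let g := LinearMap.lTensor (CompletedTensorInt Fq O k)
    (LinearMap.lsmul (A ⊗[Fq] K) M (π ⊗ₜ[Fq] (1 : K)))
  have key : ∀ x, g (T x) = T (algebraMap A O π • x) := by
    intro x
    induction x using CompletedModule.induction_on with
    | zero => rw [smul_zero, map_zero, map_zero]
    | add x y hx hy => rw [map_add, map_add, smul_add, hx, hy, map_add]
    | tmul e m =>
      change T (CompletedModule.tmul e ((π ⊗ₜ[Fq] (1 : K)) • m)) = _
      rw [CompletedModule.tmul_smul, CompletedModule.smul_def, CompletedModule.smul_tmul,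
        tensorAlgebra_algebraMap_tmul, map_one]
      rfl
  refine T.map_eq_zero_iff.mp ((injective_iff_map_eq_zero g).mp
    (Module.Flat.lTensor_preserves_injective_linearMap _ hinj) _ ?_)
  rw [key, hx, map_zero]

/-- Modulo `π ^ n` the module is spanned over `k` by `b ⊗ m`, with `b` among representatives of the
finite ring `O / π ^ n` and `m` among finitely many generators of `M`. -/
lemma finite_quotient_completedModule [Module.Finite (A ⊗[Fq] K) M] (n : ℕ) :
    Module.Finite k (CompletedModule Fq A O k K M ⧸ LinearMap.range
      (DistribSMul.toLinearMap k (CompletedModule Fq A O k K M) (algebraMap A O π ^ n))) := by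
  have := h.finite n
  have := Fintype.ofFinite (O ⧸ Ideal.span {algebraMap A O π ^ n})
  set X := CompletedModule Fq A O k K M
  set N := LinearMap.range (DistribSMul.toLinearMap k X (algebraMap A O π ^ n)) with hN
  have hmemN : ∀ x : X, algebraMap A O π ^ n • x ∈ N := fun x => ⟨x, rfl⟩
  obtain ⟨s, hs⟩ := Module.Finite.fg_top (R := A ⊗[Fq] K) (M := M)
  let v : (O ⧸ Ideal.span {algebraMap A O π ^ n}) × s → X := fun i =>
    CompletedModule.tmul (algebraMap O _ i.1.out) i.2.1
  let W : Submodule k X := Submodule.span k (Set.range v) ⊔ N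
  have hW : ∀ (e : CompletedTensorInt Fq O k) (m : M), m ∈ s → CompletedModule.tmul e m ∈ W := by
    intro e m hm
    obtain ⟨c, hc⟩ := exists_evalₐ_eq_mk n e
    obtain ⟨e', he'⟩ := h.exists_pow_smul_eq_of_evalₐ_eq_zero
      (e := e - algebraMap (O ⊗[Fq] k) _ c) (n := n) (by
        rw [map_sub, hc, AlgHom.commutes, sub_eq_zero]; rfl)
    have h1 : (CompletedModule.tmul e m : X) = CompletedModule.tmul (algebraMap (O ⊗[Fq] k) _ c) m +
        algebraMap A O π ^ n • CompletedModule.tmul e' m := by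
      rw [CompletedModule.smul_def, CompletedModule.smul_tmul, ← Algebra.smul_def, he']
      conv_lhs => rw [← add_sub_cancel (algebraMap (O ⊗[Fq] k) _ c) e]
      exact TensorProduct.add_tmul _ _ _
    rw [h1]
    refine W.add_mem ?_ (Submodule.mem_sup_right (hmemN _))
    clear h1 he' hc
    induction c using TensorProduct.induction_on with
    | zero =>
      rw [map_zero]
      convert! W.zero_mem
      exact TensorProduct.zero_tmul _ _
    | add c d hc hd =>
      rw [map_add]
      convert! W.add_mem hc hd
      exact TensorProduct.add_tmul _ _ _
    | tmul b ξ =>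
      let i := Ideal.Quotient.mk (Ideal.span {algebraMap A O π ^ n}) b
      obtain ⟨b', hb'⟩ : ∃ b', b = i.out + algebraMap A O π ^ n * b' := by
        have h2 : b - i.out ∈ Ideal.span {algebraMap A O π ^ n} := by
          rw [← Ideal.Quotient.eq, Ideal.Quotient.mk_out]
        obtain ⟨b', hb'⟩ := Ideal.mem_span_singleton'.mp h2
        exact ⟨b', by rw [mul_comm, hb', add_sub_cancel]⟩
      have h2 : (CompletedModule.tmul (algebraMap (O ⊗[Fq] k) _ (b ⊗ₜ ξ)) m : X) =
          ξ • (v (i, ⟨m, hm⟩) + algebraMap A O π ^ n •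
            CompletedModule.tmul (algebraMap O (CompletedTensorInt Fq O k) b') m) := by
        have h3 : (b ⊗ₜ[Fq] ξ : O ⊗[Fq] k) = ((1 : O) ⊗ₜ[Fq] ξ) * (algebraMap O _ i.out +
            algebraMap O _ (algebraMap A O π ^ n) * algebraMap O _ b') := by
          rw [← map_mul, ← map_add, ← hb', Algebra.TensorProduct.algebraMap_apply,
            Algebra.TensorProduct.tmul_mul_tmul, one_mul, mul_one]
          rfl
        rw [h3, CompletedModule.const_smul_def, CompletedModule.smul_def]
        have h4 : ∀ e e' : CompletedTensorInt Fq O k, (CompletedModule.tmul e m : X) +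
            CompletedModule.tmul e' m = CompletedModule.tmul (e + e') m :=
          fun e e' => (TensorProduct.add_tmul _ _ _).symm
        rw [CompletedModule.smul_tmul, h4, CompletedModule.smul_tmul, map_mul, map_add, map_mul]
        rfl
      rw [h2]
      exact W.smul_mem _ (W.add_mem (Submodule.mem_sup_left (Submodule.subset_span ⟨_, rfl⟩))
        (Submodule.mem_sup_right (hmemN _)))
  have htop : W = ⊤ := by
    rw [eq_top_iff]
    rintro x -
    induction x using CompletedModule.induction_on with
    | zero => exact W.zero_mem
    | add x y hx hy => exact W.add_mem hx hy
    | tmul e m =>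
      have hm : m ∈ Submodule.span (A ⊗[Fq] K) (s : Set M) := by rw [hs]; trivial
      induction hm using Submodule.span_induction generalizing e with
      | mem m hm => exact hW e m hm
      | zero =>
        convert! W.zero_mem
        exact TensorProduct.tmul_zero _ _
      | add x y _ _ hx hy =>
        convert! W.add_mem (hx e) (hy e)
        exact TensorProduct.tmul_add _ _ _
      | smul r m _ hm =>
        rw [CompletedModule.tmul_smul]
        exact hm _
  refine Module.finite_def.mpr ?_
  have h1 : (⊤ : Submodule k (X ⧸ N)) = (Submodule.span k (Set.range v)).map N.mkQ := by
    rw [← N.range_mkQ, ← Submodule.map_top, ← htop, Submodule.map_sup, N.mkQ_map_self, sup_bot_eq]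
  rw [h1]
  exact (Submodule.fg_span (Set.finite_range v)).map _

/-- The base change to `O ⊗̂ k` of a finitely generated `A ⊗ K`-module without `π`-torsion. -/
theorem isFrobeniusLattice [Algebra.FiniteType Fq A] [Module.Finite (A ⊗[Fq] K) M]
    (hM : ∀ m : M, (π ⊗ₜ[Fq] (1 : K)) • m = 0 → m = 0) :
    IsFrobeniusLattice Fq k (X := CompletedModule Fq A O k K M) (algebraMap A O π) where
  eq_zero_of_smul _ := h.eq_zero_of_smul_completedModule hM
  isAdicComplete :=
    { h.isPrecomplete_completedModule with
      haus' := fun x hx => h.eq_zero_of_forall_exists_pow_smul_eq fun n => by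
        have h1 := hx n
        rwa [SModEq.zero, mem_span_pow_smul_top] at h1 }
  finite n := h.finite_quotient_completedModule n

end IsUniformizedCompletion

end

noncomputable section

attribute [local instance 10] tensorAlgebra

/-! ## Semilinear functionals on base changes -/

section SemilinearLift

variable {R S S' M : Type*} [CommRing R] [CommRing S] [CommRing S'] [Algebra R S]
variable [AddCommGroup M] [Module R M]

/-- The semilinear map `S ⊗ M → S'`, `e ⊗ m ↦ s(e) g(m)`. -/
def semilinearLift {ρ : R →+* S'} (s : S →+* S') (h : ∀ x, s (algebraMap R S x) = ρ x)
    (g : M →ₛₗ[ρ] S') : S ⊗[R] M →ₛₗ[s] S' :=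
  (TensorProduct.lid S' S').toLinearMap.comp
    (semilinearBaseChange (R' := S') (S' := S') s h g)

end SemilinearLift

section Localization

variable {R E C D M : Type*} [CommRing R] [CommRing E] [CommRing C] [CommRing D]
variable [Algebra R E] [Algebra E D] [Algebra R C] [Algebra C D]
variable [AddCommGroup M] [Module R M]

/-- The map `e ⊗ m ↦ e ⊗ (1 ⊗ m)` from a base change of `M` to a base change in two steps. -/
def twoStepBaseChange (h : ∀ x : R, algebraMap E D (algebraMap R E x) =
    algebraMap C D (algebraMap R C x)) : E ⊗[R] M →ₛₗ[algebraMap E D] D ⊗[C] (C ⊗[R] M) :=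
  semilinearBaseChange (algebraMap E D) h
    (show M →ₛₗ[algebraMap R C] C ⊗[R] M from
      { toFun := fun m => 1 ⊗ₜ m
        map_add' := TensorProduct.tmul_add _
        map_smul' := fun r m => by
          rw [← TensorProduct.smul_tmul, TensorProduct.smul_tmul', Algebra.smul_def, smul_eq_mul] })

lemma twoStepBaseChange_tmul (h : ∀ x : R, algebraMap E D (algebraMap R E x) =
    algebraMap C D (algebraMap R C x)) (e : E) (m : M) :
    twoStepBaseChange h (e ⊗ₜ[R] m) = algebraMap E D e ⊗ₜ[C] ((1 : C) ⊗ₜ[R] m) := rfl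

variable (S : Submonoid E) [IsLocalization S D]

/-- If `D` is a localization of `E`, the map from the base change to `E` to the base change to `D`
is a localization. -/
lemma twoStepBaseChange_localization (h : ∀ x : R, algebraMap E D (algebraMap R E x) =
    algebraMap C D (algebraMap R C x)) :
    (∀ x : E ⊗[R] M, twoStepBaseChange h x = 0 → ∃ s ∈ S, s • x = 0) ∧
      ∀ t : D ⊗[C] (C ⊗[R] M), ∃ s ∈ S, ∃ x : E ⊗[R] M,
        algebraMap E D s • t = twoStepBaseChange h x := by
  let : Algebra R D := ((algebraMap C D).comp (algebraMap R C)).toAlgebra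
  have : IsScalarTower R C D := IsScalarTower.of_algebraMap_eq fun _ => rfl
  have : IsScalarTower R E D := IsScalarTower.of_algebraMap_eq fun x => (h x).symm
  let Φ := TensorProduct.AlgebraTensorModule.cancelBaseChange R C D D M
  let Ψ := TensorProduct.AlgebraTensorModule.cancelBaseChange R E D D M
  have key : ∀ x : E ⊗[R] M, Φ (twoStepBaseChange h x) = Ψ (1 ⊗ₜ x) := by
    intro x
    induction x using TensorProduct.induction_on with
    | zero => rw [map_zero, map_zero, TensorProduct.tmul_zero, map_zero]
    | add x y hx hy => rw [map_add, map_add, hx, hy, TensorProduct.tmul_add, map_add]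
    | tmul e m =>
      rw [twoStepBaseChange_tmul]
      simp [Φ, Ψ, TensorProduct.AlgebraTensorModule.cancelBaseChange_tmul, Algebra.smul_def]
  constructor
  · intro x hx
    have h1 := key x
    rw [hx, map_zero, eq_comm, LinearEquiv.map_eq_zero_iff] at h1
    obtain ⟨c, hc⟩ := (IsLocalizedModule.eq_zero_iff S (TensorProduct.mk E D (E ⊗[R] M) 1)).mp h1
    exact ⟨c, c.2, hc⟩
  · intro t
    obtain ⟨⟨x, s⟩, hs⟩ := IsLocalizedModule.surj S (TensorProduct.mk E D (E ⊗[R] M) 1)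
      (Ψ.symm (Φ t))
    refine ⟨s, s.2, x, Φ.injective ?_⟩
    rw [key, map_smul]
    change _ = Ψ (TensorProduct.mk E D (E ⊗[R] M) 1 x)
    have hs' : algebraMap E D (s : E) • Ψ.symm (Φ t) = TensorProduct.mk E D (E ⊗[R] M) 1 x := by
      rw [algebraMap_smul]
      exact hs
    rw [← hs', map_smul, LinearEquiv.apply_symm_apply]

end Localization

/-! ## The rings `O ⊗̂ k` and `L ⊗̂ k` -/

namespace CompletedTensor

variable {Fq O L k k' : Type*} [Field Fq] [CommRing O] [IsLocalRing O] [CommRing L]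
variable [Algebra Fq O] [Algebra O L]
variable [Field k] [Algebra Fq k] [Field k'] [Algebra Fq k']

variable (Fq O L k) in
/-- The canonical homomorphism from `O ⊗̂ k` to `L ⊗̂ k`. -/
def ofInt : CompletedTensorInt Fq O k →+* CompletedTensor Fq O L k :=
  (Algebra.TensorProduct.includeRight :
    CompletedTensorInt Fq O k →ₐ[O] L ⊗[O] CompletedTensorInt Fq O k).toRingHom

lemma ofInt_algebraMap (b : O) : ofInt Fq O L k (algebraMap O _ b) =
    algebraMap L (CompletedTensor Fq O L k) (algebraMap O L b) := by
  change (1 : L) ⊗ₜ[O] algebraMap O (CompletedTensorInt Fq O k) b = algebraMap O L b ⊗ₜ[O] 1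
  rw [Algebra.algebraMap_eq_smul_one, Algebra.algebraMap_eq_smul_one, TensorProduct.smul_tmul]

lemma map_ofInt (j : k →ₐ[Fq] k') (e : CompletedTensorInt Fq O k) :
    map Fq O L j (ofInt Fq O L k e) = ofInt Fq O L k' (mapInt Fq O j e) := by
  change (AlgHom.id L L 1) ⊗ₜ[O] mapInt Fq O j e = 1 ⊗ₜ[O] mapInt Fq O j e
  rfl

end CompletedTensor

end

noncomputable section

attribute [local instance 10] tensorAlgebra

/-! ### Torsion and Frobenius invariants of `O ⊗̂ k` and `L ⊗̂ k`. -/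

namespace IsUniformizedCompletion

variable {Fq A O L k : Type*} [Field Fq] [CommRing A] [CommRing O] [IsDomain O]
variable [IsDiscreteValuationRing O] [Algebra A O] [Algebra Fq A] [Algebra Fq O]
variable [IsScalarTower Fq A O] [Field L] [Algebra O L] [IsFractionRing O L] [Algebra Fq L]
variable [IsScalarTower Fq O L] [Field k] [Algebra Fq k]
variable {p : Ideal A} {π : A} (h : IsUniformizedCompletion p O π)

open CompletedTensor

variable (L) in
include h L in
-- Dually, `L / O` is divisible by `π`: every pairing of `e` with an element of `L / O` is a pairing
-- of `π e`.
lemma completedTensorInt_eq_zero_of_smul {e : CompletedTensorInt Fq O k}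
    (he : algebraMap A O π • e = 0) : e = 0 := by
  obtain ⟨l, hl⟩ := exists_isNondegenerateFunctional Fq O L
  refine eq_of_completedPairing_eq hl fun y => ?_
  obtain ⟨x, rfl⟩ := Submodule.Quotient.mk_surjective _ y
  have h0 : algebraMap O L (algebraMap A O π) ≠ 0 :=
    (map_ne_zero_iff _ (IsFractionRing.injective O L)).mpr h.irreducible.ne_zero
  have hy : (Submodule.Quotient.mk x : FractionQuotient O L) = algebraMap A O π •
      Submodule.Quotient.mk ((algebraMap O L (algebraMap A O π))⁻¹ * x) := by
    rw [← Submodule.Quotient.mk_smul, Algebra.smul_def, ← mul_assoc, mul_inv_cancel₀ h0, one_mul]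
  rw [hy, ← completedPairing_smul, ← completedPairing_smul, he, smul_zero]

include h in
lemma exists_isUnit_mul_pow_eq {b : O} (hb : b ≠ 0) :
    ∃ (u : O) (n : ℕ), u * b = algebraMap A O π ^ n := by
  obtain ⟨n, u, rfl⟩ := IsDiscreteValuationRing.eq_unit_mul_pow_irreducible hb h.irreducible
  exact ⟨(u⁻¹ : Oˣ), n, by rw [← mul_assoc, Units.inv_mul, one_mul]⟩

variable (Fq O L k) in
lemma isLocalization_completedTensor :
    letI := (ofInt Fq O L k).toAlgebra
    IsLocalization (Algebra.algebraMapSubmonoid (CompletedTensorInt Fq O k) (nonZeroDivisors O))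
      (CompletedTensor Fq O L k) :=
  IsLocalization.tensorRight (R := O) (A := L) (S := CompletedTensorInt Fq O k) (nonZeroDivisors O)

include h in
lemma pow_smul_eq_zero_imp {X : Type*} [AddCommGroup X] [Module O X]
    (hX : ∀ x : X, algebraMap A O π • x = 0 → x = 0) (n : ℕ) {x : X}
    (hx : algebraMap A O π ^ n • x = 0) : x = 0 := by
  induction n with
  | zero => rwa [pow_zero, one_smul] at hx
  | succ n ih => exact ih (hX _ (by rwa [pow_succ', mul_smul] at hx))

include h in
lemma ofInt_injective : Function.Injective (ofInt Fq O L k) := by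
  let := (ofInt Fq O L k).toAlgebra
  have := isLocalization_completedTensor Fq O L k
  rw [injective_iff_map_eq_zero]
  intro e he
  obtain ⟨⟨_, b, hb, rfl⟩, hs⟩ := (IsLocalization.map_eq_zero_iff
    (Algebra.algebraMapSubmonoid (CompletedTensorInt Fq O k) (nonZeroDivisors O))
    (CompletedTensor Fq O L k) e).mp he
  obtain ⟨u, n, hu⟩ := h.exists_isUnit_mul_pow_eq (nonZeroDivisors.ne_zero hb)
  refine h.pow_smul_eq_zero_imp (fun x => h.completedTensorInt_eq_zero_of_smul L) n ?_
  rw [← hu, mul_smul, Algebra.smul_def b, hs, smul_zero]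

include h in
lemma exists_pow_mul_eq_ofInt (x : CompletedTensor Fq O L k) : ∃ (n : ℕ) (e : _),
    algebraMap L (CompletedTensor Fq O L k) (algebraMap O L (algebraMap A O π ^ n)) * x =
      ofInt Fq O L k e := by
  let := (ofInt Fq O L k).toAlgebra
  have := isLocalization_completedTensor Fq O L k
  obtain ⟨⟨e, ⟨_, b, hb, rfl⟩⟩, hs⟩ := IsLocalization.surj
    (Algebra.algebraMapSubmonoid (CompletedTensorInt Fq O k) (nonZeroDivisors O)) x
  obtain ⟨u, n, hu⟩ := h.exists_isUnit_mul_pow_eq (nonZeroDivisors.ne_zero hb)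
  refine ⟨n, algebraMap O _ u * e, ?_⟩
  rw [← hu, map_mul, map_mul, map_mul, ← ofInt_algebraMap, ← ofInt_algebraMap, mul_assoc]
  congr 1
  rw [mul_comm]
  exact hs

variable (L) in
include h L in
/-- The elements of `O ⊗̂ k` that are fixed by the partial Frobenius are those of `O`. -/
lemma exists_algebraMap_eq_of_mapInt_eq [Fintype Fq] {e : CompletedTensorInt Fq O k}
    (he : mapInt Fq O (frob Fq k) e = e) : ∃ b, algebraMap O _ b = e := by
  obtain ⟨l, hl⟩ := exists_isNondegenerateFunctional Fq O L
  have := h.isPrecomplete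
  -- Invariance under `σ` makes all values of the pairing with `e` equal to their `q`-th powers. So
  -- `e` defines a functional with values in `Fq`, and such functionals come from `O`.
  have h1 : ∀ y : FractionQuotient O L, ∃ c : Fq, algebraMap Fq k c = completedPairing l e y := by
    intro y
    refine exists_algebraMap_eq_of_pow_card_eq ?_
    conv_rhs => rw [← he]
    rw [completedPairing_mapInt]
    rfl
  choose c hc using h1
  let μ : FractionQuotient O L →ₗ[Fq] Fq :=
    { toFun := c
      map_add' := fun y z => (algebraMap Fq k).injective (by
        rw [map_add, hc, hc, hc]
        exact map_add (completedPairingRight l e) y z)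
      map_smul' := fun a y => (algebraMap Fq k).injective (by
        rw [RingHom.id_apply, smul_eq_mul, map_mul, hc, hc, ← Algebra.smul_def]
        exact map_smul (completedPairingRight l e) a y) }
  obtain ⟨b, hb⟩ := exists_pairing_eq_of_isPrecomplete hl
    (fun ϖ hϖ n => h.finite_of_irreducible hϖ n) μ
  refine ⟨b, eq_of_completedPairing_eq hl fun y => ?_⟩
  rw [completedPairing_algebraMap, hb]
  exact hc y

include h in
/-- The elements of `L ⊗̂ k` that are fixed by the partial Frobenius are those of `L`. -/
lemma exists_algebraMap_eq_of_partialFrob_eq [Fintype Fq] {x : CompletedTensor Fq O L k}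
    (hx : partialFrob Fq O L k x = x) : ∃ c, algebraMap L _ c = x := by
  obtain ⟨n, e, he⟩ := h.exists_pow_mul_eq_ofInt x
  have h1 : mapInt Fq O (frob Fq k) e = e := by
    apply h.ofInt_injective (L := L)
    rw [← map_ofInt, ← he, map_mul, AlgHom.commutes]
    exact congrArg _ hx
  obtain ⟨b, rfl⟩ := h.exists_algebraMap_eq_of_mapInt_eq L h1
  have h0 : algebraMap O L (algebraMap A O π ^ n) ≠ 0 :=
    (map_ne_zero_iff _ (IsFractionRing.injective O L)).mpr (pow_ne_zero n h.irreducible.ne_zero)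
  refine ⟨(algebraMap O L (algebraMap A O π ^ n))⁻¹ * algebraMap O L b, ?_⟩
  rw [map_mul, ← ofInt_algebraMap, ← he, ← mul_assoc, ← map_mul, inv_mul_cancel₀ h0, map_one,
    one_mul]

include h in
-- As `L` is a field, only nontriviality of the target matters. If `1 = 0` in `O ⊗̂ k`, the duality
-- would force `L / O = 0`.
lemma algebraMap_completedTensor_injective :
    Function.Injective (algebraMap L (CompletedTensor Fq O L k)) := by
  have : Nontrivial (CompletedTensorInt Fq O k) := by
    obtain ⟨l, hl⟩ := exists_isNondegenerateFunctional Fq O L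
    refine ⟨1, 0, fun h10 => ?_⟩
    have hy : ∀ y : FractionQuotient O L, y = 0 := by
      refine fun y => hl y fun b => (algebraMap Fq k).injective ?_
      rw [← completedPairing_algebraMap, Algebra.algebraMap_eq_smul_one, h10, smul_zero, map_zero,
        ← map_zero (algebraMap O (CompletedTensorInt Fq O k)), completedPairing_algebraMap,
        zero_smul, map_zero, map_zero]
    have h1 := hy (Submodule.Quotient.mk (algebraMap O L (algebraMap A O π))⁻¹)
    obtain ⟨b, hb⟩ := FractionQuotient.mk_eq_zero_iff.mp h1
    refine h.irreducible.not_isUnit (IsUnit.of_mul_eq_one b (IsFractionRing.injective O L ?_))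
    rw [map_mul, hb, mul_inv_cancel₀, map_one]
    exact (map_ne_zero_iff _ (IsFractionRing.injective O L)).mpr h.irreducible.ne_zero
  have : Nontrivial (CompletedTensor Fq O L k) := (h.ofInt_injective (L := L)).nontrivial
  exact (algebraMap L (CompletedTensor Fq O L k)).injective

end IsUniformizedCompletion

end

noncomputable section

attribute [local instance 10] tensorAlgebra

/-! ## Functionals on the slope zero Tate module -/

section Functional

variable {Fq O L K Kb K' Kb' : Type*} [Field Fq] [Fintype Fq] [CommRing O] [IsLocalRing O]
variable [CommRing L] [Algebra Fq O] [Algebra O L] [Field K] [Algebra Fq K]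
variable [Field Kb] [Algebra Fq Kb] [Algebra K Kb] [IsScalarTower Fq K Kb]
variable [Field K'] [Algebra Fq K']
variable [Field Kb'] [Algebra Fq Kb'] [Algebra K' Kb'] [IsScalarTower Fq K' Kb']
variable {N : Type*} [AddCommGroup N] [Module (CompletedTensor Fq O L K) N]
variable {N' : Type*} [AddCommGroup N'] [Module (CompletedTensor Fq O L K') N']

/-- The elements of `L ⊗̂ k` that are fixed by the partial Frobenius are those of `L`. -/
structure IsFrobeniusFixedField (Fq O L k : Type*) [Field Fq] [Fintype Fq] [CommRing O]
    [IsLocalRing O] [CommRing L] [Algebra Fq O] [Algebra O L] [Field k] [Algebra Fq k] : Prop where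
  exists_algebraMap_eq : ∀ x : CompletedTensor Fq O L k, partialFrob Fq O L k x = x →
    ∃ c, algebraMap L _ c = x
  injective : Function.Injective (algebraMap L (CompletedTensor Fq O L k))

namespace slopeZeroTate

/-- The extension of a semilinear functional on `N` to the base change of `N`. -/
def extend (f : N →ₛₗ[algebraMap (CompletedTensor Fq O L K) (CompletedTensor Fq O L Kb)]
      CompletedTensor Fq O L Kb) :
    CompletedTensor Fq O L Kb ⊗[CompletedTensor Fq O L K] N →ₗ[CompletedTensor Fq O L Kb]
      CompletedTensor Fq O L Kb :=
  semilinearLift (RingHom.id _) (fun _ => rfl) f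

variable {τ : N →ₛₗ[(partialFrob Fq O L K).toRingHom] N}
variable {τ' : N' →ₛₗ[(partialFrob Fq O L K').toRingHom] N'}
variable {f : N →ₛₗ[algebraMap (CompletedTensor Fq O L K) (CompletedTensor Fq O L Kb)]
      CompletedTensor Fq O L Kb}
variable {f' : N' →ₛₗ[algebraMap (CompletedTensor Fq O L K') (CompletedTensor Fq O L Kb')]
      CompletedTensor Fq O L Kb'}

lemma extend_tmul (e : CompletedTensor Fq O L Kb) (n : N) : extend f (e ⊗ₜ n) = e * f n := rfl

lemma extend_tauClosure (hf : ∀ n, f (τ n) = partialFrob Fq O L Kb (f n))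
    (t : CompletedTensor Fq O L Kb ⊗[CompletedTensor Fq O L K] N) :
    extend f (tauClosure Kb τ t) = partialFrob Fq O L Kb (extend f t) := by
  induction t using TensorProduct.induction_on with
  | zero => simp only [map_zero]
  | add y z hy hz => simp only [map_add, hy, hz]
  | tmul e n =>
    rw [tauClosure, semilinearBaseChange_tmul, extend_tmul, extend_tmul, hf, map_mul]
    rfl

lemma extend_semilinearBaseChange
    (s : CompletedTensor Fq O L Kb →ₐ[L] CompletedTensor Fq O L Kb')
    {ρ : CompletedTensor Fq O L K →+* CompletedTensor Fq O L K'}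
    (hs : ∀ x, s (algebraMap (CompletedTensor Fq O L K) (CompletedTensor Fq O L Kb) x) =
      algebraMap (CompletedTensor Fq O L K') (CompletedTensor Fq O L Kb') (ρ x))
    (g : N →ₛₗ[ρ] N') (hg : ∀ n, f' (g n) = s (f n))
    (t : CompletedTensor Fq O L Kb ⊗[CompletedTensor Fq O L K] N) :
    extend f' (semilinearBaseChange s.toRingHom hs g t) = s (extend f t) := by
  induction t using TensorProduct.induction_on with
  | zero => simp only [map_zero]
  | add y z hy hz => simp only [map_add, hy, hz]
  | tmul e n =>
    rw [semilinearBaseChange_tmul, extend_tmul, extend_tmul, hg, map_mul]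
    rfl

variable (hL : IsFrobeniusFixedField Fq O L Kb) (hL' : IsFrobeniusFixedField Fq O L Kb')

/-- A Frobenius equivariant functional on `N` with values in `L ⊗̂ Kb` induces a functional on
`T_0(N)` with values in `L`. -/
def functional (f : N →ₛₗ[algebraMap (CompletedTensor Fq O L K) (CompletedTensor Fq O L Kb)]
      CompletedTensor Fq O L Kb) (hf : ∀ n, f (τ n) = partialFrob Fq O L Kb (f n)) :
    Module.Dual L (slopeZeroTate Kb τ) :=
  (LinearEquiv.ofInjective (Algebra.linearMap L (CompletedTensor Fq O L Kb))
    hL.injective).symm.toLinearMap.comp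
    (LinearMap.codRestrict _
      (((extend f).restrictScalars L).comp (slopeZeroTate Kb τ).subtype) (fun t => by
        obtain ⟨c, hc⟩ := hL.exists_algebraMap_eq (extend f t.1) (by
          rw [← extend_tauClosure hf]
          exact congrArg _ t.2)
        exact ⟨c, hc⟩))

lemma algebraMap_functional (hf : ∀ n, f (τ n) = partialFrob Fq O L Kb (f n))
    (t : slopeZeroTate Kb τ) :
    algebraMap L (CompletedTensor Fq O L Kb) (functional hL f hf t) = extend f t.1 :=
  congrArg Subtype.val (LinearEquiv.apply_symm_apply
    (LinearEquiv.ofInjective (Algebra.linearMap L (CompletedTensor Fq O L Kb)) hL.injective) _)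

include hL' in
-- The functionals take values in `L`, which `s` fixes. Galois actions, homomorphisms and field
-- extensions are all instances of this invariance.
lemma functional_map (hf : ∀ n, f (τ n) = partialFrob Fq O L Kb (f n))
    (hf' : ∀ n, f' (τ' n) = partialFrob Fq O L Kb' (f' n))
    (s : CompletedTensor Fq O L Kb →ₐ[L] CompletedTensor Fq O L Kb')
    {ρ : CompletedTensor Fq O L K →+* CompletedTensor Fq O L K'}
    (hs : ∀ x, s (algebraMap (CompletedTensor Fq O L K) (CompletedTensor Fq O L Kb) x) =
      algebraMap (CompletedTensor Fq O L K') (CompletedTensor Fq O L Kb') (ρ x))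
    (hσ : ∀ e, s (partialFrob Fq O L Kb e) = partialFrob Fq O L Kb' (s e))
    (g : N →ₛₗ[ρ] N') (hg : ∀ n, g (τ n) = τ' (g n)) (hfg : ∀ n, f' (g n) = s (f n))
    (t : slopeZeroTate Kb τ) :
    functional hL' f' hf' (slopeZeroTate.map s hs hσ g hg t) = functional hL f hf t := by
  refine hL'.injective ?_
  rw [algebraMap_functional, coe_map_apply, extend_semilinearBaseChange s hs g hfg,
    ← algebraMap_functional hL hf, AlgHom.commutes]

end slopeZeroTate

end Functional

namespace IsUniformizedCompletion

variable {Fq A O L k : Type*} [Field Fq] [CommRing A] [CommRing O] [IsDomain O]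
variable [IsDiscreteValuationRing O] [Algebra A O] [Algebra Fq A] [Algebra Fq O]
variable [IsScalarTower Fq A O] [Field L] [Algebra O L] [IsFractionRing O L] [Algebra Fq L]
variable [IsScalarTower Fq O L] [Field k] [Algebra Fq k]
variable {p : Ideal A} {π : A} (h : IsUniformizedCompletion p O π)

include h in
lemma isFrobeniusFixedField [Fintype Fq] : IsFrobeniusFixedField Fq O L k where
  exists_algebraMap_eq _ hx := h.exists_algebraMap_eq_of_partialFrob_eq hx
  injective := h.algebraMap_completedTensor_injective

end IsUniformizedCompletion

end

noncomputable section

attribute [local instance 10] tensorAlgebra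

/-! ## Frobenius equivariant pairings -/

section Pairings

variable {Fq A O L K k M : Type*} [Field Fq] [Fintype Fq] [CommRing A] [CommRing O] [IsDomain O]
variable [IsDiscreteValuationRing O] [Algebra A O] [Algebra Fq A] [Algebra Fq O]
variable [IsScalarTower Fq A O] [Field L] [Algebra O L] [IsFractionRing O L] [Algebra Fq L]
variable [IsScalarTower Fq O L] [Field K] [Algebra Fq K] [Field k] [Algebra Fq k] [Algebra K k]
variable [IsScalarTower Fq K k] [AddCommGroup M] [Module (A ⊗[Fq] K) M]

/-- A pairing of an `A ⊗ K`-module `M` with `L / O` with values in an extension `k` of `K` that is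
`A`-balanced, `K`-linear in `M`, and equivariant under the Frobenius. -/
structure IsFrobeniusPairing (τ : M →ₛₗ[(coeffMap A (frob Fq K)).toRingHom] M)
    (β : M →+ (FractionQuotient O L →ₗ[Fq] k)) : Prop where
  apply_smul : ∀ (a : A) (ξ : K) (m : M) (y : FractionQuotient O L),
    β ((a ⊗ₜ[Fq] ξ) • m) y = algebraMap K k ξ * β m (algebraMap A O a • y)
  apply_tau : ∀ m y, β (τ m) y = β m y ^ Fintype.card Fq

variable {p : Ideal A} {π : A} (h : IsUniformizedCompletion p O π)
variable {l : FractionQuotient O L →ₗ[Fq] Fq} (hl : IsNondegenerateFunctional l)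
variable {τ : M →ₛₗ[(coeffMap A (frob Fq K)).toRingHom] M}

namespace IsFrobeniusPairing

variable {β : M →+ (FractionQuotient O L →ₗ[Fq] k)} (hβ : IsFrobeniusPairing τ β)

include hβ h hl in
-- By duality each `β m` is an element of `O ⊗̂ k`, unique for the given `l`; uniqueness turns the
-- balancedness of `β` into semilinearity.
lemma exists_intFunctional : ∃ e : M →ₛₗ[algebraMap (A ⊗[Fq] K) (CompletedTensorInt Fq O k)]
    CompletedTensorInt Fq O k, ∀ m y, completedPairing l (e m) y = β m y := by
  choose e he using fun m => exists_completedPairing_eq hl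
    (fun ϖ hϖ n => h.finite_of_irreducible hϖ n) (β m)
  have hadd : ∀ m m', e (m + m') = e m + e m' := fun m m' =>
    eq_of_completedPairing_eq hl fun y => by
      rw [completedPairing_add_left, he, he, he, map_add, LinearMap.add_apply]
  have hsmul : ∀ (r : A ⊗[Fq] K) (m : M),
      e (r • m) = algebraMap (A ⊗[Fq] K) (CompletedTensorInt Fq O k) r * e m := by
    intro r m
    induction r using TensorProduct.induction_on with
    | zero =>
      have h0 := hadd 0 0
      rw [add_zero, left_eq_add] at h0
      rw [zero_smul, map_zero, zero_mul, h0]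
    | add x y hx hy => rw [add_smul, hadd, map_add, add_mul, hx, hy]
    | tmul a ξ =>
      refine eq_of_completedPairing_eq hl fun y => ?_
      have h1 : algebraMap (A ⊗[Fq] K) (CompletedTensorInt Fq O k) (a ⊗ₜ ξ) =
        algebraMap (O ⊗[Fq] k) _ (algebraMap A O a ⊗ₜ algebraMap K k ξ) := rfl
      rw [h1, completedPairing_algebraMap_tmul_mul, he, he, hβ.apply_smul]
  exact ⟨{ toFun := e, map_add' := hadd, map_smul' := hsmul }, he⟩

/-- The functional with values in `O ⊗̂ k` that corresponds to a Frobenius equivariant pairing. -/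
def intFunctional : M →ₛₗ[algebraMap (A ⊗[Fq] K) (CompletedTensorInt Fq O k)]
    CompletedTensorInt Fq O k := (hβ.exists_intFunctional h hl).choose

lemma completedPairing_intFunctional (m : M) (y : FractionQuotient O L) :
    completedPairing l (hβ.intFunctional h hl m) y = β m y :=
  (hβ.exists_intFunctional h hl).choose_spec m y

lemma intFunctional_tau (m : M) : hβ.intFunctional h hl (τ m) =
    CompletedTensor.mapInt Fq O (frob Fq k) (hβ.intFunctional h hl m) := by
  refine eq_of_completedPairing_eq hl fun y => ?_
  rw [completedPairing_mapInt, completedPairing_intFunctional, completedPairing_intFunctional,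
    hβ.apply_tau]
  rfl

end IsFrobeniusPairing

variable (Fq A O L K k) in
lemma ofInt_algebraMap_tensorProduct (x : A ⊗[Fq] K) :
    CompletedTensor.ofInt Fq O L k (algebraMap (A ⊗[Fq] K) (CompletedTensorInt Fq O k) x) =
      algebraMap (CompletedTensor Fq O L K) (CompletedTensor Fq O L k)
        (algebraMap (A ⊗[Fq] K) (CompletedTensor Fq O L K) x) := by
  refine Eq.trans ?_
    (CompletedTensor.map_coeffHom Fq O L A (IsScalarTower.toAlgHom Fq K k) x).symm
  induction x using TensorProduct.induction_on with
  | zero => simp only [map_zero]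
  | add x y hx hy => simp only [map_add, hx, hy]
  | tmul a ξ => rfl

variable (O L τ) in
/-- The base change of `τ` to `L ⊗̂ K`. -/
def isocrystalTau : CompletedTensor Fq O L K ⊗[A ⊗[Fq] K] M
    →ₛₗ[(partialFrob Fq O L K).toRingHom] CompletedTensor Fq O L K ⊗[A ⊗[Fq] K] M :=
  semilinearBaseChange _ (CompletedTensor.map_coeffHom Fq O L A (frob Fq K)) τ

namespace IsFrobeniusPairing

variable {β : M →+ (FractionQuotient O L →ₗ[Fq] k)} (hβ : IsFrobeniusPairing τ β)

/-- The functional with values in `L ⊗̂ k` that corresponds to a Frobenius equivariant pairing. -/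
def ratFunctional : CompletedTensor Fq O L K ⊗[A ⊗[Fq] K] M
    →ₛₗ[algebraMap (CompletedTensor Fq O L K) (CompletedTensor Fq O L k)]
      CompletedTensor Fq O L k :=
  semilinearLift (ρ := (CompletedTensor.ofInt Fq O L k).comp
      (algebraMap (A ⊗[Fq] K) (CompletedTensorInt Fq O k))) _
    (fun x => (ofInt_algebraMap_tensorProduct Fq A O L K k x).symm)
    { toFun := fun m => CompletedTensor.ofInt Fq O L k (hβ.intFunctional h hl m)
      map_add' := fun m m' => by rw [map_add, map_add]
      map_smul' := fun r m => by rw [map_smulₛₗ, smul_eq_mul, map_mul]; rfl }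

lemma ratFunctional_tmul (e : CompletedTensor Fq O L K) (m : M) :
    hβ.ratFunctional h hl (e ⊗ₜ m) =
      algebraMap (CompletedTensor Fq O L K) (CompletedTensor Fq O L k) e *
        CompletedTensor.ofInt Fq O L k (hβ.intFunctional h hl m) := rfl

lemma ratFunctional_tau (n : CompletedTensor Fq O L K ⊗[A ⊗[Fq] K] M) :
    hβ.ratFunctional h hl (isocrystalTau O L τ n) =
      partialFrob Fq O L k (hβ.ratFunctional h hl n) := by
  induction n using TensorProduct.induction_on with
  | zero => simp only [map_zero]
  | add y z hy hz => simp only [map_add, hy, hz]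
  | tmul e m =>
    rw [isocrystalTau, semilinearBaseChange_tmul, ratFunctional_tmul, ratFunctional_tmul, map_mul,
      intFunctional_tau, CompletedTensor.map_ofInt]
    congr 1
    exact partialFrob_comm (IsScalarTower.toAlgHom Fq K k) e

/-- The functional on the slope zero Tate module defined by a Frobenius equivariant pairing. -/
def functional : Module.Dual L (slopeZeroTate k (isocrystalTau O L τ)) :=
  slopeZeroTate.functional h.isFrobeniusFixedField (hβ.ratFunctional h hl)
    (hβ.ratFunctional_tau h hl)

end IsFrobeniusPairing

/-! ### Comparison with the base change to `O ⊗̂ k` -/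

variable (Fq A O L K k M) in
/-- The map `e ⊗ m ↦ e ⊗ (1 ⊗ m)` from the base change of `M` to `O ⊗̂ k` to that to `L ⊗̂ k`. -/
def CompletedModule.toRational : CompletedModule Fq A O k K M →ₛₗ[CompletedTensor.ofInt Fq O L k]
    CompletedTensor Fq O L k ⊗[CompletedTensor Fq O L K]
      (CompletedTensor Fq O L K ⊗[A ⊗[Fq] K] M) :=
  letI := (CompletedTensor.ofInt Fq O L k).toAlgebra
  (show CompletedTensorInt Fq O k ⊗[A ⊗[Fq] K] M →ₛₗ[CompletedTensor.ofInt Fq O L k] _ from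
    twoStepBaseChange (ofInt_algebraMap_tensorProduct Fq A O L K k)).comp
    (CompletedModule.toTensor Fq A O k K M).toLinearMap

namespace CompletedModule

lemma toRational_tmul (e : CompletedTensorInt Fq O k) (m : M) :
    toRational Fq A O L K k M (tmul e m) = CompletedTensor.ofInt Fq O L k e ⊗ₜ
      ((1 : CompletedTensor Fq O L K) ⊗ₜ m) := rfl

lemma toRational_smul (b : O) (x : CompletedModule Fq A O k K M) :
    toRational Fq A O L K k M (b • x) = algebraMap O L b • toRational Fq A O L K k M x := by
  rw [smul_def, map_smulₛₗ, CompletedTensor.ofInt_algebraMap, algebraMap_smul]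

variable (O k τ) in
/-- The base change of `τ` to `O ⊗̂ k`. -/
def tau : CompletedModule Fq A O k K M →ₛₗ[(frob Fq k).toRingHom] CompletedModule Fq A O k K M where
  toFun x := (toTensor Fq A O k K M).symm
    (semilinearBaseChange (CompletedTensor.mapInt Fq O (frob Fq k)).toRingHom (fun x => by
      change CompletedTensor.mapInt Fq O (frob Fq k) _ = _
      induction x using TensorProduct.induction_on with
      | zero => simp only [map_zero]
      | add x y hx hy => simp only [map_add, hx, hy]
      | tmul a ξ =>
        change CompletedTensor.mapInt Fq O (frob Fq k) (algebraMap (O ⊗[Fq] k) _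
          (algebraMap A O a ⊗ₜ algebraMap K k ξ)) = algebraMap (O ⊗[Fq] k) _
          (algebraMap A O a ⊗ₜ algebraMap K k (frob Fq K ξ))
        rw [CompletedTensor.mapInt_algebraMap, Algebra.TensorProduct.map_tmul]
        congr 2
        exact (map_pow (algebraMap K k) ξ (Fintype.card Fq)).symm) τ (toTensor Fq A O k K M x))
  map_add' x y := by rw [map_add, map_add, map_add]
  map_smul' c x := by
    rw [const_smul_def, map_smul, map_smulₛₗ, map_smul, const_smul_def]
    congr 1

lemma tau_tmul (e : CompletedTensorInt Fq O k) (m : M) : tau O k τ (tmul e m) =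
    tmul (CompletedTensor.mapInt Fq O (frob Fq k) e) (τ m) := rfl

lemma tau_smul (b : O) (x : CompletedModule Fq A O k K M) :
    tau O k τ (b • x) = b • tau O k τ x := by
  induction x using CompletedModule.induction_on with
  | zero => simp only [smul_zero, map_zero]
  | add x y hx hy => simp only [smul_add, map_add, hx, hy]
  | tmul e m =>
    rw [smul_def, smul_tmul, tau_tmul, tau_tmul, smul_def, smul_tmul, map_mul, AlgHom.commutes]

lemma toRational_tau (x : CompletedModule Fq A O k K M) :
    toRational Fq A O L K k M (tau O k τ x) =
      tauClosure k (isocrystalTau O L τ) (toRational Fq A O L K k M x) := by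
  induction x using CompletedModule.induction_on with
  | zero => simp only [map_zero]
  | add x y hx hy => simp only [map_add, hx, hy]
  | tmul e m =>
    rw [tau_tmul, toRational_tmul, toRational_tmul, tauClosure, semilinearBaseChange_tmul,
      isocrystalTau, semilinearBaseChange_tmul, ← CompletedTensor.map_ofInt]
    congr 2
    exact (map_one (partialFrob Fq O L K)).symm

include h in
-- The kernel of a localization map is torsion, here `π`-power torsion. With `exists_toRational_eq`
-- this makes the base change to `O ⊗̂ k` a lattice in the rational one.
lemma toRational_injective
    (hX : ∀ x : CompletedModule Fq A O k K M, algebraMap A O π • x = 0 → x = 0) :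
    Function.Injective (toRational Fq A O L K k M) := by
  let := (CompletedTensor.ofInt Fq O L k).toAlgebra
  have := IsUniformizedCompletion.isLocalization_completedTensor Fq O L k
  rw [injective_iff_map_eq_zero]
  intro x hx
  obtain ⟨_, ⟨b, hb, rfl⟩, hs⟩ := (twoStepBaseChange_localization (M := M)
    (Algebra.algebraMapSubmonoid (CompletedTensorInt Fq O k) (nonZeroDivisors O))
    (ofInt_algebraMap_tensorProduct Fq A O L K k)).1 (toTensor Fq A O k K M x) hx
  obtain ⟨u, n, hu⟩ := h.exists_isUnit_mul_pow_eq (nonZeroDivisors.ne_zero hb)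
  refine h.pow_smul_eq_zero_imp hX n ?_
  have hs' : b • x = 0 := hs
  rw [← hu, mul_smul, hs', smul_zero]

include h in
lemma exists_toRational_eq (t : CompletedTensor Fq O L k ⊗[CompletedTensor Fq O L K]
      (CompletedTensor Fq O L K ⊗[A ⊗[Fq] K] M)) :
    ∃ (n : ℕ) (x : CompletedModule Fq A O k K M),
      toRational Fq A O L K k M x = algebraMap O L (algebraMap A O π ^ n) • t := by
  let := (CompletedTensor.ofInt Fq O L k).toAlgebra
  have := IsUniformizedCompletion.isLocalization_completedTensor Fq O L k
  obtain ⟨_, ⟨b, hb, rfl⟩, x, hs⟩ := (twoStepBaseChange_localization (M := M)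
    (Algebra.algebraMapSubmonoid (CompletedTensorInt Fq O k) (nonZeroDivisors O))
    (ofInt_algebraMap_tensorProduct Fq A O L K k)).2 t
  obtain ⟨u, n, hu⟩ := h.exists_isUnit_mul_pow_eq (nonZeroDivisors.ne_zero hb)
  refine ⟨n, u • (toTensor Fq A O k K M).symm x, ?_⟩
  rw [toRational_smul, ← hu, map_mul, mul_smul]
  congr 1
  refine Eq.trans hs.symm ?_
  rw [← algebraMap_smul (CompletedTensor Fq O L k) (algebraMap O L b) t,
    ← CompletedTensor.ofInt_algebraMap]
  rfl

end CompletedModule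

end Pairings

end

noncomputable section

attribute [local instance 10] tensorAlgebra

/-! ### Injectivity: a pairing with zero functional is zero. -/

section Pairings

variable {Fq A O L K k M : Type*} [Field Fq] [Fintype Fq] [CommRing A] [CommRing O] [IsDomain O]
variable [IsDiscreteValuationRing O] [Algebra A O] [Algebra Fq A] [Algebra Fq O]
variable [IsScalarTower Fq A O] [Field L] [Algebra O L] [IsFractionRing O L] [Algebra Fq L]
variable [IsScalarTower Fq O L] [Field K] [Algebra Fq K] [Field k] [Algebra Fq k] [Algebra K k]
variable [IsScalarTower Fq K k] [AddCommGroup M] [Module (A ⊗[Fq] K) M]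
variable {p : Ideal A} {π : A} (h : IsUniformizedCompletion p O π)
variable {l : FractionQuotient O L →ₗ[Fq] Fq} (hl : IsNondegenerateFunctional l)
variable {τ : M →ₛₗ[(coeffMap A (frob Fq K)).toRingHom] M}

lemma completedPairing_zero_left (y : FractionQuotient O L) :
    completedPairing l (0 : CompletedTensorInt Fq O k) y = 0 := by
  have h0 := completedPairing_algebraMap (K := k) (l := l) (0 : O) y
  rwa [map_zero, zero_smul, map_zero, map_zero] at h0

lemma completedPairing_constHom_mul (c : k) (e : CompletedTensorInt Fq O k)
    (y : FractionQuotient O L) :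
    completedPairing l (CompletedModule.constHom Fq O k c * e) y = c * completedPairing l e y := by
  have h0 := completedPairing_algebraMap_tmul_mul l (1 : O) c e y
  rwa [one_smul] at h0

namespace CompletedModule

/-- The extension to the base change to `O ⊗̂ k` of a functional with values in `O ⊗̂ k`. -/
def extend (f : M →ₛₗ[algebraMap (A ⊗[Fq] K) (CompletedTensorInt Fq O k)]
      CompletedTensorInt Fq O k) :
    CompletedModule Fq A O k K M →ₗ[CompletedTensorInt Fq O k] CompletedTensorInt Fq O k :=
  (semilinearLift (RingHom.id _) (fun _ => rfl) f).comp (toTensor Fq A O k K M).toLinearMap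

variable (f : M →ₛₗ[algebraMap (A ⊗[Fq] K) (CompletedTensorInt Fq O k)]
      CompletedTensorInt Fq O k)

lemma extend_tmul (e : CompletedTensorInt Fq O k) (m : M) : extend f (tmul e m) = e * f m := rfl

lemma extend_tau (hf : ∀ m, f (τ m) = CompletedTensor.mapInt Fq O (frob Fq k) (f m))
    (x : CompletedModule Fq A O k K M) :
    extend f (tau O k τ x) = CompletedTensor.mapInt Fq O (frob Fq k) (extend f x) := by
  induction x using CompletedModule.induction_on with
  | zero => simp only [map_zero]
  | add x y hx hy => simp only [map_add, hx, hy]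
  | tmul e m => rw [tau_tmul, extend_tmul, extend_tmul, hf, map_mul]

/-- The functional with values in `k` defined by one with values in `O ⊗̂ k` and an element
of `L / O`. -/
def pairingFunctional (l : FractionQuotient O L →ₗ[Fq] Fq) (y : FractionQuotient O L) :
    CompletedModule Fq A O k K M →ₗ[k] k where
  toFun x := completedPairing l (extend f x) y
  map_add' x x' := by rw [map_add, completedPairing_add_left]
  map_smul' c x := by
    rw [const_smul_def, map_smul, smul_eq_mul, completedPairing_constHom_mul]
    rfl

lemma pairingFunctional_apply (y : FractionQuotient O L) (x : CompletedModule Fq A O k K M) :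
    pairingFunctional f l y x = completedPairing l (extend f x) y := rfl

lemma pairingFunctional_smul (y : FractionQuotient O L) (b : O)
    (x : CompletedModule Fq A O k K M) :
    pairingFunctional f l y (b • x) = pairingFunctional f l (b • y) x := by
  rw [pairingFunctional_apply, pairingFunctional_apply, ← completedPairing_smul, smul_def, map_smul,
    algebraMap_smul]

lemma pairingFunctional_zero (x : CompletedModule Fq A O k K M) :
    pairingFunctional f l (0 : FractionQuotient O L) x = 0 :=
  (completedPairingRight l (extend f x)).map_zero

end CompletedModule

namespace IsFrobeniusPairing

open CompletedModule

variable {β : M →+ (FractionQuotient O L →ₗ[Fq] k)} (hβ : IsFrobeniusPairing τ β)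

lemma extend_toRational (x : CompletedModule Fq A O k K M) :
    slopeZeroTate.extend (hβ.ratFunctional h hl) (toRational Fq A O L K k M x) =
      CompletedTensor.ofInt Fq O L k (extend (hβ.intFunctional h hl) x) := by
  induction x using CompletedModule.induction_on with
  | zero => simp only [map_zero]
  | add x y hx hy => simp only [map_add, hx, hy]
  | tmul e m =>
    rw [toRational_tmul, slopeZeroTate.extend_tmul, ratFunctional_tmul, extend_tmul, map_one,
      one_mul, map_mul]

lemma pairingFunctional_tau (y : FractionQuotient O L) (x : CompletedModule Fq A O k K M) :
    pairingFunctional (hβ.intFunctional h hl) l y (tau O k τ x) =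
      pairingFunctional (hβ.intFunctional h hl) l y x ^ Fintype.card Fq := by
  rw [pairingFunctional_apply, extend_tau _ (hβ.intFunctional_tau h hl), completedPairing_mapInt]
  rfl

lemma algebraMap_functional_toRational {x : CompletedModule Fq A O k K M}
    (hx : toRational Fq A O L K k M x ∈ slopeZeroTate k (isocrystalTau O L τ)) :
    algebraMap L (CompletedTensor Fq O L k) (hβ.functional h hl ⟨_, hx⟩) =
      CompletedTensor.ofInt Fq O L k (extend (hβ.intFunctional h hl) x) := by
  rw [functional, slopeZeroTate.algebraMap_functional, extend_toRational]

end IsFrobeniusPairing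

namespace CompletedModule

lemma toRational_mem {x : CompletedModule Fq A O k K M} (hx : tau O k τ x = x) :
    toRational Fq A O L K k M x ∈ slopeZeroTate k (isocrystalTau O L τ) := by
  change tauClosure k (isocrystalTau O L τ) _ = _
  rw [← toRational_tau, hx]

include h in
-- After multiplication by a power of `π` an invariant vector comes from the lattice, and its
-- preimage is fixed because the lattice embeds compatibly with `τ`.
lemma exists_toRational_eq_of_mem
    (hX : IsFrobeniusLattice Fq k (X := CompletedModule Fq A O k K M) (algebraMap A O π))
    (t : slopeZeroTate k (isocrystalTau O L τ)) :
    ∃ (n : ℕ) (x : CompletedModule Fq A O k K M) (hx : tau O k τ x = x),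
      (⟨_, toRational_mem hx⟩ : slopeZeroTate k (isocrystalTau O L τ)) =
        algebraMap O L (algebraMap A O π ^ n) • t := by
  obtain ⟨n, x, hx⟩ := exists_toRational_eq h t.1
  refine ⟨n, x, toRational_injective (L := L) h hX.eq_zero_of_smul ?_, Subtype.ext hx⟩
  rw [toRational_tau, hx]
  exact (algebraMap O L (algebraMap A O π ^ n) • t).2

/-- The fixed vectors of `τ` in the base change to `O ⊗̂ k`. -/
abbrev fixed (O k : Type*) [CommRing O] [IsDomain O] [IsDiscreteValuationRing O] [Algebra A O]
    [Algebra Fq O] [IsScalarTower Fq A O] [Field k] [Algebra Fq k] [Algebra K k]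
    [IsScalarTower Fq K k] (τ : M →ₛₗ[(coeffMap A (frob Fq K)).toRingHom] M) :
    Submodule O (CompletedModule Fq A O k K M) :=
  fixedSubmodule O (tau O k τ).toAddMonoidHom tau_smul

end CompletedModule

namespace IsFrobeniusPairing

open CompletedModule

variable {β : M →+ (FractionQuotient O L →ₗ[Fq] k)} (hβ : IsFrobeniusPairing τ β)
variable [IsAlgClosed k]

/-- For fixed `y`, pairing with `y` gives an equivariant functional on the lattice that factors
modulo some `π ^ n`. If the functional on `T_0` is zero, this one kills the fixed vectors, hence
everything, in particular `1 ⊗ m`. -/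
theorem eq_zero_of_functional_eq_zero
    (hX : IsFrobeniusLattice Fq k (X := CompletedModule Fq A O k K M) (algebraMap A O π))
    (h0 : hβ.functional h hl = 0) : β = 0 := by
  refine AddMonoidHom.ext fun m => LinearMap.ext fun y => ?_
  obtain ⟨n, hn⟩ := FractionQuotient.exists_pow_smul_eq_zero h.irreducible y
  have h1 := hX.functional_eq_zero (fun _ => rfl) (tau O k τ) tau_smul n
    (pairingFunctional (hβ.intFunctional h hl) l y) (hβ.pairingFunctional_tau h hl y)
    (fun x => by rw [pairingFunctional_smul, hn, pairingFunctional_zero])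
    (fun x hx => by
      have h2 := hβ.algebraMap_functional_toRational h hl (toRational_mem hx)
      rw [h0, LinearMap.zero_apply, map_zero, eq_comm, ← map_zero (CompletedTensor.ofInt Fq O L k),
        h.ofInt_injective.eq_iff] at h2
      rw [pairingFunctional_apply, h2, completedPairing_zero_left])
  have h2 := LinearMap.congr_fun h1 (tmul 1 m)
  rwa [pairingFunctional_apply, extend_tmul, one_mul, completedPairing_intFunctional] at h2

end IsFrobeniusPairing

end Pairings

end

noncomputable section

attribute [local instance 10] tensorAlgebra

/-! ### Surjectivity: functionals on the invariants come from pairings, up to a power of the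
uniformizer. -/

section Pairings

variable {Fq A O L K k M : Type*} [Field Fq] [Fintype Fq] [CommRing A] [CommRing O] [IsDomain O]
variable [IsDiscreteValuationRing O] [Algebra A O] [Algebra Fq A] [Algebra Fq O]
variable [IsScalarTower Fq A O] [Field L] [Algebra O L] [IsFractionRing O L] [Algebra Fq L]
variable [IsScalarTower Fq O L] [Field K] [Algebra Fq K] [Field k] [Algebra Fq k] [Algebra K k]
variable [IsScalarTower Fq K k] [AddCommGroup M] [Module (A ⊗[Fq] K) M]
variable {p : Ideal A} {π : A} (h : IsUniformizedCompletion p O π)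
variable {l : FractionQuotient O L →ₗ[Fq] Fq} (hl : IsNondegenerateFunctional l)
variable {τ : M →ₛₗ[(coeffMap A (frob Fq K)).toRingHom] M}

namespace CompletedModule

/-- An equivariant functional with values in `k` on the base change to `O ⊗̂ k` that extends
the functional on the fixed vectors defined by `g`, `l` and an element of `L / O`. -/
structure IsFrobeniusExtension (π : A) (l : FractionQuotient O L →ₗ[Fq] Fq)
    (g : fixed O k τ →ₗ[O] O) (y : FractionQuotient O L)
    (u : CompletedModule Fq A O k K M →ₗ[k] k) : Prop where
  map_tau : ∀ x, u (tau O k τ x) = frob Fq k (u x)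
  exists_map_pow_smul : ∃ n : ℕ, ∀ x, u (algebraMap A O π ^ n • x) = 0
  eq_algebraMap : ∀ w, u w.1 = algebraMap Fq k (l (g w • y))

namespace IsFrobeniusExtension

variable {g : fixed O k τ →ₗ[O] O} {y z : FractionQuotient O L}
variable {u v : CompletedModule Fq A O k K M →ₗ[k] k}

lemma add (hu : IsFrobeniusExtension π l g y u) (hv : IsFrobeniusExtension π l g z v) :
    IsFrobeniusExtension π l g (y + z) (u + v) where
  map_tau x := by
    rw [LinearMap.add_apply, LinearMap.add_apply, hu.map_tau, hv.map_tau, map_add]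
  exists_map_pow_smul := by
    obtain ⟨m, hm⟩ := hu.exists_map_pow_smul
    obtain ⟨n, hn⟩ := hv.exists_map_pow_smul
    refine ⟨m + n, fun x => ?_⟩
    rw [LinearMap.add_apply, pow_add, mul_smul, hm, zero_add, smul_comm, hn]
  eq_algebraMap w := by
    rw [LinearMap.add_apply, hu.eq_algebraMap, hv.eq_algebraMap, smul_add, map_add, map_add]

lemma smul (hu : IsFrobeniusExtension π l g y u) (b : O) :
    IsFrobeniusExtension π l g (b • y) (u.comp (DistribSMul.toLinearMap k _ b)) where
  map_tau x := by
    change u (b • tau O k τ x) = frob Fq k (u (b • x))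
    rw [← tau_smul, hu.map_tau]
  exists_map_pow_smul := by
    obtain ⟨m, hm⟩ := hu.exists_map_pow_smul
    refine ⟨m, fun x => ?_⟩
    change u (b • algebraMap A O π ^ m • x) = 0
    rw [smul_comm, hm]
  eq_algebraMap w := by
    change u (b • w).1 = _
    rw [hu.eq_algebraMap, g.map_smul, smul_eq_mul, mul_comm, mul_smul]

variable (hX : IsFrobeniusLattice Fq k (X := CompletedModule Fq A O k K M) (algebraMap A O π))
variable [IsAlgClosed k]

include hX in
-- The difference is equivariant, kills a power of `π` and vanishes on fixed vectors. Uniqueness is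
-- what makes the extensions for varying `y` fit together linearly.
lemma eq (hu : IsFrobeniusExtension π l g y u) (hv : IsFrobeniusExtension π l g y v) : u = v := by
  obtain ⟨m, hm⟩ := hu.exists_map_pow_smul
  obtain ⟨n, hn⟩ := hv.exists_map_pow_smul
  refine sub_eq_zero.mp (hX.functional_eq_zero (fun _ => rfl) (tau O k τ) tau_smul (m + n)
    (u - v) (fun x => ?_) (fun x => ?_) (fun x hx => ?_))
  · change u (tau O k τ x) - v (tau O k τ x) = frob Fq k (u x - v x)
    rw [hu.map_tau, hv.map_tau, map_sub]
  · rw [LinearMap.sub_apply, pow_add, mul_smul, hm, zero_sub, smul_comm, hn, neg_zero]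
  · rw [LinearMap.sub_apply, hu.eq_algebraMap ⟨x, hx⟩, hv.eq_algebraMap ⟨x, hx⟩, sub_self]

include h hX in
lemma exists_isFrobeniusExtension (l : FractionQuotient O L →ₗ[Fq] Fq) (g : fixed O k τ →ₗ[O] O)
    (y : FractionQuotient O L) : ∃ u, IsFrobeniusExtension π l g y u := by
  obtain ⟨n, hn⟩ := FractionQuotient.exists_pow_smul_eq_zero h.irreducible y
  obtain ⟨u, h1, h2, h3⟩ := hX.exists_functional (fun _ => rfl) (tau O k τ) tau_smul n
    (l.comp (((LinearMap.toSpanSingleton O _ y).comp g).restrictScalars Fq)) (fun w => by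
      change l (g (algebraMap A O π ^ n • w) • y) = 0
      rw [g.map_smul, smul_eq_mul, mul_comm, mul_smul, hn, smul_zero, map_zero])
  exact ⟨u, h1, ⟨n, h2⟩, h3⟩

end IsFrobeniusExtension

include h in
/-- `tmul e m` is determined modulo `π ^ n` by `e` modulo `π ^ n`. -/
lemma exists_tmul_eq_add (n : ℕ) (e : CompletedTensorInt Fq O k) (m : M) :
    ∃ (c : O ⊗[Fq] k) (x : CompletedModule Fq A O k K M),
      tmul e m = tmul (algebraMap (O ⊗[Fq] k) _ c) m + algebraMap A O π ^ n • x := by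
  obtain ⟨c, hc⟩ := exists_evalₐ_eq_mk n e
  obtain ⟨e', he'⟩ := h.exists_pow_smul_eq_of_evalₐ_eq_zero
    (e := e - algebraMap (O ⊗[Fq] k) _ c) (n := n) (by
      rw [map_sub, hc, AlgHom.commutes, sub_eq_zero]; rfl)
  refine ⟨c, tmul e' m, ?_⟩
  rw [smul_def, smul_tmul, ← Algebra.smul_def, he']
  conv_lhs => rw [← add_sub_cancel (algebraMap (O ⊗[Fq] k) _ c) e]
  exact TensorProduct.add_tmul _ _ _

lemma tmul_algebraMap_tmul (b : O) (ξ : k) (m : M) :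
    (tmul (algebraMap (O ⊗[Fq] k) _ (b ⊗ₜ ξ)) m : CompletedModule Fq A O k K M) =
      ξ • b • tmul 1 m := by
  rw [const_smul_def, smul_def, smul_tmul, smul_tmul, mul_one]
  congr 1
  change _ = algebraMap (O ⊗[Fq] k) _ (1 ⊗ₜ ξ) * algebraMap (O ⊗[Fq] k) _ (b ⊗ₜ 1)
  rw [← map_mul, Algebra.TensorProduct.tmul_mul_tmul, one_mul, mul_one]

lemma tmul_add (e : CompletedTensorInt Fq O k) (m m' : M) :
    (tmul e (m + m') : CompletedModule Fq A O k K M) = tmul e m + tmul e m' :=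
  TensorProduct.tmul_add _ _ _

lemma add_tmul (e e' : CompletedTensorInt Fq O k) (m : M) :
    (tmul (e + e') m : CompletedModule Fq A O k K M) = tmul e m + tmul e' m :=
  TensorProduct.add_tmul _ _ _

lemma zero_tmul (m : M) : (tmul 0 m : CompletedModule Fq A O k K M) = 0 :=
  TensorProduct.zero_tmul _ _

end CompletedModule

namespace IsFrobeniusPairing

open CompletedModule

variable (hX : IsFrobeniusLattice Fq k (X := CompletedModule Fq A O k K M) (algebraMap A O π))
variable [IsAlgClosed k]

include h hl hX in
/-- An integral functional on the fixed vectors comes from a Frobenius equivariant pairing. -/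
theorem exists_extend_eq (g : fixed O k τ →ₗ[O] O) :
    ∃ (β : M →+ (FractionQuotient O L →ₗ[Fq] k)) (hβ : IsFrobeniusPairing τ β),
      ∀ w : fixed O k τ, extend (hβ.intFunctional h hl) w.1 = algebraMap O _ (g w) := by
  choose u hu using IsFrobeniusExtension.exists_isFrobeniusExtension h hX l g
  -- The `u y` are chosen separately; uniqueness makes them additive and compatible with `O`, so
  -- that `(m, y) ↦ u y (1 ⊗ m)` is a pairing.
  have hadd : ∀ y z, u (y + z) = u y + u z := fun y z =>
    (hu (y + z)).eq hX ((hu y).add (hu z))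
  have hsmul : ∀ (b : O) y x, u (b • y) x = u y (b • x) := fun b y x =>
    LinearMap.congr_fun ((hu (b • y)).eq hX ((hu y).smul b)) x
  let β : M →+ (FractionQuotient O L →ₗ[Fq] k) :=
    { toFun := fun m =>
        { toFun := fun y => u y (tmul 1 m)
          map_add' := fun y z => by rw [hadd, LinearMap.add_apply]
          map_smul' := fun c y => by
            rw [← algebraMap_smul O c y, hsmul, algebraMap_smul, ← algebraMap_smul k c, map_smul,
              RingHom.id_apply, algebraMap_smul] }
      map_zero' := LinearMap.ext fun y => by
        have h0 : (tmul 1 (0 : M) : CompletedModule Fq A O k K M) = 0 :=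
          TensorProduct.tmul_zero _ _
        change u y (tmul 1 0) = 0
        rw [h0, map_zero]
      map_add' := fun m m' => LinearMap.ext fun y => by
        change u y (tmul 1 (m + m')) = u y (tmul 1 m) + u y (tmul 1 m')
        rw [tmul_add, map_add] }
  have hβ : IsFrobeniusPairing τ β :=
    { apply_smul := fun a ξ m y => by
        change u y (tmul 1 ((a ⊗ₜ[Fq] ξ) • m)) =
          algebraMap K k ξ * u (algebraMap A O a • y) (tmul 1 m)
        rw [tmul_smul, tensorAlgebra_algebraMap_tmul, mul_one, tmul_algebraMap_tmul, map_smul,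
          hsmul, smul_eq_mul]
      apply_tau := fun m y => by
        change u y (tmul 1 (τ m)) = u y (tmul 1 m) ^ Fintype.card Fq
        have h1 : tau O k τ (tmul 1 m) = tmul 1 (τ m) := by
          rw [tau_tmul, map_one]
        rw [← h1, (hu y).map_tau]
        rfl }
  refine ⟨β, hβ, fun w => ?_⟩
  -- Both sides kill `π ^ n X` when `π ^ n` kills `y`, so it suffices to compare them on `ξ b (1 ⊗
  -- m)` with `b ∈ O` and `ξ ∈ k`, where they agree by construction of `β`.
  have key : ∀ x y, pairingFunctional (hβ.intFunctional h hl) l y x = u y x := by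
    intro x y
    induction x using CompletedModule.induction_on with
    | zero => rw [map_zero, map_zero]
    | add x x' hx hx' => rw [map_add, map_add, hx, hx']
    | tmul e m =>
      obtain ⟨n, hn⟩ := FractionQuotient.exists_pow_smul_eq_zero h.irreducible y
      obtain ⟨c, x, hx⟩ := exists_tmul_eq_add (K := K) h n e m
      have h1 : u y (algebraMap A O π ^ n • x) = 0 := by
        rw [← hsmul, hn]
        have h2 := hadd 0 0
        rw [add_zero, left_eq_add] at h2
        rw [h2, LinearMap.zero_apply]
      rw [hx, map_add, map_add, h1, pairingFunctional_smul, hn, pairingFunctional_zero]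
      congr 1
      clear hx h1
      induction c using TensorProduct.induction_on with
      | zero => rw [map_zero, zero_tmul, map_zero, map_zero]
      | add c d hc hd => rw [map_add, add_tmul, map_add, map_add, hc, hd]
      | tmul b ξ =>
        rw [tmul_algebraMap_tmul, LinearMap.map_smul _ ξ, LinearMap.map_smul _ ξ,
          pairingFunctional_smul,
          pairingFunctional_apply, extend_tmul, one_mul, completedPairing_intFunctional, ← hsmul]
        rfl
  refine eq_of_completedPairing_eq hl fun y => ?_
  rw [completedPairing_algebraMap, ← (hu y).eq_algebraMap w, ← key]
  rfl

include hX in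
/-- A multiple of every functional on the slope zero Tate module comes from a Frobenius equivariant
pairing. -/
theorem exists_functional_eq (g : Module.Dual L (slopeZeroTate k (isocrystalTau O L τ))) :
    ∃ (n : ℕ) (β : M →+ (FractionQuotient O L →ₗ[Fq] k)) (hβ : IsFrobeniusPairing τ β),
      hβ.functional h hl = algebraMap O L (algebraMap A O π ^ n) • g := by
  let G : fixed O k τ →ₗ[O] L :=
    { toFun := fun w => g ⟨_, toRational_mem w.2⟩
      map_add' := fun w w' => by
        rw [← map_add]
        exact congrArg g (Subtype.ext (map_add (toRational Fq A O L K k M) w.1 w'.1))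
      map_smul' := fun b w => by
        rw [RingHom.id_apply, Algebra.smul_def, ← smul_eq_mul, ← map_smul]
        exact congrArg g (Subtype.ext (toRational_smul b w.1)) }
  have hprec := h.isPrecomplete
  rw [h.irreducible.maximalIdeal_eq] at hprec
  have hfin : Module.Finite O (fixed O k τ) :=
    hX.finite_fixedSubmodule (fun _ => rfl) (tau O k τ) tau_smul hprec
  have hfg : (LinearMap.range G).FG := by
    rw [← Submodule.map_top]
    exact hfin.fg_top.map G
  -- The fixed vectors are finitely generated over `O`, so their values under `g` have a common
  -- denominator, which may be taken to be a power of `π`.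
  obtain ⟨a, ha, haI⟩ := FractionalIdeal.isFractional_of_fg (S := nonZeroDivisors O) hfg
  obtain ⟨v, n, hv⟩ := h.exists_isUnit_mul_pow_eq (nonZeroDivisors.ne_zero ha)
  have hint : ∀ w, ∃ b, algebraMap O L b = algebraMap A O π ^ n • G w := by
    intro w
    obtain ⟨b, hb⟩ := haI _ ⟨w, rfl⟩
    refine ⟨v * b, ?_⟩
    rw [← hv, mul_smul, ← hb, map_mul, Algebra.smul_def]
  let g' : fixed O k τ →ₗ[O] O :=
    (LinearEquiv.ofInjective (Algebra.linearMap O L)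
      (IsFractionRing.injective O L)).symm.toLinearMap.comp
      (LinearMap.codRestrict _ (algebraMap A O π ^ n • G) hint)
  have hg' : ∀ w, algebraMap O L (g' w) = algebraMap A O π ^ n • G w := fun w =>
    congrArg Subtype.val (LinearEquiv.apply_symm_apply
      (LinearEquiv.ofInjective (Algebra.linearMap O L) (IsFractionRing.injective O L)) _)
  obtain ⟨β, hβ, hβ'⟩ := exists_extend_eq h hl hX g'
  refine ⟨n, β, hβ, LinearMap.ext fun t => ?_⟩
  -- It suffices to compare the two functionals on a multiple of `t` that comes from a fixed vector
  -- of the lattice.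
  obtain ⟨m, x, hx, hxt⟩ := exists_toRational_eq_of_mem h hX t
  have h0 : algebraMap O L (algebraMap A O π ^ m) ≠ 0 :=
    (map_ne_zero_iff _ (IsFractionRing.injective O L)).mpr (pow_ne_zero m h.irreducible.ne_zero)
  have h1 := hβ.algebraMap_functional_toRational h hl (toRational_mem hx)
  rw [hβ' ⟨x, hx⟩, CompletedTensor.ofInt_algebraMap,
    (h.isFrobeniusFixedField (Fq := Fq) (L := L) (k := k)).injective.eq_iff, hg', hxt, map_smul,
    Algebra.smul_def] at h1
  refine mul_left_cancel₀ h0 (h1.trans ?_)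
  change algebraMap A O π ^ n • g ⟨_, toRational_mem hx⟩ = _ * (_ * g t)
  rw [hxt, map_smul, smul_eq_mul, Algebra.smul_def, mul_left_comm]

end IsFrobeniusPairing

end Pairings

end

noncomputable section

attribute [local instance 10] tensorAlgebra

/-! ### Linearity and functoriality of the functional attached to a pairing. -/

section Pairings

variable {Fq A O L K k M : Type*} [Field Fq] [Fintype Fq] [CommRing A] [CommRing O] [IsDomain O]
variable [IsDiscreteValuationRing O] [Algebra A O] [Algebra Fq A] [Algebra Fq O]
variable [IsScalarTower Fq A O] [Field L] [Algebra O L] [IsFractionRing O L] [Algebra Fq L]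
variable [IsScalarTower Fq O L] [Field K] [Algebra Fq K] [Field k] [Algebra Fq k] [Algebra K k]
variable [IsScalarTower Fq K k] [AddCommGroup M] [Module (A ⊗[Fq] K) M]
variable {p : Ideal A} {π : A} (h : IsUniformizedCompletion p O π)
variable {l : FractionQuotient O L →ₗ[Fq] Fq} (hl : IsNondegenerateFunctional l)
variable {τ : M →ₛₗ[(coeffMap A (frob Fq K)).toRingHom] M}

namespace IsFrobeniusPairing

variable {β γ δ : M →+ (FractionQuotient O L →ₗ[Fq] k)} (hβ : IsFrobeniusPairing τ β)
variable (hγ : IsFrobeniusPairing τ γ) (hδ : IsFrobeniusPairing τ δ)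

/-- Sums and scalar multiples are treated at once, since the pairing attached to `b f + g` has
exactly this form. -/
lemma functional_eq_smul_add {b : O} (hb : ∀ m y, δ m y = β m (b • y) + γ m y) :
    hδ.functional h hl = algebraMap O L b • hβ.functional h hl + hγ.functional h hl := by
  have h1 : ∀ m, hδ.intFunctional h hl m =
      b • hβ.intFunctional h hl m + hγ.intFunctional h hl m := fun m =>
    eq_of_completedPairing_eq hl fun y => by
      rw [completedPairing_add_left, completedPairing_smul, completedPairing_intFunctional,
        completedPairing_intFunctional, completedPairing_intFunctional, hb]
  have h2 : ∀ n, hδ.ratFunctional h hl n = algebraMap L _ (algebraMap O L b) *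
      hβ.ratFunctional h hl n + hγ.ratFunctional h hl n := by
    intro n
    induction n using TensorProduct.induction_on with
    | zero => simp only [map_zero, mul_zero, add_zero]
    | add x y hx hy => rw [map_add, map_add, map_add, hx, hy]; ring
    | tmul e m =>
      rw [ratFunctional_tmul, ratFunctional_tmul, ratFunctional_tmul, h1, map_add, Algebra.smul_def,
        map_mul, CompletedTensor.ofInt_algebraMap]
      ring
  have h3 : ∀ t, slopeZeroTate.extend (hδ.ratFunctional h hl) t =
      algebraMap L _ (algebraMap O L b) * slopeZeroTate.extend (hβ.ratFunctional h hl) t +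
        slopeZeroTate.extend (hγ.ratFunctional h hl) t := by
    intro t
    induction t using TensorProduct.induction_on with
    | zero => simp only [map_zero, mul_zero, add_zero]
    | add x y hx hy => rw [map_add, map_add, map_add, hx, hy]; ring
    | tmul e n =>
      rw [slopeZeroTate.extend_tmul, slopeZeroTate.extend_tmul, slopeZeroTate.extend_tmul, h2]
      ring
  refine LinearMap.ext fun t =>
    (h.isFrobeniusFixedField (Fq := Fq) (L := L) (k := k)).injective ?_
  rw [LinearMap.add_apply, LinearMap.smul_apply, smul_eq_mul, map_add, map_mul]
  simp only [functional, slopeZeroTate.algebraMap_functional]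
  exact h3 t.1

variable {K' k' M' : Type*} [Field K'] [Algebra Fq K'] [Field k'] [Algebra Fq k'] [Algebra K' k']
variable [IsScalarTower Fq K' k'] [AddCommGroup M'] [Module (A ⊗[Fq] K') M']
variable {τ' : M' →ₛₗ[(coeffMap A (frob Fq K')).toRingHom] M'}
variable {β' : M' →+ (FractionQuotient O L →ₗ[Fq] k')} (hβ' : IsFrobeniusPairing τ' β')

lemma ratFunctional_tmul_of_comm {s : k →ₐ[Fq] k'} {m : M} {m' : M'}
    (hm : ∀ y, β' m' y = s (β m y)) {e : CompletedTensor Fq O L K} {e' : CompletedTensor Fq O L K'}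
    (he : algebraMap _ (CompletedTensor Fq O L k') e' =
      CompletedTensor.map Fq O L s (algebraMap _ (CompletedTensor Fq O L k) e)) :
    hβ'.ratFunctional h hl (e' ⊗ₜ m') =
      CompletedTensor.map Fq O L s (hβ.ratFunctional h hl (e ⊗ₜ m)) := by
  have h1 : hβ'.intFunctional h hl m' =
      CompletedTensor.mapInt Fq O s (hβ.intFunctional h hl m) :=
    eq_of_completedPairing_eq hl fun y => by
      rw [completedPairing_mapInt, completedPairing_intFunctional, completedPairing_intFunctional,
        hm]
  rw [ratFunctional_tmul, ratFunctional_tmul, map_mul, h1, CompletedTensor.map_ofInt, he]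

/-- By uniqueness in the duality, a compatibility of pairings, which is an identity in `k'`, passes
to the functionals with values in `L ⊗̂ k'`. -/
lemma ratFunctional_of_comm {s : k →ₐ[Fq] k'} {g : M → M'}
    (hg : ∀ m y, β' (g m) y = s (β m y)) {ρ : CompletedTensor Fq O L K → CompletedTensor Fq O L K'}
    (hρ : ∀ e, algebraMap _ (CompletedTensor Fq O L k') (ρ e) =
      CompletedTensor.map Fq O L s (algebraMap _ (CompletedTensor Fq O L k) e))
    (G : CompletedTensor Fq O L K ⊗[A ⊗[Fq] K] M →+ CompletedTensor Fq O L K' ⊗[A ⊗[Fq] K'] M')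
    (hG : ∀ e m, G (e ⊗ₜ m) = ρ e ⊗ₜ g m) (n : CompletedTensor Fq O L K ⊗[A ⊗[Fq] K] M) :
    hβ'.ratFunctional h hl (G n) = CompletedTensor.map Fq O L s (hβ.ratFunctional h hl n) := by
  induction n using TensorProduct.induction_on with
  | zero => simp only [map_zero]
  | add x y hx hy => rw [map_add, map_add, map_add, map_add, hx, hy]
  | tmul e m => rw [hG, ratFunctional_tmul_of_comm h hl hβ hβ' (hg m) (hρ e)]

end IsFrobeniusPairing

end Pairings

end

noncomputable section

attribute [local instance 10] tensorAlgebra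

open IsDedekindDomain

/-! ### The Tate module as the module of Frobenius equivariant pairings. -/

section TatePairing

variable {Fq : Type*} [Field Fq] [Fintype Fq]
variable {A : Type*} [CommRing A] [IsDedekindDomain A] [Algebra Fq A]
variable (F : Type*) [Field F] [Algebra A F] [IsFractionRing A F] (p : HeightOneSpectrum A)

/-- The `Fq`-algebra structure of `F_p`, through `A_p`. -/
@[reducible]
def adicCompletionAlgebra : Algebra Fq (p.adicCompletion F) :=
  ((algebraMap (p.adicCompletionIntegers F) (p.adicCompletion F)).comp
    (algebraMap Fq (p.adicCompletionIntegers F))).toAlgebra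

attribute [local instance] adicCompletionAlgebra

instance adicCompletion_isScalarTower :
    IsScalarTower Fq (p.adicCompletionIntegers F) (p.adicCompletion F) :=
  IsScalarTower.of_algebraMap_eq fun _ => rfl

variable {F p} in
lemma isUniformizedCompletion_adicCompletionIntegers [Algebra.FiniteType Fq A] {π : A}
    (hπ : p.intValuation π = WithZero.exp (-1 : ℤ)) :
    IsUniformizedCompletion p.asIdeal (p.adicCompletionIntegers F) π where
  irreducible := adicIntegers_irreducible hπ
  exists_sub_eq := adicIntegers_exists_sub_eq hπ
  mem_pow_iff := adicIntegers_mem_pow_iff hπ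
  isPrecomplete := inferInstance
  finite n := by
    have := p.isMaximal
    have := finite_quotient_of_isMaximal Fq p.asIdeal
    exact adicIntegers_finite_quotient F hπ n

namespace DrinfeldModule

variable {F p}
variable {K : Type*} [Field K] [Algebra Fq K] {r : ℕ} {φ : DrinfeldModule Fq A K r}
variable {Kb : Type*} [Field Kb] [Algebra Fq Kb] [Algebra K Kb] [IsScalarTower Fq K Kb]

lemma algebraMap_smul_localQuotient (a : A) (y : LocalQuotient F p) :
    algebraMap A (p.adicCompletionIntegers F) a • y = a • y :=
  algebraMap_smul _ a y

/-- The value of an element of the Tate module, as an element of `Kb`. -/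
def tateValue (f : TateModule F p (φ.Points Kb)) (y : LocalQuotient F p) : Kb :=
  (f y : φ.Points Kb)

lemma tateValue_add (f : TateModule F p (φ.Points Kb)) (y z : LocalQuotient F p) :
    tateValue f (y + z) = tateValue f y + tateValue f z :=
  congrArg Subtype.val (map_add f y z)

lemma tateValue_smul (f : TateModule F p (φ.Points Kb)) (a : A) (y : LocalQuotient F p) :
    tateValue f (a • y) = TwistedPoly.eval Kb (φ.toAlgHom a) (tateValue f y) :=
  congrArg Subtype.val (map_smul f a y)

lemma tateValue_const_smul (f : TateModule F p (φ.Points Kb)) (c : Fq) (y : LocalQuotient F p) :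
    tateValue f (c • y) = c • tateValue f y := by
  have h1 : c • y = algebraMap Fq A c • y := by
    rw [← algebraMap_smul_localQuotient, ← IsScalarTower.algebraMap_apply, algebraMap_smul]
  rw [h1, tateValue_smul, AlgHom.commutes, TwistedPoly.algebraMap_eq, TwistedPoly.C_eq_monomial,
    TwistedPoly.eval_monomial, pow_zero, pow_one, ← IsScalarTower.algebraMap_apply,
    ← Algebra.smul_def]

/-- The pairing of the motive with `F_p / A_p` defined by an element `f` of the Tate module: it maps
`m` and `y` to `m(f(y))`. -/
def tatePairing (f : TateModule F p (φ.Points Kb)) : φ.Motive →+ (LocalQuotient F p →ₗ[Fq] Kb) where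
  toFun m :=
    { toFun := fun y => TwistedPoly.eval Kb (Motive.toPoly φ m) (tateValue f y)
      map_add' := fun y z => by
        rw [tateValue_add, map_add]
      map_smul' := fun c y => by
        rw [tateValue_const_smul, LinearMap.map_smul, RingHom.id_apply] }
  map_zero' := LinearMap.ext fun y => by
    change TwistedPoly.eval Kb (Motive.toPoly φ 0) (tateValue f y) = 0
    rw [map_zero, map_zero, LinearMap.zero_apply]
  map_add' m m' := LinearMap.ext fun y => by
    change TwistedPoly.eval Kb (Motive.toPoly φ (m + m')) (tateValue f y) = _
    rw [map_add, map_add, LinearMap.add_apply]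
    rfl

lemma tatePairing_apply (f : TateModule F p (φ.Points Kb)) (m : φ.Motive) (y : LocalQuotient F p) :
    tatePairing f m y = TwistedPoly.eval Kb (Motive.toPoly φ m) (tateValue f y) := rfl

lemma isFrobeniusPairing_tatePairing (f : TateModule F p (φ.Points Kb)) :
    IsFrobeniusPairing (O := p.adicCompletionIntegers F) (L := p.adicCompletion F)
      (Motive.tau φ) (tatePairing f) where
  apply_smul a ξ m y := by
    rw [tatePairing_apply, tatePairing_apply, Motive.toPoly_smul, map_mul, map_mul,
      Module.End.mul_apply, Module.End.mul_apply, TwistedPoly.C_eq_monomial,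
      TwistedPoly.eval_monomial, pow_zero, pow_one, algebraMap_smul_localQuotient, tateValue_smul]
  apply_tau m y := by
    rw [tatePairing_apply, tatePairing_apply, Motive.toPoly_tau, map_mul, Module.End.mul_apply,
      TwistedPoly.tau, TwistedPoly.eval_monomial, map_one, one_mul, pow_one]

/-- The motive is generated by `1` under left multiplication by `K` and by `τ`, so an equivariant
pairing is determined by its values at `1`. -/
lemma apply_eq_eval {β : φ.Motive →+ (LocalQuotient F p →ₗ[Fq] Kb)}
    (hβ : IsFrobeniusPairing (O := p.adicCompletionIntegers F) (L := p.adicCompletion F)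
      (Motive.tau φ) β) (m : TwistedPoly Fq K) (y : LocalQuotient F p) :
    β ((Motive.toPoly φ).symm m) y =
      TwistedPoly.eval Kb m (β ((Motive.toPoly φ).symm 1) y) := by
  induction m using TwistedPoly.induction_on with
  | add f g hf hg => rw [map_add, map_add, LinearMap.add_apply, hf, hg, map_add]; rfl
  | mon n x =>
    have h1 : ∀ n, β ((Motive.toPoly φ).symm (TwistedPoly.tau ^ n)) y =
        β ((Motive.toPoly φ).symm 1) y ^ Fintype.card Fq ^ n := by
      intro n
      induction n with
      | zero => rw [pow_zero, pow_zero, pow_one]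
      | succ n ih =>
        rw [pow_succ (Fintype.card Fq), pow_mul, ← ih, ← hβ.apply_tau]
        congr 2
        exact (Motive.toPoly φ).injective (by
          rw [Motive.toPoly_tau, AddEquiv.apply_symm_apply, AddEquiv.apply_symm_apply, pow_succ'])
    have h2 : (Motive.toPoly φ).symm (TwistedPoly.monomial n x) =
        ((1 : A) ⊗ₜ[Fq] x) • (Motive.toPoly φ).symm (TwistedPoly.tau ^ n) :=
      (Motive.toPoly φ).injective (by
        rw [Motive.toPoly_smul, AddEquiv.apply_symm_apply, AddEquiv.apply_symm_apply, map_one,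
          mul_one, TwistedPoly.monomial_eq])
    rw [h2, hβ.apply_smul, map_one, one_smul, h1, TwistedPoly.eval_monomial]

/-- Every Frobenius equivariant pairing comes from an element of the Tate module. -/
lemma exists_tatePairing_eq {β : φ.Motive →+ (LocalQuotient F p →ₗ[Fq] Kb)}
    (hβ : IsFrobeniusPairing (O := p.adicCompletionIntegers F) (L := p.adicCompletion F)
      (Motive.tau φ) β) {π : A}
    (h : IsUniformizedCompletion p.asIdeal (p.adicCompletionIntegers F) π) :
    ∃ f : TateModule F p (φ.Points Kb), tatePairing f = β := by
  have hsmul : ∀ (a : A) (y : LocalQuotient F p), β ((Motive.toPoly φ).symm 1) (a • y) =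
      TwistedPoly.eval Kb (φ.toAlgHom a) (β ((Motive.toPoly φ).symm 1) y) := by
    intro a y
    have h1 := hβ.apply_smul a 1 ((Motive.toPoly φ).symm 1) y
    rw [map_one (algebraMap K Kb), one_mul, algebraMap_smul_localQuotient] at h1
    rw [← h1, ← apply_eq_eval hβ]
    congr 2
    exact (Motive.toPoly φ).injective (by
      rw [Motive.toPoly_smul, AddEquiv.apply_symm_apply, AddEquiv.apply_symm_apply, map_one,
        mul_one, one_mul])
  -- The element is `y ↦ β(1, y)`. It is `A`-linear because `(a ⊗ 1) • 1` is `φ_a`, and its values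
  -- are torsion because each `y` is killed by a power of `p`.
  let f : LocalQuotient F p →ₗ[A] primeTorsion p (φ.Points Kb) :=
    { toFun := fun y => ⟨(β ((Motive.toPoly φ).symm 1) y : Kb), by
        obtain ⟨n, hn⟩ := FractionQuotient.exists_pow_smul_eq_zero h.irreducible y
        refine ⟨n, fun b hb => ?_⟩
        obtain ⟨z, hz⟩ := (h.mem_pow_iff n b).mpr hb
        refine (hsmul b y).symm.trans ?_
        rw [← algebraMap_smul_localQuotient, ← hz, mul_comm, mul_smul, hn, smul_zero, map_zero]
        rfl⟩
      map_add' := fun y z => Subtype.ext (map_add (β ((Motive.toPoly φ).symm 1)) y z)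
      map_smul' := fun a y => Subtype.ext (hsmul a y) }
  refine ⟨f, AddMonoidHom.ext fun m => LinearMap.ext fun y => ?_⟩
  exact (apply_eq_eval hβ (Motive.toPoly φ m) y).symm

end DrinfeldModule

end TatePairing

end

noncomputable section

attribute [local instance 10] tensorAlgebra

open IsDedekindDomain

attribute [local instance] adicCompletionAlgebra

/-! ### The comparison map and its bijectivity. -/

namespace DrinfeldModule

variable {Fq : Type*} [Field Fq] [Fintype Fq]
variable {A : Type*} [CommRing A] [IsDedekindDomain A] [Algebra Fq A]
variable {F : Type*} [Field F] [Algebra A F] [IsFractionRing A F] {p : HeightOneSpectrum A}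
variable {K : Type*} [Field K] [Algebra Fq K] {r : ℕ} {φ : DrinfeldModule Fq A K r}
variable {Kb : Type*} [Field Kb] [Algebra Fq Kb] [Algebra K Kb] [IsScalarTower Fq K Kb]
variable {π : A} (h : IsUniformizedCompletion p.asIdeal (p.adicCompletionIntegers F) π)
variable {l : LocalQuotient F p →ₗ[Fq] Fq}
variable (hl : IsNondegenerateFunctional (O := p.adicCompletionIntegers F)
  (L := p.adicCompletion F) l)

section Functional

/-- The semilinear functional on the isocrystal defined by an element of the Tate module. -/
def isocrystalFunctional (f : TateModule F p (φ.Points Kb)) : φ.Isocrystal F p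
    →ₛₗ[algebraMap (IsocrystalRing Fq F p K) (IsocrystalRing Fq F p Kb)]
      IsocrystalRing Fq F p Kb :=
  (isFrobeniusPairing_tatePairing f).ratFunctional h hl

lemma isocrystalFunctional_tau (f : TateModule F p (φ.Points Kb)) (n : φ.Isocrystal F p) :
    isocrystalFunctional h hl f (Isocrystal.tau F p φ n) =
      partialFrob Fq (p.adicCompletionIntegers F) (p.adicCompletion F) Kb
        (isocrystalFunctional h hl f n) :=
  (isFrobeniusPairing_tatePairing f).ratFunctional_tau h hl n

/-- The functional on the slope zero Tate module defined by an element of the Tate module. -/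
def tateFunctional (f : TateModule F p (φ.Points Kb)) :
    Module.Dual (p.adicCompletion F) (φ.T0 F p Kb) :=
  slopeZeroTate.functional h.isFrobeniusFixedField (isocrystalFunctional h hl f)
    (isocrystalFunctional_tau h hl f)

lemma tatePairing_smul_add (b : p.adicCompletionIntegers F) (f g : TateModule F p (φ.Points Kb))
    (m : φ.Motive) (y : LocalQuotient F p) :
    tatePairing (b • f + g) m y = tatePairing f m (b • y) + tatePairing g m y := by
  rw [tatePairing_apply, tatePairing_apply, tatePairing_apply, ← map_add]
  rfl

lemma tateFunctional_smul_add (b : p.adicCompletionIntegers F)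
    (f g : TateModule F p (φ.Points Kb)) : tateFunctional h hl (b • f + g) =
      algebraMap _ (p.adicCompletion F) b • tateFunctional h hl f + tateFunctional h hl g :=
  IsFrobeniusPairing.functional_eq_smul_add h hl _ _ _ (tatePairing_smul_add b f g)

/-- The map from the Tate module to the dual of the slope zero Tate module. -/
def tateFunctionalHom : TateModule F p (φ.Points Kb) →ₗ[p.adicCompletionIntegers F]
    Module.Dual (p.adicCompletion F) (φ.T0 F p Kb) where
  toFun := tateFunctional h hl
  map_add' f g := by
    have h1 := tateFunctional_smul_add h hl 1 f g
    rwa [one_smul, map_one, one_smul] at h1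
  map_smul' b f := by
    -- Taking `b = 1` and `f = g = 0` shows that zero is sent to zero, which then isolates the
    -- scalar multiple.
    have h1 := tateFunctional_smul_add h hl 1 (0 : TateModule F p (φ.Points Kb)) 0
    rw [one_smul, map_one, one_smul, add_zero, left_eq_add] at h1
    have h2 := tateFunctional_smul_add h hl b f 0
    rwa [add_zero, h1, add_zero, algebraMap_smul] at h2

lemma tatePairing_injective :
    Function.Injective (tatePairing : TateModule F p (φ.Points Kb) → _) := by
  intro f g hfg
  refine TateModule.ext fun y => Subtype.ext ?_
  have h1 := LinearMap.congr_fun (DFunLike.congr_fun hfg ((Motive.toPoly φ).symm 1)) y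
  rw [tatePairing_apply, tatePairing_apply, AddEquiv.apply_symm_apply, map_one] at h1
  exact h1

/-- The map from the rational Tate module to the dual of the slope zero Tate module. -/
def rationalTateFunctional :
    φ.V F p Kb →ₗ[p.adicCompletion F] Module.Dual (p.adicCompletion F) (φ.T0 F p Kb) :=
  (tateFunctionalHom h hl).liftBaseChange (p.adicCompletion F)

lemma rationalTateFunctional_tmul (c : p.adicCompletion F) (f : TateModule F p (φ.Points Kb)) :
    rationalTateFunctional h hl (c ⊗ₜ f) = c • tateFunctional h hl f :=
  LinearMap.liftBaseChange_tmul _ _ _ _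

theorem rationalTateFunctional_bijective [Algebra.FiniteType Fq A] [IsAlgClosed Kb] (hr : 1 ≤ r) :
    Function.Bijective (rationalTateFunctional (φ := φ) (Kb := Kb) h hl) := by
  have hπ0 : π ≠ 0 := by
    rintro rfl
    exact h.irreducible.ne_zero (map_zero _)
  have hπu : ¬ IsUnit π := fun hu => p.isPrime.ne_top (Ideal.eq_top_of_isUnit_mem _ h.mem hu)
  have := Motive.finite φ hr hπ0 hπu
  have hX : IsFrobeniusLattice Fq Kb (X := CompletedModule Fq A (p.adicCompletionIntegers F) Kb K
      φ.Motive) (algebraMap A (p.adicCompletionIntegers F) π) :=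
    h.isFrobeniusLattice fun m hm => Motive.eq_zero_of_smul φ hπ0 hm
  constructor
  · rw [injective_iff_map_eq_zero]
    intro v hv
    -- Up to a nonzero scalar, a vector of the rational Tate module comes from the Tate module
    -- itself.
    obtain ⟨⟨f, s⟩, hs⟩ := IsLocalizedModule.surj (nonZeroDivisors (p.adicCompletionIntegers F))
      (TensorProduct.mk (p.adicCompletionIntegers F) (p.adicCompletion F)
        (TateModule F p (φ.Points Kb)) 1) v
    have hs0 : algebraMap (p.adicCompletionIntegers F) (p.adicCompletion F) s ≠ 0 :=
      IsFractionRing.to_map_ne_zero_of_mem_nonZeroDivisors s.2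
    have hs' : algebraMap (p.adicCompletionIntegers F) (p.adicCompletion F) s • v =
        1 ⊗ₜ f := (algebraMap_smul _ _ _).trans hs
    have h1 : tateFunctional h hl f = 0 := by
      rw [← one_smul (p.adicCompletion F) (tateFunctional h hl f), ← rationalTateFunctional_tmul,
        ← hs', map_smul, hv, smul_zero]
    have h2 : tatePairing f = 0 :=
      (isFrobeniusPairing_tatePairing f).eq_zero_of_functional_eq_zero h hl hX h1
    have h3 : f = 0 := tatePairing_injective (h2.trans (by
      refine AddMonoidHom.ext fun m => LinearMap.ext fun y => ?_
      exact (map_zero (TwistedPoly.eval Kb (Motive.toPoly φ m))).symm))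
    rw [h3, TensorProduct.tmul_zero] at hs'
    exact (smul_eq_zero.mp hs').resolve_left hs0
  · intro g
    obtain ⟨n, β, hβ, hg⟩ := IsFrobeniusPairing.exists_functional_eq (τ := Motive.tau φ) h hl hX g
    obtain ⟨f, rfl⟩ := exists_tatePairing_eq hβ h
    refine ⟨(algebraMap (p.adicCompletionIntegers F) (p.adicCompletion F)
      (algebraMap A (p.adicCompletionIntegers F) π ^ n))⁻¹ ⊗ₜ f, ?_⟩
    have h0 : algebraMap (p.adicCompletionIntegers F) (p.adicCompletion F)
        (algebraMap A (p.adicCompletionIntegers F) π ^ n) ≠ 0 :=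
      (map_ne_zero_iff _ (IsFractionRing.injective _ _)).mpr (pow_ne_zero n h.irreducible.ne_zero)
    rw [rationalTateFunctional_tmul]
    refine (congrArg _ hg).trans ?_
    exact inv_smul_smul₀ h0 g

end Functional

end DrinfeldModule

end

noncomputable section

attribute [local instance 10] tensorAlgebra

open IsDedekindDomain

attribute [local instance] adicCompletionAlgebra

/-! ### Compatibility of the functionals with Galois, homomorphisms and field extensions. -/

namespace DrinfeldModule

variable {Fq : Type*} [Field Fq] [Fintype Fq]
variable {A : Type*} [CommRing A] [IsDedekindDomain A] [Algebra Fq A]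
variable {F : Type*} [Field F] [Algebra A F] [IsFractionRing A F] {p : HeightOneSpectrum A}
variable {K : Type*} [Field K] [Algebra Fq K] {r : ℕ} {φ : DrinfeldModule Fq A K r}
variable {Kb : Type*} [Field Kb] [Algebra Fq Kb] [Algebra K Kb] [IsScalarTower Fq K Kb]
variable {π : A} (h : IsUniformizedCompletion p.asIdeal (p.adicCompletionIntegers F) π)
variable {l : LocalQuotient F p →ₗ[Fq] Fq}
variable (hl : IsNondegenerateFunctional (O := p.adicCompletionIntegers F)
  (L := p.adicCompletion F) l)

lemma map_restrictScalars_algebraMap {O L : Type*} [CommRing O] [IsLocalRing O] [CommRing L]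
    [Algebra Fq O] [Algebra O L] (γ : Kb ≃ₐ[K] Kb) (e : CompletedTensor Fq O L K) :
    algebraMap _ (CompletedTensor Fq O L Kb) e = CompletedTensor.map Fq O L
      (γ.toAlgHom.restrictScalars Fq) (algebraMap _ (CompletedTensor Fq O L Kb) e) := by
  rw [CompletedTensor.baseChange_algebraMap, CompletedTensor.map_map]
  congr 2
  ext y
  exact (γ.commutes y).symm

lemma tatePairing_galois (γ : Kb ≃ₐ[K] Kb) (f : TateModule F p (φ.Points Kb)) (m : φ.Motive)
    (y : LocalQuotient F p) : tatePairing (TateModule.map F p (Points.galois φ γ) f) m y =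
      γ.toAlgHom.restrictScalars Fq (tatePairing f m y) := by
  have h1 : ∀ f : TwistedPoly Fq K, TwistedPoly.map (AlgHom.id Fq K) f = f := by
    intro f
    induction f using TwistedPoly.induction_on with
    | add f g hf hg => rw [map_add, hf, hg]
    | mon n x => rw [TwistedPoly.map_monomial]; rfl
  rw [tatePairing_apply, tatePairing_apply, TwistedPoly.eval_map (AlgHom.id Fq K)
    (γ.toAlgHom.restrictScalars Fq) (fun x => γ.commutes x), h1]
  rfl

/-- Applying `γ` to both `f` and `t` applies `γ` to the value, which lies in `F_p` and is therefore
unchanged. -/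
lemma tateFunctional_galois (γ : Kb ≃ₐ[K] Kb) (f : TateModule F p (φ.Points Kb))
    (t : φ.T0 F p Kb) :
    tateFunctional h hl (TateModule.map F p (Points.galois φ γ) f) (T0.galoisRep F p Kb φ γ t) =
      tateFunctional h hl f t :=
  slopeZeroTate.functional_map h.isFrobeniusFixedField h.isFrobeniusFixedField
    (isocrystalFunctional_tau h hl _) (isocrystalFunctional_tau h hl _)
    (CompletedTensor.map Fq _ _ (γ.toAlgHom.restrictScalars Fq)) (ρ := RingHom.id _)
    (fun e => (map_restrictScalars_algebraMap γ e).symm) (partialFrob_comm _) LinearMap.id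
    (fun _ => rfl)
    (IsFrobeniusPairing.ratFunctional_of_comm h hl (isFrobeniusPairing_tatePairing f)
      (isFrobeniusPairing_tatePairing _) (g := id) (tatePairing_galois γ f) (ρ := id)
      (map_restrictScalars_algebraMap γ) (AddMonoidHom.id _) (fun _ _ => rfl)) t

variable {ψ : DrinfeldModule Fq A K r}

lemma tatePairing_mapHom {u : TwistedPoly Fq K} (hu : φ.IsHom ψ u)
    (f : TateModule F p (φ.Points Kb)) (m : ψ.Motive) (y : LocalQuotient F p) :
    tatePairing f (Motive.mapHom hu m) y =
      tatePairing (TateModule.map F p (Points.mapHom Kb hu) f) m y := by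
  rw [tatePairing_apply, tatePairing_apply, Motive.toPoly_mapHom, map_mul]
  rfl

lemma isocrystalFunctional_mapHom {u : TwistedPoly Fq K} (hu : φ.IsHom ψ u)
    (f : TateModule F p (φ.Points Kb)) (n : ψ.Isocrystal F p) :
    isocrystalFunctional h hl f (Isocrystal.mapHom F p hu n) =
      isocrystalFunctional h hl (TateModule.map F p (Points.mapHom Kb hu) f) n := by
  have h1 := IsFrobeniusPairing.ratFunctional_of_comm h hl (isFrobeniusPairing_tatePairing
      (TateModule.map F p (Points.mapHom Kb hu) f))
    (isFrobeniusPairing_tatePairing f) (s := AlgHom.id Fq Kb) (g := Motive.mapHom hu)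
    (tatePairing_mapHom hu f) (ρ := id) (fun _ => (CompletedTensor.map_id _ _ _ _).symm)
    (Isocrystal.mapHom F p hu).toAddMonoidHom (fun _ _ => rfl) n
  rw [CompletedTensor.map_id] at h1
  exact h1

lemma tateFunctional_mapHom {u : TwistedPoly Fq K} (hu : φ.IsHom ψ u)
    (f : TateModule F p (φ.Points Kb)) (t : ψ.T0 F p Kb) :
    tateFunctional h hl f (T0.mapHom F p hu t) =
      tateFunctional h hl (TateModule.map F p (Points.mapHom Kb hu) f) t := by
  have h1 := slopeZeroTate.functional_map (τ := Isocrystal.tau F p ψ) (τ' := Isocrystal.tau F p φ)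
    h.isFrobeniusFixedField h.isFrobeniusFixedField
    (isocrystalFunctional_tau h hl (TateModule.map F p (Points.mapHom Kb hu) f))
    (isocrystalFunctional_tau h hl f)
    (AlgHom.id _ _) (ρ := RingHom.id _) (fun _ => rfl) (fun _ => rfl) (Isocrystal.mapHom F p hu)
    (Isocrystal.mapHom_tau F p hu) (isocrystalFunctional_mapHom h hl hu f) t
  exact h1

variable {K' : Type*} [Field K'] [Algebra Fq K']
variable {Kb' : Type*} [Field Kb'] [Algebra Fq Kb'] [Algebra K' Kb'] [IsScalarTower Fq K' Kb']
variable {φ' : DrinfeldModule Fq A K' r}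

lemma tatePairing_mapField {i : K →ₐ[Fq] K'} (ib : Kb →ₐ[Fq] Kb')
    (hib : ∀ x : K, ib (algebraMap K Kb x) = algebraMap K' Kb' (i x))
    (hφ : φ.IsBaseChange φ' i) (f : TateModule F p (φ.Points Kb)) (m : φ.Motive)
    (y : LocalQuotient F p) :
    tatePairing (TateModule.map F p (Points.mapField ib hib hφ) f) (Motive.mapField hφ m) y =
      ib (tatePairing f m y) := by
  rw [tatePairing_apply, tatePairing_apply, TwistedPoly.eval_map i ib hib, Motive.toPoly_mapField]
  rfl

lemma map_algebraMap_of_comm {O L : Type*} [CommRing O] [IsLocalRing O] [CommRing L]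
    [Algebra Fq O] [Algebra O L] {i : K →ₐ[Fq] K'} (ib : Kb →ₐ[Fq] Kb')
    (hib : ∀ x : K, ib (algebraMap K Kb x) = algebraMap K' Kb' (i x))
    (e : CompletedTensor Fq O L K) :
    algebraMap _ (CompletedTensor Fq O L Kb') (CompletedTensor.map Fq O L i e) =
      CompletedTensor.map Fq O L ib (algebraMap _ (CompletedTensor Fq O L Kb) e) := by
  rw [CompletedTensor.baseChange_algebraMap, CompletedTensor.baseChange_algebraMap,
    CompletedTensor.map_map, CompletedTensor.map_map]
  congr 2
  ext y
  exact (hib y).symm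

lemma tateFunctional_mapField {i : K →ₐ[Fq] K'} (ib : Kb →ₐ[Fq] Kb')
    (hib : ∀ x : K, ib (algebraMap K Kb x) = algebraMap K' Kb' (i x))
    (hφ : φ.IsBaseChange φ' i) (f : TateModule F p (φ.Points Kb)) (t : φ.T0 F p Kb) :
    tateFunctional h hl (TateModule.map F p (Points.mapField ib hib hφ) f)
      (T0.mapField F p ib hib hφ t) = tateFunctional h hl f t :=
  slopeZeroTate.functional_map h.isFrobeniusFixedField h.isFrobeniusFixedField
    (isocrystalFunctional_tau h hl _) (isocrystalFunctional_tau h hl _)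
    (CompletedTensor.map Fq _ _ ib) (fun e => (map_algebraMap_of_comm ib hib e).symm)
    (partialFrob_comm ib) (Isocrystal.mapField F p hφ) (Isocrystal.mapField_tau F p hφ)
    (IsFrobeniusPairing.ratFunctional_of_comm h hl (isFrobeniusPairing_tatePairing f)
      (isFrobeniusPairing_tatePairing _) (g := Motive.mapField hφ)
      (tatePairing_mapField ib hib hφ f) (map_algebraMap_of_comm ib hib)
      (Isocrystal.mapField F p hφ).toAddMonoidHom (fun _ _ => rfl)) t

end DrinfeldModule

end

noncomputable section

attribute [local instance 10] tensorAlgebra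

open IsDedekindDomain

attribute [local instance] adicCompletionAlgebra

/-! ### The comparison isomorphism and its naturality. -/

namespace DrinfeldModule

variable {Fq : Type*} [Field Fq] [Fintype Fq]
variable {A : Type*} [CommRing A] [IsDedekindDomain A] [Algebra Fq A]
variable {F : Type*} [Field F] [Algebra A F] [IsFractionRing A F] {p : HeightOneSpectrum A}
variable {K : Type*} [Field K] [Algebra Fq K] {r : ℕ} {φ : DrinfeldModule Fq A K r}
variable {Kb : Type*} [Field Kb] [Algebra Fq Kb] [Algebra K Kb] [IsScalarTower Fq K Kb]
variable {π : A} (h : IsUniformizedCompletion p.asIdeal (p.adicCompletionIntegers F) π)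
variable {l : LocalQuotient F p →ₗ[Fq] Fq}
variable (hl : IsNondegenerateFunctional (O := p.adicCompletionIntegers F)
  (L := p.adicCompletion F) l)

variable [Algebra.FiniteType Fq A] [IsAlgClosed Kb]

/-- The isomorphism of the rational Tate module with the dual of the slope zero Tate module, twisted
by the differentials. It depends on the choice of the uniformizer `π` and of the functional `l`,
but not on the Drinfeld module. -/
def tateEquiv (hπ : p.intValuation π = WithZero.exp (-1 : ℤ)) (hr : 1 ≤ r) :
    φ.V F p Kb ≃ₗ[p.adicCompletion F] φ.DualT0Omega F p Kb :=
  (LinearEquiv.ofBijective _ (rationalTateFunctional_bijective h hl hr)).trans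
    (LinearEquiv.ofBijective
      { toFun := fun t => t ⊗ₜ[A] KaehlerDifferential.D Fq A π
        map_add' := fun t u => TensorProduct.add_tmul t u _
        map_smul' := fun c t => (TensorProduct.smul_tmul' c t _).symm }
      (bijective_tmul_differential Fq hπ F (p.adicCompletion F) _))

lemma tateEquiv_apply (hπ : p.intValuation π = WithZero.exp (-1 : ℤ)) (hr : 1 ≤ r)
    (x : φ.V F p Kb) : tateEquiv h hl hπ hr x =
      rationalTateFunctional h hl x ⊗ₜ[A] KaehlerDifferential.D Fq A π := rfl

omit [Algebra.FiniteType Fq A] [IsAlgClosed Kb]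

lemma rationalTateFunctional_galois (γ : Kb ≃ₐ[K] Kb) (x : φ.V F p Kb) :
    rationalTateFunctional h hl (V.galoisRep F p φ Kb γ x) =
      (T0.galoisRep F p Kb φ).dual γ (rationalTateFunctional h hl x) := by
  induction x using TensorProduct.induction_on with
  | zero => simp only [map_zero]
  | add x y hx hy => simp only [map_add, hx, hy]
  | tmul c f =>
    have h1 : V.galoisRep F p φ Kb γ (c ⊗ₜ f) = c ⊗ₜ TateModule.map F p (Points.galois φ γ) f := rfl
    rw [h1, rationalTateFunctional_tmul, rationalTateFunctional_tmul, map_smul]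
    congr 1
    refine LinearMap.ext fun t => ?_
    -- The contragredient action evaluates at `γ⁻¹ t`, so invariance is used at this vector.
    have h2 := tateFunctional_galois h hl γ f ((T0.galoisRep F p Kb φ) γ⁻¹ t)
    rw [Representation.self_inv_apply] at h2
    exact h2

variable {ψ : DrinfeldModule Fq A K r}

lemma rationalTateFunctional_mapHom {u : TwistedPoly Fq K} (hu : φ.IsHom ψ u) (x : φ.V F p Kb) :
    rationalTateFunctional h hl (V.mapHom F p hu x) =
      (T0.mapHom F p hu).dualMap (rationalTateFunctional h hl x) := by
  induction x using TensorProduct.induction_on with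
  | zero => simp only [map_zero]
  | add x y hx hy => simp only [map_add, hx, hy]
  | tmul c f =>
    have h1 : V.mapHom F p hu (c ⊗ₜ f) = c ⊗ₜ TateModule.map F p (Points.mapHom Kb hu) f := rfl
    rw [h1, rationalTateFunctional_tmul, rationalTateFunctional_tmul, map_smul]
    congr 1
    exact LinearMap.ext fun t => (tateFunctional_mapHom h hl hu f t).symm

variable {K' : Type*} [Field K'] [Algebra Fq K']
variable {Kb' : Type*} [Field Kb'] [Algebra Fq Kb'] [Algebra K' Kb'] [IsScalarTower Fq K' Kb']
variable {φ' : DrinfeldModule Fq A K' r}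

lemma rationalTateFunctional_mapField {i : K →ₐ[Fq] K'} (ib : Kb →ₐ[Fq] Kb')
    (hib : ∀ x : K, ib (algebraMap K Kb x) = algebraMap K' Kb' (i x))
    (hφ : φ.IsBaseChange φ' i) (x : φ.V F p Kb) :
    (T0.mapField F p ib hib hφ).dualMap (rationalTateFunctional h hl (V.mapField F p ib hib hφ x)) =
      rationalTateFunctional h hl x := by
  induction x using TensorProduct.induction_on with
  | zero => simp only [map_zero]
  | add x y hx hy => simp only [map_add, hx, hy]
  | tmul c f =>
    have h1 : V.mapField F p ib hib hφ (c ⊗ₜ f) =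
      c ⊗ₜ TateModule.map F p (Points.mapField ib hib hφ) f := rfl
    rw [h1, rationalTateFunctional_tmul, rationalTateFunctional_tmul, map_smul]
    congr 1
    exact LinearMap.ext fun t => tateFunctional_mapField h hl ib hib hφ f t

end DrinfeldModule

end

-- The theorem.

universe u w

theorem proposition15p6
    {Fq : Type*} [Field Fq] [Fintype Fq]
    {A : Type*} [CommRing A] [IsDedekindDomain A] [Algebra Fq A] [Algebra.FiniteType Fq A]
    {F : Type*} [Field F] [Algebra A F] [IsFractionRing A F]
    (_hA : HasUniquePlaceAtInfinity A F)
    (p : IsDedekindDomain.HeightOneSpectrum A) (r : ℕ) (_hr : 1 ≤ r) :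
    ∃ Φ : ∀ (K : Type u) (Kb : Type w) [Field K] [Field Kb] [Algebra Fq K] [Algebra Fq Kb]
        [Algebra K Kb] [IsScalarTower Fq K Kb] [IsAlgClosure K Kb] (φ : DrinfeldModule Fq A K r),
        φ.V F p Kb ≃ₗ[p.adicCompletion F] φ.DualT0Omega F p Kb,
      -- equivariance under the Galois group
      (∀ (K : Type u) (Kb : Type w) [Field K] [Field Kb] [Algebra Fq K] [Algebra Fq Kb]
        [Algebra K Kb] [IsScalarTower Fq K Kb] [IsAlgClosure K Kb] (φ : DrinfeldModule Fq A K r)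
        (γ : Kb ≃ₐ[K] Kb) (x : φ.V F p Kb),
        Φ K Kb φ (DrinfeldModule.V.galoisRep F p φ Kb γ x) =
          DrinfeldModule.DualT0Omega.galois F p Kb φ γ (Φ K Kb φ x)) ∧
      -- naturality in homomorphisms of Drinfeld modules over a field
      (∀ (K : Type u) (Kb : Type w) [Field K] [Field Kb] [Algebra Fq K] [Algebra Fq Kb]
        [Algebra K Kb] [IsScalarTower Fq K Kb] [IsAlgClosure K Kb]
        (φ ψ : DrinfeldModule Fq A K r) (u : TwistedPoly Fq K) (hu : φ.IsHom ψ u)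
        (x : φ.V F p Kb),
        Φ K Kb ψ (DrinfeldModule.V.mapHom F p hu x) =
          DrinfeldModule.DualT0Omega.mapHom F p hu (Φ K Kb φ x)) ∧
      -- naturality in extensions of the field of definition and its algebraic closure
      (∀ (K K' : Type u) (Kb Kb' : Type w) [Field K] [Field Kb] [Algebra Fq K] [Algebra Fq Kb]
        [Algebra K Kb] [IsScalarTower Fq K Kb] [IsAlgClosure K Kb]
        [Field K'] [Field Kb'] [Algebra Fq K'] [Algebra Fq Kb']
        [Algebra K' Kb'] [IsScalarTower Fq K' Kb'] [IsAlgClosure K' Kb']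
        (i : K →ₐ[Fq] K') (ib : Kb →ₐ[Fq] Kb')
        (hib : ∀ x : K, ib (algebraMap K Kb x) = algebraMap K' Kb' (i x))
        (φ : DrinfeldModule Fq A K r) (φ' : DrinfeldModule Fq A K' r)
        (hφ : φ.IsBaseChange φ' i) (x : φ.V F p Kb),
        DrinfeldModule.DualT0Omega.mapField F p ib hib hφ
          (Φ K' Kb' φ' (DrinfeldModule.V.mapField F p ib hib hφ x)) = Φ K Kb φ x) := by
  let := adicCompletionAlgebra (Fq := Fq) F p
  -- The uniformizer and the functional `l` are fixed before any field or Drinfeld module is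
  -- considered; this makes the isomorphisms natural across all of them.
  obtain ⟨π, hπ⟩ := p.intValuation_exists_uniformizer
  have h := isUniformizedCompletion_adicCompletionIntegers (F := F) (Fq := Fq) hπ
  obtain ⟨l, hl⟩ := exists_isNondegenerateFunctional Fq (p.adicCompletionIntegers F)
    (p.adicCompletion F)
  refine ⟨fun K Kb _ _ _ _ _ _ _ φ =>
    have := IsAlgClosure.isAlgClosed K (K := Kb)
    DrinfeldModule.tateEquiv h hl hπ _hr, ?_, ?_, ?_⟩
  · intro K Kb _ _ _ _ _ _ _ φ γ x
    -- The action on the differentials is trivial and fixes `dπ`, so only the first tensor factor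
    -- has to be compared.
    simp only [DrinfeldModule.tateEquiv_apply, DrinfeldModule.rationalTateFunctional_galois]
    rfl
  · intro K Kb _ _ _ _ _ _ _ φ ψ u hu x
    simp only [DrinfeldModule.tateEquiv_apply, DrinfeldModule.rationalTateFunctional_mapHom]
    rfl
  · intro K K' Kb Kb' _ _ _ _ _ _ _ _ _ _ _ _ _ _ i ib hib φ φ' hφ x
    simp only [DrinfeldModule.tateEquiv_apply]
    exact congrArg (fun t => t ⊗ₜ[A] KaehlerDifferential.D Fq A π)
      (DrinfeldModule.rationalTateFunctional_mapField h hl ib hib hφ x)
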